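/- Let $\mathfrak g$ be a real semisimple Lie algebra (complex semisimple Lie algebras are included, viewed as real ones), and let $\mathfrak q\subset\mathfrak p\subset\mathfrak g$ be two nested standard parabolic subalgebras, determined by sets $\Sigma_{\mathfrak p}\subset\Sigma_{\mathfrak q}$ of simple restricted roots. Let $\mathfrak g_{(i',i'')}$ be the sum of the (restricted) root spaces for which the $\Sigma_{\mathfrak p}$-height is $i'$ and the $\Sigma_{\mathfrak q}$-height is $i'+i''$ (the centralizer of the maximal split abelian subspace being put into $\mathfrak g_{(0,0)}$), and put $\mathfrak g^{(i',*)}=\bigoplus_{j'\ge i',\,j''}\mathfrak g_{(j',j'')}$, so that $\mathfrak p=\mathfrak g^{(0,*)}$ and $\mathfrak q=\bigoplus_{i',i''\ge 0}\mathfrak g_{(i',i'')}$. Let $G$ be a Lie group with Lie algebra $\mathfrak g$, let $P\subset G$ be a subgroup that lies between the normalizer $N_G(\mathfrak p)$ and its identity component, and let $Q\subset P$ be a Lie subgroup with Lie algebra $\mathfrak q$ that lies between $N_P(\mathfrak q)$ and its identity component. Let $(p\colon\mathcal G\to M,\omega)$ be a Cartan geometry of type $(G,Q)$ with curvature $\kappa$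 and torsion $\tau\in\Omega^2(M,TM)$ (the projection of $\kappa$ to $TM\cong\mathcal G\times_Q(\mathfrak g/\mathfrak q)$). For $i'\le 0$ let $T^{i'}_PM=\mathcal G\times_Q(\mathfrak g^{(i',*)}/\mathfrak q)\subset TM$, put $T_\rho M=T^0_PM$, and for $i'<0$ let $\mathcal V_{i'}M=T^{i'}_PM/T^{i'+1}_PM\cong\mathcal G\times_Q\mathbb V_{i'}$, where $\mathbb V_{i'}=\mathfrak g^{(i',*)}/\mathfrak g^{(i'+1,*)}$. The relative tractor connection on $\mathcal V_{i'}M$ is the partial connection $\nabla^\rho\colon\Gamma(T_\rho M)\times\Gamma(\mathcal V_{i'}M)\to\Gamma(\mathcal V_{i'}M)$ that is given, in terms of $Q$-equivariant functions $f\colon\mathcal G\to\mathbb V_{i'}$, by $(\nabla^\rho_\xi f)(u)=df_u(w)+\omega_u(w)\bullet f(u)$ for any $w\in T_u\mathcal G$ with $\omega_u(w)\in\mathfrak p$ and $T_up\cdot w=\xi(p(u))$, where $\bullet$ is induced by the adjoint action of $\mathfrak p$. Assume that $T_\rho M$ is involutive, and let $\psi\colon U\to N$ be a local leaf space with connected fibers,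 i.e. $U\subset M$ is open and $\psi$ is a surjective submersion onto a smooth manifold $N$ with connected fibers and with $\ker T_y\psi=(T_\rho M)_y$ for all $y\in U$. Fix an integer $i'<0$. (1) There is a smooth subbundle $T^{i'}N\subset TN$ that corresponds to $T^{i'}_PM/T_\rho M|_U$ under the isomorphism $(TM/T_\rho M)|_U\cong\psi^*TN$ induced by $T\psi$ if and only if, over $U$, $\tau(T_\rho M,T^{i'}_PM)\subset T^{i'}_PM$. (2) If over $U$ one has $\tau(T_\rho M,T^{i'}_PM)\subset T^{i'}_PM$ and $\tau(T_\rho M,T^{i'+1}_PM)\subset T^{i'+1}_PM$, so that both $T^{i'}N$ and $T^{i'+1}N$ exist (with $T^0N=0$), then $T\psi$ induces an isomorphism of smooth vector bundles $\mathcal V_{i'}M|_U\cong\psi^*(T^{i'}N/T^{i'+1}N)$. If over $U$ even $\tau(T_\rho M,T^{i'}_PM)\subset T^{i'+1}_PM$ (which implies both of these conditions), then a smooth section of $\mathcal V_{i'}M|_U$ is parallel for the relative tractor connection if and only if, under this isomorphism, it is the pullback of a smooth section of $T^{i'}N/T^{i'+1}N$ over $N$. -/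

import Mathlib

open scoped Manifold ContDiff

noncomputable section

namespace RelBGG

/-! ### Linear algebra: subquotients -/

/-- The subquotient `F / F'` of a vector space (used for `F' ≤ F`). -/
abbrev SubQuot {V : Type*} [AddCommGroup V] [Module ℝ V] (F F' : Submodule ℝ V) : Type _ :=
  ↥F ⧸ F'.submoduleOf F

/-- The class in `F / F'` of an element of `F`. -/
abbrev SubQuot.mk {V : Type*} [AddCommGroup V] [Module ℝ V] {F : Submodule ℝ V}
    (F' : Submodule ℝ V) (v : F) : SubQuot F F' :=
  Submodule.Quotient.mk v

/-- The map `F / F' → K / K'` induced by a linear map `T` with `T F ⊆ K` and `T F' ⊆ K'`. -/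
def SubQuot.map {V W : Type*} [AddCommGroup V] [Module ℝ V] [AddCommGroup W] [Module ℝ W]
    {F F' : Submodule ℝ V} {K K' : Submodule ℝ W} (T : V →ₗ[ℝ] W)
    (h : F.map T ≤ K) (h' : F'.map T ≤ K') : SubQuot F F' →ₗ[ℝ] SubQuot K K' :=
  Submodule.mapQ _ _ (T.restrict fun v hv => h (Submodule.mem_map_of_mem hv)) fun v hv => by
    simp only [Submodule.submoduleOf, Submodule.mem_comap] at hv ⊢
    exact h' (Submodule.mem_map_of_mem hv)

/-! ### Restricted roots, nested standard parabolic subalgebras and the bigrading -/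

section Algebra

variable {𝔤 : Type*} [LieRing 𝔤] [LieAlgebra ℝ 𝔤]

/-- The joint eigenspace `{X | [H, X] = l(H) X for all H ∈ 𝔞}`. -/
def weightSpace (𝔞 : Submodule ℝ 𝔤) (l : Module.Dual ℝ 𝔞) : Submodule ℝ 𝔤 where
  carrier := {X | ∀ H : 𝔞, ⁅(H : 𝔤), X⁆ = l H • X}
  zero_mem' := by intro H; simp
  add_mem' := by
    intro X Y hX hY H
    rw [lie_add, hX H, hY H, smul_add]
  smul_mem' := by
    intro c X hX H
    rw [lie_smul, hX H, smul_comm]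

variable (𝔤) in
/-- Two nested standard parabolic subalgebras of a real semisimple Lie algebra `𝔤`: a Cartan
involution `θ`, a maximal abelian subspace `𝔞` of the `-1`-eigenspace of `θ`, a system of simple
restricted roots, and two sets `Sp ⊆ Sq` of simple restricted roots.  (In a semisimple Lie
algebra the simple restricted roots form a basis of `𝔞*`.) -/
structure NestedParabolics where
  θ : 𝔤 ≃ₗ⁅ℝ⁆ 𝔤
  θ_involutive : ∀ X, θ (θ X) = X
  θ_cartan : ∀ X, X ≠ 0 → killingForm ℝ 𝔤 X (θ X) < 0
  𝔞 : Submodule ℝ 𝔤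
  𝔞_neg : ∀ H ∈ 𝔞, θ H = -H
  𝔞_abelian : ∀ H ∈ 𝔞, ∀ H' ∈ 𝔞, ⁅H, H'⁆ = 0
  𝔞_maximal : ∀ X, θ X = -X → (∀ H ∈ 𝔞, ⁅H, X⁆ = 0) → X ∈ 𝔞
  rank : ℕ
  simple : Module.Basis (Fin rank) ℝ (Module.Dual ℝ 𝔞)
  simple_root : ∀ k, weightSpace 𝔞 (simple k) ≠ ⊥
  root_coeff : ∀ l, weightSpace 𝔞 l ≠ ⊥ →
    (∀ k, ∃ n : ℕ, simple.repr l k = n) ∨ (∀ k, ∃ n : ℕ, simple.repr l k = -(n : ℝ))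
  Sp : Finset (Fin rank)
  Sq : Finset (Fin rank)
  Sp_subset_Sq : Sp ⊆ Sq

namespace NestedParabolics

variable (𝔯 : NestedParabolics 𝔤)

/-- The `S`-height of `l ∈ 𝔞*`: the sum of its coefficients at the simple roots in `S`. -/
def height (S : Finset (Fin 𝔯.rank)) (l : Module.Dual ℝ 𝔯.𝔞) : ℝ := ∑ k ∈ S, 𝔯.simple.repr l k

/-- The bigrading component `𝔤_(i', i'')`: the sum of the spaces `weightSpace 𝔞 l` for which `l`
has `Sp`-height `i'` and `Sq`-height `i' + i''`.  These spaces are zero unless `l` is a restricted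
root or `l = 0`; the latter gives the centralizer of `𝔞`, which lies in `𝔤_(0, 0)`. -/
def bigrading (i' i'' : ℤ) : Submodule ℝ 𝔤 :=
  ⨆ (l : Module.Dual ℝ 𝔯.𝔞)
    (_ : 𝔯.height 𝔯.Sp l = (i' : ℝ) ∧ 𝔯.height 𝔯.Sq l = (i' : ℝ) + (i'' : ℝ)), weightSpace 𝔯.𝔞 l

/-- The filtration component `𝔤^(i', *) = ⨁_{j' ≥ i', j''} 𝔤_(j', j'')`. -/
def fil (i' : ℤ) : Submodule ℝ 𝔤 := ⨆ (j' : ℤ) (_ : i' ≤ j') (j'' : ℤ), 𝔯.bigrading j' j''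

/-- The parabolic subalgebra `𝔭 = 𝔤^(0, *)`. -/
def 𝔭 : Submodule ℝ 𝔤 := 𝔯.fil 0

/-- The parabolic subalgebra `𝔮 = ⨁_{j', j'' ≥ 0} 𝔤_(j', j'')`. -/
def 𝔮 : Submodule ℝ 𝔤 :=
  ⨆ (j' : ℤ) (_ : 0 ≤ j') (j'' : ℤ) (_ : 0 ≤ j''), 𝔯.bigrading j' j''

lemma lie_mem_bigrading {a b c d : ℤ} {X Y : 𝔤} (hX : X ∈ 𝔯.bigrading a b)
    (hY : Y ∈ 𝔯.bigrading c d) : ⁅X, Y⁆ ∈ 𝔯.bigrading (a + c) (b + d) := by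
  unfold bigrading at hX
  refine Submodule.iSup_induction _ (motive := fun X => ⁅X, Y⁆ ∈ 𝔯.bigrading (a + c) (b + d))
    hX (fun l X hX => ?_) (by simp) (fun X X' h h' => by rw [add_lie]; exact add_mem h h')
  refine Submodule.iSup_induction _ (motive := fun X => ⁅X, Y⁆ ∈ 𝔯.bigrading (a + c) (b + d))
    hX (fun hl X hX => ?_) (by simp) (fun X X' h h' => by rw [add_lie]; exact add_mem h h')
  unfold bigrading at hY
  refine Submodule.iSup_induction _ (motive := fun Y => ⁅X, Y⁆ ∈ 𝔯.bigrading (a + c) (b + d))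
    hY (fun m Y hY => ?_) (by simp) (fun X X' h h' => by rw [lie_add]; exact add_mem h h')
  refine Submodule.iSup_induction _ (motive := fun Y => ⁅X, Y⁆ ∈ 𝔯.bigrading (a + c) (b + d))
    hY (fun hm Y hY => ?_) (by simp) (fun X X' h h' => by rw [lie_add]; exact add_mem h h')
  refine Submodule.mem_iSup_of_mem (l + m) (Submodule.mem_iSup_of_mem ?_ ?_)
  · have key : ∀ S, 𝔯.height S (l + m) = 𝔯.height S l + 𝔯.height S m := fun S => by
      simp only [height, map_add, Finsupp.add_apply, Finset.sum_add_distrib]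
    rw [key, key, hl.1, hl.2, hm.1, hm.2]
    push_cast
    constructor <;> ring
  · intro H
    rw [leibniz_lie, hX H, hY H, smul_lie, lie_smul, LinearMap.add_apply, add_smul]

lemma lie_mem_fil {a c : ℤ} {X Y : 𝔤} (hX : X ∈ 𝔯.fil a) (hY : Y ∈ 𝔯.fil c) :
    ⁅X, Y⁆ ∈ 𝔯.fil (a + c) := by
  unfold fil at hX
  refine Submodule.iSup_induction _ (motive := fun X => ⁅X, Y⁆ ∈ 𝔯.fil (a + c))
    hX (fun i X hX => ?_) (by simp) (fun Z Z' h h' => by rw [add_lie]; exact add_mem h h')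
  refine Submodule.iSup_induction _ (motive := fun X => ⁅X, Y⁆ ∈ 𝔯.fil (a + c))
    hX (fun hi X hX => ?_) (by simp) (fun Z Z' h h' => by rw [add_lie]; exact add_mem h h')
  refine Submodule.iSup_induction _ (motive := fun X => ⁅X, Y⁆ ∈ 𝔯.fil (a + c))
    hX (fun k X hX => ?_) (by simp) (fun Z Z' h h' => by rw [add_lie]; exact add_mem h h')
  unfold fil at hY
  refine Submodule.iSup_induction _ (motive := fun Y => ⁅X, Y⁆ ∈ 𝔯.fil (a + c))
    hY (fun j Y hY => ?_) (by simp) (fun Z Z' h h' => by rw [lie_add]; exact add_mem h h')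
  refine Submodule.iSup_induction _ (motive := fun Y => ⁅X, Y⁆ ∈ 𝔯.fil (a + c))
    hY (fun hj Y hY => ?_) (by simp) (fun Z Z' h h' => by rw [lie_add]; exact add_mem h h')
  refine Submodule.iSup_induction _ (motive := fun Y => ⁅X, Y⁆ ∈ 𝔯.fil (a + c))
    hY (fun l Y hY => ?_) (by simp) (fun Z Z' h h' => by rw [lie_add]; exact add_mem h h')
  exact Submodule.mem_iSup_of_mem _ (Submodule.mem_iSup_of_mem (add_le_add hi hj)
    (Submodule.mem_iSup_of_mem _ (𝔯.lie_mem_bigrading hX hY)))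

/-- The representation space `𝕍_{i'} = 𝔤^(i', *) / 𝔤^(i'+1, *)`. -/
abbrev 𝕍 (i' : ℤ) : Type _ := SubQuot (𝔯.fil i') (𝔯.fil (i' + 1))

/-- The infinitesimal representation of `𝔭` on `𝕍_{i'}`, induced by the adjoint action. -/
def infAct (i' : ℤ) (X : 𝔯.𝔭) : 𝔯.𝕍 i' →ₗ[ℝ] 𝔯.𝕍 i' :=
  SubQuot.map (LieAlgebra.ad ℝ 𝔤 (X : 𝔤))
    (by
      rintro _ ⟨Y, hY, rfl⟩
      have := 𝔯.lie_mem_fil X.2 hY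
      rwa [zero_add] at this)
    (by
      rintro _ ⟨Y, hY, rfl⟩
      have := 𝔯.lie_mem_fil X.2 hY
      rwa [zero_add] at this)

end NestedParabolics

end Algebra

/-! ### Lie groups and parabolic subgroups -/

instance : ENat.LEInfty (minSmoothness ℝ 3) := ⟨by
  rw [minSmoothness_of_isRCLikeNormedField]; exact ENat.LEInfty.out⟩

/-- The identification of the tangent spaces at equal points. -/
def castTangent {E : Type*} [NormedAddCommGroup E] [NormedSpace ℝ E]
    {X : Type*} [TopologicalSpace X] [ChartedSpace E X] {x y : X} (h : x = y) :
    TangentSpace 𝓘(ℝ, E) x →ₗ[ℝ] TangentSpace 𝓘(ℝ, E) y :=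
  h ▸ LinearMap.id

section Groups

variable {EG : Type*} [NormedAddCommGroup EG] [NormedSpace ℝ EG] [FiniteDimensional ℝ EG]
  {G : Type*} [TopologicalSpace G] [ChartedSpace EG G] [Group G] [LieGroup 𝓘(ℝ, EG) ∞ G]
  {𝔤 : Type*} [LieRing 𝔤] [LieAlgebra ℝ 𝔤]

/-- The differential at the identity of `h ↦ g h g⁻¹`, on the tangent space at the identity. -/
def tangentConj (g : G) : GroupLieAlgebra 𝓘(ℝ, EG) G →ₗ[ℝ] GroupLieAlgebra 𝓘(ℝ, EG) G :=
  castTangent (show g * 1 * g⁻¹ = 1 by group) ∘ₗ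
    (mfderiv 𝓘(ℝ, EG) 𝓘(ℝ, EG) (fun h : G => g * h * g⁻¹) 1).toLinearMap

/-- The adjoint action of `G` on `𝔤`, for a given identification `e` of `𝔤` with the Lie algebra
of `G`. -/
def Ad (e : 𝔤 ≃ₗ⁅ℝ⁆ GroupLieAlgebra 𝓘(ℝ, EG) G) (g : G) : 𝔤 →ₗ[ℝ] 𝔤 :=
  e.toLinearEquiv.symm.toLinearMap ∘ₗ tangentConj g ∘ₗ e.toLinearEquiv.toLinearMap

/-- The differential at the identity of the inclusion of a subgroup, with values in `𝔤`. -/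
def subgroupDeriv {EQ : Type*} [NormedAddCommGroup EQ] [NormedSpace ℝ EQ]
    (e : 𝔤 ≃ₗ⁅ℝ⁆ GroupLieAlgebra 𝓘(ℝ, EG) G) (Q : Subgroup G) [ChartedSpace EQ Q] :
    TangentSpace 𝓘(ℝ, EQ) (1 : Q) →ₗ[ℝ] 𝔤 :=
  e.toLinearEquiv.symm.toLinearMap ∘ₗ
    (mfderiv 𝓘(ℝ, EQ) 𝓘(ℝ, EG) (fun q : Q => (q : G)) 1).toLinearMap

/-- `Q ⊆ P ⊆ G` are subgroups corresponding to `𝔮 ⊆ 𝔭 ⊆ 𝔤`: `P` lies between the normalizer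
`N_G(𝔭)` and its identity component, `Q` lies between `N_P(𝔮)` and its identity component, and
the manifold structure on `Q` is the one of a Lie subgroup with Lie algebra `𝔮`. -/
structure IsParabolicPair {EQ : Type*} [NormedAddCommGroup EQ] [NormedSpace ℝ EQ]
    (𝔯 : NestedParabolics 𝔤) (e : 𝔤 ≃ₗ⁅ℝ⁆ GroupLieAlgebra 𝓘(ℝ, EG) G)
    (P Q : Subgroup G) [ChartedSpace EQ Q] : Prop where
  P_le : ∀ g ∈ P, 𝔯.𝔭.map (Ad e g) = 𝔯.𝔭
  le_P : connectedComponentIn {g : G | 𝔯.𝔭.map (Ad e g) = 𝔯.𝔭} 1 ⊆ (P : Set G)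
  Q_le : ∀ g ∈ Q, g ∈ P ∧ 𝔯.𝔮.map (Ad e g) = 𝔯.𝔮
  le_Q : connectedComponentIn {g : G | g ∈ P ∧ 𝔯.𝔮.map (Ad e g) = 𝔯.𝔮} 1 ⊆ (Q : Set G)
  smooth_incl : ContMDiff 𝓘(ℝ, EQ) 𝓘(ℝ, EG) ∞ (fun q : Q => (q : G))
  injective_deriv : Function.Injective (subgroupDeriv (EQ := EQ) e Q)
  range_deriv : LinearMap.range (subgroupDeriv (EQ := EQ) e Q) = 𝔯.𝔮

end Groups

/-! ### Subbundles of tangent bundles, sections of subquotients, leaf spaces -/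

section Bundles

variable {EM : Type*} [NormedAddCommGroup EM] [NormedSpace ℝ EM]
  {M : Type*} [TopologicalSpace M] [ChartedSpace EM M] [IsManifold 𝓘(ℝ, EM) ∞ M]
  {EN : Type*} [NormedAddCommGroup EN] [NormedSpace ℝ EN]
  {N : Type*} [TopologicalSpace N] [ChartedSpace EN N] [IsManifold 𝓘(ℝ, EN) ∞ N]

/-- `V` is a smooth vector field on `W`. -/
def IsSmoothVectorField (V : ∀ x : M, TangentSpace 𝓘(ℝ, EM) x) (W : Set M) : Prop :=
  ContMDiffOn 𝓘(ℝ, EM) 𝓘(ℝ, EM).tangent ∞ (fun x => (⟨x, V x⟩ : TangentBundle 𝓘(ℝ, EM) M)) W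

/-- The family of subspaces `F x` of the tangent spaces is a smooth subbundle of the tangent
bundle: locally it has a smooth frame. -/
def IsSmoothSubbundle (F : ∀ x : M, Submodule ℝ (TangentSpace 𝓘(ℝ, EM) x)) : Prop :=
  ∀ x₀ : M, ∃ W : Set M, IsOpen W ∧ x₀ ∈ W ∧
    ∃ (r : ℕ) (X : Fin r → ∀ x : M, TangentSpace 𝓘(ℝ, EM) x),
      (∀ k, IsSmoothVectorField (X k) W) ∧
      ∀ x ∈ W, LinearIndependent ℝ (fun k => X k x) ∧
        Submodule.span ℝ (Set.range fun k => X k x) = F x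

/-- A distribution is involutive if it is closed under the Lie bracket of local vector fields. -/
def IsInvolutive (D : ∀ x : M, Submodule ℝ (TangentSpace 𝓘(ℝ, EM) x)) : Prop :=
  ∀ (W : Set M) (V₁ V₂ : ∀ x : M, TangentSpace 𝓘(ℝ, EM) x), IsOpen W →
    IsSmoothVectorField V₁ W → IsSmoothVectorField V₂ W →
    (∀ x ∈ W, V₁ x ∈ D x) → (∀ x ∈ W, V₂ x ∈ D x) →
    ∀ x ∈ W, VectorField.mlieBracket 𝓘(ℝ, EM) V₁ V₂ x ∈ D x

/-- `ψ : U → N` is a local leaf space for the distribution `D`: a surjective submersion from an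
open subset `U` onto a manifold whose vertical subspaces are the fibers of `D`.  (`ψ` is a total
function of which only the restriction to `U` is used.) -/
structure IsLocalLeafSpace (D : ∀ x : M, Submodule ℝ (TangentSpace 𝓘(ℝ, EM) x)) (U : Set M)
    (ψ : M → N) : Prop where
  isOpen : IsOpen U
  smooth : ContMDiffOn 𝓘(ℝ, EM) 𝓘(ℝ, EN) ∞ ψ U
  surjective : ψ '' U = Set.univ
  submersion : ∀ y ∈ U, Function.Surjective (mfderiv 𝓘(ℝ, EM) 𝓘(ℝ, EN) ψ y)
  ker_eq : ∀ y ∈ U, LinearMap.ker (mfderiv 𝓘(ℝ, EM) 𝓘(ℝ, EN) ψ y).toLinearMap = D y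

/-- The section `s` of the pullback along `φ : M → N` of the bundle `K / K'`
(for subbundles `K' ⊆ K ⊆ TN`) is smooth on `W`: locally it is represented by a smooth section of
the pullback of `K`. -/
def IsSmoothSectionAlong (φ : M → N) (K K' : ∀ z : N, Submodule ℝ (TangentSpace 𝓘(ℝ, EN) z))
    (W : Set M) (s : ∀ x : M, SubQuot (K (φ x)) (K' (φ x))) : Prop :=
  ∀ x₀ ∈ W, ∃ W₀ : Set M, IsOpen W₀ ∧ x₀ ∈ W₀ ∧ ∃ v : ∀ x : M, K (φ x),
    ContMDiffOn 𝓘(ℝ, EM) 𝓘(ℝ, EN).tangent ∞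
      (fun x => (⟨φ x, (v x : TangentSpace 𝓘(ℝ, EN) (φ x))⟩ : TangentBundle 𝓘(ℝ, EN) N)) W₀ ∧
    ∀ x ∈ W₀ ∩ W, s x = SubQuot.mk (K' (φ x)) (v x)

/-- Smooth sections on `W` of a subquotient `F / F'` of the tangent bundle. -/
def IsSmoothSection (F F' : ∀ x : M, Submodule ℝ (TangentSpace 𝓘(ℝ, EM) x))
    (W : Set M) (s : ∀ x : M, SubQuot (F x) (F' x)) : Prop :=
  IsSmoothSectionAlong (EM := EM) (fun x : M => x) F F' W s

end Bundles

/-! ### Cartan geometries -/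

section Cartan

variable {EG : Type*} [NormedAddCommGroup EG] [NormedSpace ℝ EG] [FiniteDimensional ℝ EG]
  {G : Type*} [TopologicalSpace G] [ChartedSpace EG G] [Group G] [LieGroup 𝓘(ℝ, EG) ∞ G]
  {𝔤 : Type*} [LieRing 𝔤] [LieAlgebra ℝ 𝔤]
  {EQ : Type*} [NormedAddCommGroup EQ] [NormedSpace ℝ EQ]
  {EP : Type*} [NormedAddCommGroup EP] [NormedSpace ℝ EP]
  {EM : Type*} [NormedAddCommGroup EM] [NormedSpace ℝ EM]
  {EN : Type*} [NormedAddCommGroup EN] [NormedSpace ℝ EN]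

/-- A Cartan geometry of type `(G, Q)` on `M` with total space `𝒢`: a principal right `Q`-bundle
`𝒢 → M` with a Cartan connection `ω ∈ Ω¹(𝒢, 𝔤)`. -/
structure CartanGeometry (e : 𝔤 ≃ₗ⁅ℝ⁆ GroupLieAlgebra 𝓘(ℝ, EG) G) (Q : Subgroup G)
    [ChartedSpace EQ Q]
    (𝒢 : Type*) [TopologicalSpace 𝒢] [ChartedSpace EP 𝒢] [IsManifold 𝓘(ℝ, EP) ∞ 𝒢]
    (M : Type*) [TopologicalSpace M] [ChartedSpace EM M] [IsManifold 𝓘(ℝ, EM) ∞ M] where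
  proj : 𝒢 → M
  proj_smooth : ContMDiff 𝓘(ℝ, EP) 𝓘(ℝ, EM) ∞ proj
  act : 𝒢 → Q → 𝒢
  act_smooth : ContMDiff (𝓘(ℝ, EP).prod 𝓘(ℝ, EQ)) 𝓘(ℝ, EP) ∞ (fun p : 𝒢 × Q => act p.1 p.2)
  act_one : ∀ u, act u 1 = u
  act_mul : ∀ u q q', act u (q * q') = act (act u q) q'
  proj_act : ∀ u q, proj (act u q) = proj u
  /-- local trivializations -/
  locally_trivial : ∀ x : M, ∃ (W : Set M) (φ : OpenPartialHomeomorph 𝒢 (M × Q)),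
    IsOpen W ∧ x ∈ W ∧ φ.source = proj ⁻¹' W ∧ φ.target = W ×ˢ Set.univ ∧
    ContMDiffOn 𝓘(ℝ, EP) (𝓘(ℝ, EM).prod 𝓘(ℝ, EQ)) ∞ φ φ.source ∧
    ContMDiffOn (𝓘(ℝ, EM).prod 𝓘(ℝ, EQ)) 𝓘(ℝ, EP) ∞ φ.symm φ.target ∧
    ∀ u ∈ φ.source, (φ u).1 = proj u ∧ ∀ q, φ (act u q) = ((φ u).1, (φ u).2 * q)
  /-- the Cartan connection; each `conn u = ω_u` is a linear isomorphism -/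
  conn : ∀ u : 𝒢, TangentSpace 𝓘(ℝ, EP) u ≃ₗ[ℝ] 𝔤
  /-- `ω` is a smooth one-form with values in the finite-dimensional vector space `𝔤` -/
  conn_smooth : ∀ ℓ : 𝔤 →ₗ[ℝ] ℝ, ContMDiff 𝓘(ℝ, EP).tangent 𝓘(ℝ, ℝ) ∞
    (fun v : TangentBundle 𝓘(ℝ, EP) 𝒢 => ℓ (conn v.1 v.2))
  conn_equivariant : ∀ (u : 𝒢) (q : Q) (w : TangentSpace 𝓘(ℝ, EP) u),
    conn (act u q) (mfderiv 𝓘(ℝ, EP) 𝓘(ℝ, EP) (fun u' => act u' q) u w)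
      = Ad e ((q : G)⁻¹) (conn u w)
  /-- `ω` reproduces the generators of fundamental vector fields -/
  conn_fundamental : ∀ (u : 𝒢) (a : TangentSpace 𝓘(ℝ, EQ) (1 : Q)),
    conn (act u 1) (mfderiv 𝓘(ℝ, EQ) 𝓘(ℝ, EP) (fun q : Q => act u q) 1 a) = subgroupDeriv e Q a

namespace CartanGeometry

variable {e : 𝔤 ≃ₗ⁅ℝ⁆ GroupLieAlgebra 𝓘(ℝ, EG) G} {Q : Subgroup G} [ChartedSpace EQ Q]
  {𝒢 : Type*} [TopologicalSpace 𝒢] [ChartedSpace EP 𝒢] [IsManifold 𝓘(ℝ, EP) ∞ 𝒢]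
  {M : Type*} [TopologicalSpace M] [ChartedSpace EM M] [IsManifold 𝓘(ℝ, EM) ∞ M]
  {N : Type*} [TopologicalSpace N] [ChartedSpace EN N] [IsManifold 𝓘(ℝ, EN) ∞ N]
  (A : CartanGeometry (EQ := EQ) (EP := EP) (EM := EM) e Q 𝒢 M)

lemma proj_surjective : Function.Surjective A.proj := by
  intro x
  obtain ⟨W, φ, -, hx, hs, ht, -, -, h⟩ := A.locally_trivial x
  have hm : ((x, 1) : M × Q) ∈ φ.target := by rw [ht]; exact ⟨hx, trivial⟩
  refine ⟨φ.symm (x, 1), ?_⟩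
  rw [← (h _ (φ.map_target hm)).1, φ.right_inv hm]

/-- The map `𝔤 → T_x M`, `X ↦ T_u p (ω_u⁻¹ X)` for `u` in the fiber over `x`.  It induces the
isomorphism `𝒢 ×_Q (𝔤/𝔮) ≅ TM`. -/
def toTangent {x : M} (u : 𝒢) (h : A.proj u = x) : 𝔤 →ₗ[ℝ] TangentSpace 𝓘(ℝ, EM) x :=
  castTangent h ∘ₗ (mfderiv 𝓘(ℝ, EP) 𝓘(ℝ, EM) A.proj u).toLinearMap ∘ₗ
    (A.conn u).symm.toLinearMap

/-- The vector field `ω⁻¹(X)` on `𝒢`. -/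
def constField (X : 𝔤) (u : 𝒢) : TangentSpace 𝓘(ℝ, EP) u := (A.conn u).symm X

/-- The curvature function of `ω`, i.e. the value of `κ = dω + ½[ω, ω]` on the vector fields
`ω⁻¹(X)`, `ω⁻¹(Y)` at `u`; on these, `dω` is `-ω([ω⁻¹(X), ω⁻¹(Y)])`. -/
def curvature (u : 𝒢) (X Y : 𝔤) : 𝔤 :=
  ⁅X, Y⁆ - A.conn u (VectorField.mlieBracket 𝓘(ℝ, EP) (A.constField X) (A.constField Y) u)

/-- A point in the fiber over `x`. -/
def point (x : M) : 𝒢 := Function.surjInv A.proj_surjective x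

lemma proj_point (x : M) : A.proj (A.point x) = x := Function.surjInv_eq A.proj_surjective x

/-- The torsion `τ ∈ Ω²(M, TM)`: the projection to `TM` of the curvature.  It is computed at some
point `u` over `x` and on some elements of `𝔤` which represent the two given tangent vectors;
as the curvature is horizontal and equivariant, the result does not depend on these choices. -/
def torsion (x : M) (ξ η : TangentSpace 𝓘(ℝ, EM) x) : TangentSpace 𝓘(ℝ, EM) x :=
  A.toTangent (A.point x) (A.proj_point x)
    (A.curvature (A.point x)
      (Function.invFun (A.toTangent (A.point x) (A.proj_point x)) ξ)
      (Function.invFun (A.toTangent (A.point x) (A.proj_point x)) η))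

variable (𝔯 : NestedParabolics 𝔤)

/-- For `i' ≤ 0`, the subbundle `T^{i'}_P M = 𝒢 ×_Q (𝔤^(i', *)/𝔮)` of `TM = 𝒢 ×_Q (𝔤/𝔮)`.  (As
`𝔤^(i', *)` is `Q`-invariant, all points of the fiber over `x` give the same subspace.) -/
def TP (i' : ℤ) (x : M) : Submodule ℝ (TangentSpace 𝓘(ℝ, EM) x) :=
  ⨆ (u : 𝒢) (h : A.proj u = x), (𝔯.fil i').map (A.toTangent u h)

/-- The relative tangent bundle `T_ρ M = T^0_P M = 𝒢 ×_Q (𝔭/𝔮)`. -/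
abbrev relTangent (x : M) : Submodule ℝ (TangentSpace 𝓘(ℝ, EM) x) := A.TP 𝔯 0 x

/-- On `U`, the torsion maps `T_ρ M × T^{i'}_P M` to `T^{j'}_P M`. -/
def TorsionCond (U : Set M) (i' j' : ℤ) : Prop :=
  ∀ x ∈ U, ∀ ξ ∈ A.relTangent 𝔯 x, ∀ η ∈ A.TP 𝔯 i' x, A.torsion x ξ η ∈ A.TP 𝔯 j' x

/-- The fiber at `x` of the relative tractor bundle `𝒱_{i'} M = T^{i'}_P M / T^{i'+1}_P M`,
for `i' < 0`. -/
abbrev 𝒱 (i' : ℤ) (x : M) : Type _ := SubQuot (A.TP 𝔯 i' x) (A.TP 𝔯 (i' + 1) x)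

lemma map_fil_le (i' : ℤ) {x : M} (u : 𝒢) (h : A.proj u = x) :
    (𝔯.fil i').map (A.toTangent u h) ≤ A.TP 𝔯 i' x :=
  le_iSup₂_of_le (f := fun (u : 𝒢) (h : A.proj u = x) => (𝔯.fil i').map (A.toTangent u h))
    u h le_rfl

/-- The isomorphism `𝕍_{i'} → 𝒱_{i'} M` at `p(u)`, `v ↦ [u, v]`, which identifies `𝒱_{i'} M` with
the associated bundle `𝒢 ×_Q 𝕍_{i'}`. -/
def frame (i' : ℤ) (u : 𝒢) : 𝔯.𝕍 i' →ₗ[ℝ] A.𝒱 𝔯 i' (A.proj u) :=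
  SubQuot.map (A.toTangent u rfl) (A.map_fil_le 𝔯 i' u rfl) (A.map_fil_le 𝔯 (i' + 1) u rfl)

/-- The `Q`-equivariant function `𝒢 → 𝕍_{i'}` which corresponds to a section `σ` of `𝒱_{i'} M`:
at `u` it has the value `v` for which `[u, v] = σ(p(u))`. -/
def equivariantFunction (i' : ℤ) (σ : ∀ x : M, A.𝒱 𝔯 i' x) (u : 𝒢) : 𝔯.𝕍 i' :=
  Function.invFun (A.frame 𝔯 i' u) (σ (A.proj u))

/-- The derivative at `u` in direction `w` of a function with values in a finite-dimensional
vector space, computed in coordinates. -/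
def dirDeriv {V : Type*} [AddCommGroup V] [Module ℝ V] [FiniteDimensional ℝ V] (f : 𝒢 → V)
    (u : 𝒢) (w : TangentSpace 𝓘(ℝ, EP) u) : V :=
  ∑ k, (show ℝ from mfderiv 𝓘(ℝ, EP) 𝓘(ℝ, ℝ)
    (fun u' => (Module.finBasis ℝ V).repr (f u') k) u w) • Module.finBasis ℝ V k

/-- The relative tractor connection on `𝒱_{i'} M`, characterized by
`∇_{Π(s)} σ = D_s σ + s • σ` for sections `s` of `𝒢 ×_Q 𝔭`.  Here the right-hand side is computed
at the point `u ∈ 𝒢`: the value `w` at `u` of the vector field on `𝒢` that corresponds to `s` is a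
tangent vector with `ω(w) ∈ 𝔭`, the fundamental derivative `D_s σ` is the derivative in direction
`w` of the equivariant function of `σ`, and `s • σ` is the infinitesimal action of `ω(w)`. -/
def relTractorConnection [FiniteDimensional ℝ 𝔤] (i' : ℤ) (σ : ∀ x : M, A.𝒱 𝔯 i' x) (u : 𝒢)
    (w : TangentSpace 𝓘(ℝ, EP) u) (hw : A.conn u w ∈ 𝔯.𝔭) : A.𝒱 𝔯 i' (A.proj u) :=
  A.frame 𝔯 i' u (dirDeriv (A.equivariantFunction 𝔯 i' σ) u w
    + 𝔯.infAct i' ⟨A.conn u w, hw⟩ (A.equivariantFunction 𝔯 i' σ u))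

/-- The section `σ` of `𝒱_{i'} M` is parallel over `U` for the relative tractor connection. -/
def IsParallel [FiniteDimensional ℝ 𝔤] (i' : ℤ) (U : Set M) (σ : ∀ x : M, A.𝒱 𝔯 i' x) : Prop :=
  ∀ (u : 𝒢) (w : TangentSpace 𝓘(ℝ, EP) u) (hw : A.conn u w ∈ 𝔯.𝔭), A.proj u ∈ U →
    A.relTractorConnection 𝔯 i' σ u w hw = 0

/-- The subbundle `K` of `TN` corresponds to `T^{i'}_P M / T_ρ M` under the isomorphism
`TM / T_ρ M ≅ ψ^* TN` over `U` induced by `Tψ`. -/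
def Corresponds (U : Set M) (ψ : M → N) (i' : ℤ)
    (K : ∀ z : N, Submodule ℝ (TangentSpace 𝓘(ℝ, EN) z)) : Prop :=
  ∀ y ∈ U, (A.TP 𝔯 i' y).map (mfderiv 𝓘(ℝ, EM) 𝓘(ℝ, EN) ψ y).toLinearMap = K (ψ y)

/-- The map `𝒱_{i'} M → ψ^*(K / K')` at `y ∈ U` induced by `Tψ`, where `K` and `K'` correspond to
`T^{i'}_P M` and `T^{i'+1}_P M`. -/
def inducedMap {U : Set M} {ψ : M → N} {i' : ℤ}
    {K K' : ∀ z : N, Submodule ℝ (TangentSpace 𝓘(ℝ, EN) z)}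
    (h : A.Corresponds 𝔯 U ψ i' K) (h' : A.Corresponds 𝔯 U ψ (i' + 1) K') (y : M) (hy : y ∈ U) :
    A.𝒱 𝔯 i' y →ₗ[ℝ] SubQuot (K (ψ y)) (K' (ψ y)) :=
  SubQuot.map (mfderiv 𝓘(ℝ, EM) 𝓘(ℝ, EN) ψ y).toLinearMap (h y hy).le (h' y hy).le

/-- `Tψ` induces an isomorphism of smooth vector bundles `𝒱_{i'} M|_U ≅ ψ^*(K / K')`: it is a
linear isomorphism on each fiber, and it and its inverse map smooth local sections to smooth
local sections. -/
def InducesIso {U : Set M} {ψ : M → N} {i' : ℤ}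
    {K K' : ∀ z : N, Submodule ℝ (TangentSpace 𝓘(ℝ, EN) z)}
    (h : A.Corresponds 𝔯 U ψ i' K) (h' : A.Corresponds 𝔯 U ψ (i' + 1) K') : Prop :=
  (∀ (y : M) (hy : y ∈ U), Function.Bijective (A.inducedMap 𝔯 h h' y hy)) ∧
  ∀ (W : Set M) (hW : W ⊆ U) (σ : ∀ x : M, A.𝒱 𝔯 i' x)
    (s : ∀ x : M, SubQuot (K (ψ x)) (K' (ψ x))), IsOpen W →
    (∀ (y : M) (hy : y ∈ W), s y = A.inducedMap 𝔯 h h' y (hW hy) (σ y)) →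
    (IsSmoothSection (A.TP 𝔯 i') (A.TP 𝔯 (i' + 1)) W σ ↔
      IsSmoothSectionAlong (EM := EM) ψ K K' W s)

end CartanGeometry

end Cartan

end RelBGG

end

/-!
Write `X~ = ω⁻¹(X)` for the vector field on `𝒢` determined by `X ∈ 𝔤`.  Everything is pulled back
to `𝒢`: the linear maps `leafMap u : 𝔤 → T N`, `X ↦ T(ψ ∘ p)(X~)`, have kernel `𝔭`, and they map
`𝔤^(i, *)` onto the image of `T^i_P M` under `Tψ`.  The definition of the curvature says that
`[X~, Y~] = ([X, Y] - κ(X, Y))~`.  If `X ∈ 𝔭`, then `X~` is tangent to the fibres of `ψ ∘ p`, so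
the derivative of `u ↦ leafMap u Y` in the direction `X~` is the value of `leafMap` on `[X~, Y~]`,
that is on `[X, Y] - κ(X, Y)` (`mvfderiv_leafMapChart`).  All assertions follow from this formula.

*The subbundles.*  Since `[𝔭, 𝔤^(i, *)] ⊆ 𝔤^(i, *)`, the formula shows that the torsion condition
`κ(𝔭, 𝔤^(i, *)) ⊆ 𝔤^(i, *)` is equivalent to the images `leafMap u (𝔤^(i, *))` having derivatives
in themselves along the leaves, and so to their being constant along curves in the leaves
(`range_eq_of_hasDerivAt`, `eventually_map_leafMap_eq`, `curvature_mem_of_map_leafMap_eq`).  As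
the fibres of `ψ` are connected, they are then constant on the fibres and descend to `N`; local
sections of `ψ ∘ p` give smooth frames (`exists_subbundle`).

*The isomorphism.*  It is pointwise linear algebra; smoothness of the inverse follows by solving
linear equations in the frames `leafMap u` (`contMDiffAt_coeff`, `inducesIso`).

*Parallel sections.*  Represent a section `σ` of `𝒱_i M` by a smooth function `F : 𝒢 → 𝔤^(i, *)`.
The derivative of `leafMap u (F u)` in the direction `X~` with `X ∈ 𝔭` is the value of `leafMap u`
on `dF(X~) + [X, F] - κ(X, F)`.  If `κ(𝔭, 𝔤^(i, *)) ⊆ 𝔤^(i+1, *)`, then modulo `𝔤^(i+1, *)` this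
is the relative tractor connection of `σ`.  Hence `σ` is parallel if and only if its image in `TN`
is constant, modulo the subbundle `T^{i+1} N`, along the leaves
(`isParallel_iff_exists_pullback`).

Two facts make the translation between `M` and `𝒢` possible.  The torsion only determines `κ`
modulo `𝔮` and is computed at one point of each fibre, so one needs that `κ` vanishes if one entry
is in `𝔮` (`curvature_subgroupDeriv`, from the equivariance of `ω`) and that `𝔤^(i, *)` is
invariant under `Ad Q`.  The group `P` is only known to preserve `𝔭`; but the filtration in
non-positive degrees is determined by `𝔭` (`map_fil_of_map_𝔭`): `𝔤^(1, *)` is the orthocomplement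
of `𝔭` for the Killing form, and `𝔤^(j-1, *)` consists of the elements that `ad 𝔤^(1, *)` maps to
`𝔤^(j, *)`, for `j ≤ 0`.
-/

noncomputable section

namespace RelBGG

open Filter Topology Set

/-! ### Weight spaces -/

namespace NestedParabolics

variable {𝔤 : Type*} [LieRing 𝔤] [LieAlgebra ℝ 𝔤] (𝔯 : NestedParabolics 𝔤)

lemma killingForm_lie (X Y Z : 𝔤) :
    killingForm ℝ 𝔤 ⁅X, Y⁆ Z = killingForm ℝ 𝔤 X ⁅Y, Z⁆ :=
  LieModule.traceForm_apply_lie_apply ℝ 𝔤 𝔤 X Y Z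

lemma killingForm_θ (X Y : 𝔤) :
    killingForm ℝ 𝔤 (𝔯.θ X) Y = killingForm ℝ 𝔤 X (𝔯.θ Y) := by
  conv_lhs => rw [← 𝔯.θ_involutive Y]
  exact LieAlgebra.killingForm_of_equiv_apply 𝔯.θ X (𝔯.θ Y)

lemma killingForm_θ_symm (X Y : 𝔤) :
    killingForm ℝ 𝔤 X (𝔯.θ Y) = killingForm ℝ 𝔤 Y (𝔯.θ X) := by
  rw [← killingForm_θ, LieModule.traceForm_comm]

/-- The inner product `(X, Y) ↦ -B(X, θ Y)` on `𝔤`, for the Killing form `B`. -/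
abbrev core : InnerProductSpace.Core ℝ 𝔤 where
  inner X Y := -killingForm ℝ 𝔤 X (𝔯.θ Y)
  conj_inner_symm X Y := by simp [killingForm_θ_symm 𝔯 X Y]
  re_inner_nonneg X := by
    rcases eq_or_ne X 0 with rfl | h
    · simp
    · simpa using (𝔯.θ_cartan X h).le
  add_left X Y Z := by simp [add_comm]
  smul_left X Y r := by simp
  definite X h := by
    by_contra h'
    exact (𝔯.θ_cartan X h').ne (by simpa using h)

/-- The operators `ad H`, `H ∈ 𝔞`, are symmetric for the inner product `core`. -/
lemma lie_symmetric {H : 𝔤} (hH : H ∈ 𝔯.𝔞) (X Y : 𝔤) :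
    killingForm ℝ 𝔤 ⁅H, X⁆ (𝔯.θ Y) = killingForm ℝ 𝔤 X (𝔯.θ ⁅H, Y⁆) := by
  rw [← lie_skew, map_neg, LinearMap.neg_apply, killingForm_lie, LieEquiv.map_lie, 𝔯.𝔞_neg H hH,
    neg_lie, map_neg]

/-- Weight spaces are orthogonal for the Killing form unless their weights are opposite. -/
lemma killingForm_weightSpace_eq_zero {l m : Module.Dual ℝ 𝔯.𝔞} (h : l + m ≠ 0) {X Y : 𝔤}
    (hX : X ∈ weightSpace 𝔯.𝔞 l) (hY : Y ∈ weightSpace 𝔯.𝔞 m) : killingForm ℝ 𝔤 X Y = 0 := by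
  obtain ⟨H, hH⟩ : ∃ H, (l + m) H ≠ 0 := by
    by_contra! h'
    exact h (LinearMap.ext h')
  have h1 : killingForm ℝ 𝔤 ⁅X, (H : 𝔤)⁆ Y = killingForm ℝ 𝔤 X ⁅(H : 𝔤), Y⁆ := killingForm_lie _ _ _
  rw [← lie_skew, hX H, hY H] at h1
  simp only [map_neg, map_smul, LinearMap.neg_apply, LinearMap.smul_apply, smul_eq_mul] at h1
  have h2 : (l + m) H * killingForm ℝ 𝔤 X Y = 0 := by
    rw [LinearMap.add_apply]; linarith
  exact (mul_eq_zero.1 h2).resolve_left hH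

lemma θ_mem_weightSpace {l : Module.Dual ℝ 𝔯.𝔞} {X : 𝔤} (hX : X ∈ weightSpace 𝔯.𝔞 l) :
    𝔯.θ X ∈ weightSpace 𝔯.𝔞 (-l) := by
  intro H
  have h := congrArg 𝔯.θ (hX H)
  rw [LieEquiv.map_lie, 𝔯.𝔞_neg H H.2, neg_lie] at h
  rw [← neg_neg ⁅(H : 𝔤), 𝔯.θ X⁆, h, LinearMap.neg_apply, neg_smul, map_smul]

lemma lie_mem_weightSpace {l m : Module.Dual ℝ 𝔯.𝔞} {X Y : 𝔤} (hX : X ∈ weightSpace 𝔯.𝔞 l)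
    (hY : Y ∈ weightSpace 𝔯.𝔞 m) : ⁅X, Y⁆ ∈ weightSpace 𝔯.𝔞 (l + m) := by
  intro H
  rw [leibniz_lie, hX H, hY H, smul_lie, lie_smul, LinearMap.add_apply, add_smul]

/-- A weight vector that is a sum of vectors of other weights vanishes, since weight spaces of
different weights are orthogonal for the inner product. -/
lemma eq_zero_of_mem_weightSpace {l : Module.Dual ℝ 𝔯.𝔞} {X : 𝔤} (hX : X ∈ weightSpace 𝔯.𝔞 l)
    {p : Module.Dual ℝ 𝔯.𝔞 → Prop} (hl : ¬ p l)
    (hX' : X ∈ ⨆ (m : Module.Dual ℝ 𝔯.𝔞) (_ : p m), weightSpace 𝔯.𝔞 m) : X = 0 := by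
  by_contra h0
  refine (𝔯.θ_cartan X h0).ne ?_
  have : ∀ Y ∈ ⨆ (m : Module.Dual ℝ 𝔯.𝔞) (_ : p m), weightSpace 𝔯.𝔞 m,
      killingForm ℝ 𝔤 Y (𝔯.θ X) = 0 := by
    intro Y hY
    have hle : (⨆ (m : Module.Dual ℝ 𝔯.𝔞) (_ : p m), weightSpace 𝔯.𝔞 m)
        ≤ LinearMap.ker ((killingForm ℝ 𝔤).flip (𝔯.θ X)) := by
      refine iSup₂_le fun m hm Z hZ => ?_
      have hne : m + -l ≠ 0 := by
        intro h
        rw [← sub_eq_add_neg, sub_eq_zero] at h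
        exact hl (h ▸ hm)
      exact 𝔯.killingForm_weightSpace_eq_zero hne hZ (𝔯.θ_mem_weightSpace hX)
    exact hle hY
  exact this X hX'

lemma iSupIndep_weightSpace [FiniteDimensional ℝ 𝔤] :
    iSupIndep (weightSpace 𝔯.𝔞) := by
  intro l
  rw [Submodule.disjoint_def]
  intro X hX hX'
  exact 𝔯.eq_zero_of_mem_weightSpace (p := fun m => m ≠ l) hX (by simp) hX'

/-- A subspace which is stable under `ad 𝔞` is the sum of its intersections with the weight
spaces, since the `ad H`, `H ∈ 𝔞`, are commuting symmetric operators. -/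
lemma le_iSup_inf_weightSpace [FiniteDimensional ℝ 𝔤] (W : Submodule ℝ 𝔤)
    (hW : ∀ H ∈ 𝔯.𝔞, ∀ X ∈ W, ⁅H, X⁆ ∈ W) : W ≤ ⨆ l, W ⊓ weightSpace 𝔯.𝔞 l := by
  let _ : NormedAddCommGroup 𝔤 := 𝔯.core.toNormedAddCommGroup
  let _ : InnerProductSpace ℝ 𝔤 := InnerProductSpace.ofCore 𝔯.core.toCore
  let b := Module.finBasis ℝ 𝔯.𝔞
  let T : Fin (Module.finrank ℝ 𝔯.𝔞) → (W →ₗ[ℝ] W) := fun i =>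
    (LieAlgebra.ad ℝ 𝔤 (b i : 𝔤)).restrict (fun X hX => hW _ (b i).2 X hX)
  have hT : ∀ i, (T i).IsSymmetric := fun i X Y => by
    change -killingForm ℝ 𝔤 ⁅(b i : 𝔤), (X : 𝔤)⁆ (𝔯.θ Y)
      = -killingForm ℝ 𝔤 (X : 𝔤) (𝔯.θ ⁅(b i : 𝔤), (Y : 𝔤)⁆)
    rw [𝔯.lie_symmetric (b i).2]
  have hC : Pairwise (Function.onFun Commute T) := by
    intro i j _
    refine LinearMap.ext fun X => Subtype.ext ?_
    change ⁅(b i : 𝔤), ⁅(b j : 𝔤), (X : 𝔤)⁆⁆ = ⁅(b j : 𝔤), ⁅(b i : 𝔤), (X : 𝔤)⁆⁆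
    rw [leibniz_lie, 𝔯.𝔞_abelian _ (b i).2 _ (b j).2, zero_lie, zero_add]
  have key := LinearMap.IsSymmetric.iSup_iInf_eq_top_of_commute hT hC
  have hle : ∀ χ : Fin (Module.finrank ℝ 𝔯.𝔞) → ℝ,
      (⨅ i, Module.End.eigenspace (T i) (χ i)) ≤
        (⨆ l, W ⊓ weightSpace 𝔯.𝔞 l).comap W.subtype := by
    intro χ X hX
    rw [Submodule.mem_iInf] at hX
    refine Submodule.mem_iSup_of_mem (b.constr ℝ χ) ⟨X.2, fun H => ?_⟩
    have hX' : ∀ i, ⁅(b i : 𝔤), (X : 𝔤)⁆ = χ i • (X : 𝔤) := fun i =>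
      congrArg Subtype.val (Module.End.mem_eigenspace_iff.1 (hX i))
    have hlin : ((LieModule.toEnd ℝ 𝔤 𝔤 : 𝔤 →ₗ[ℝ] Module.End ℝ 𝔤).flip (X : 𝔤)) ∘ₗ 𝔯.𝔞.subtype
        = (b.constr ℝ χ).smulRight (X : 𝔤) := by
      refine b.ext fun i => ?_
      simpa using hX' i
    exact LinearMap.congr_fun hlin H
  intro X hX
  have : (⟨X, hX⟩ : W) ∈ (⨆ l, W ⊓ weightSpace 𝔯.𝔞 l).comap W.subtype := by
    have htop : (⟨X, hX⟩ : W) ∈ (⊤ : Submodule ℝ W) := trivial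
    rw [← key] at htop
    exact iSup_le hle htop
  exact this

/-! ### Heights and the filtration -/

lemma height_add (S : Finset (Fin 𝔯.rank)) (l m : Module.Dual ℝ 𝔯.𝔞) :
    𝔯.height S (l + m) = 𝔯.height S l + 𝔯.height S m := by
  simp only [height, map_add, Finsupp.add_apply, Finset.sum_add_distrib]

lemma height_neg (S : Finset (Fin 𝔯.rank)) (l : Module.Dual ℝ 𝔯.𝔞) :
    𝔯.height S (-l) = -𝔯.height S l := by
  simp only [height, map_neg, Finsupp.neg_apply, Finset.sum_neg_distrib]

lemma height_simple (S : Finset (Fin 𝔯.rank)) (k : Fin 𝔯.rank) :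
    𝔯.height S (𝔯.simple k) = if k ∈ S then 1 else 0 := by
  simp [height, Finsupp.single_apply]

lemma exists_int_height {l : Module.Dual ℝ 𝔯.𝔞} (hl : weightSpace 𝔯.𝔞 l ≠ ⊥)
    (S : Finset (Fin 𝔯.rank)) : ∃ n : ℤ, 𝔯.height S l = n := by
  have hk : ∀ k, ∃ n : ℤ, 𝔯.simple.repr l k = n := by
    intro k
    rcases 𝔯.root_coeff l hl with h | h
    · obtain ⟨n, hn⟩ := h k
      exact ⟨n, by simpa using hn⟩
    · obtain ⟨n, hn⟩ := h k
      exact ⟨-n, by simpa using hn⟩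
  choose n hn using hk
  exact ⟨∑ k ∈ S, n k, by simp [height, hn]⟩

lemma weightSpace_le_fil {i : ℤ} {l : Module.Dual ℝ 𝔯.𝔞} (h : (i : ℝ) ≤ 𝔯.height 𝔯.Sp l) :
    weightSpace 𝔯.𝔞 l ≤ 𝔯.fil i := by
  by_cases hl : weightSpace 𝔯.𝔞 l = ⊥
  · rw [hl]; exact bot_le
  obtain ⟨n, hn⟩ := 𝔯.exists_int_height hl 𝔯.Sp
  obtain ⟨m, hm⟩ := 𝔯.exists_int_height hl 𝔯.Sq
  refine le_iSup_of_le n (le_iSup_of_le ?_ (le_iSup_of_le (m - n) ?_))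
  · rw [hn] at h; exact_mod_cast h
  · exact le_iSup₂_of_le l ⟨hn, by rw [hm]; push_cast; ring⟩ le_rfl

lemma fil_eq (i : ℤ) : 𝔯.fil i =
    ⨆ (l : Module.Dual ℝ 𝔯.𝔞) (_ : (i : ℝ) ≤ 𝔯.height 𝔯.Sp l), weightSpace 𝔯.𝔞 l := by
  apply le_antisymm
  · refine iSup_le fun n => iSup_le fun hn => iSup_le fun m => iSup₂_le fun l hl => ?_
    refine le_iSup₂_of_le (f := fun l _ => weightSpace 𝔯.𝔞 l) l ?_ le_rfl
    rw [hl.1]; exact_mod_cast hn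
  · exact iSup₂_le fun l hl => 𝔯.weightSpace_le_fil hl

lemma fil_antitone : Antitone 𝔯.fil := fun _ _ hij =>
  iSup_mono fun _ => iSup_le fun hn => le_iSup_of_le (hij.trans hn) le_rfl

lemma 𝔮_le_𝔭 : 𝔯.𝔮 ≤ 𝔯.𝔭 :=
  iSup_mono fun _ => iSup_mono fun _ => iSup_mono fun _ => iSup_le fun _ => le_rfl

lemma 𝔭_le_fil {i : ℤ} (hi : i ≤ 0) : 𝔯.𝔭 ≤ 𝔯.fil i := 𝔯.fil_antitone hi

lemma eq_zero_of_mem_fil {i : ℤ} {l : Module.Dual ℝ 𝔯.𝔞} (h : 𝔯.height 𝔯.Sp l < i) {X : 𝔤}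
    (hX : X ∈ weightSpace 𝔯.𝔞 l) (hX' : X ∈ 𝔯.fil i) : X = 0 := by
  rw [fil_eq] at hX'
  exact 𝔯.eq_zero_of_mem_weightSpace (p := fun l => (i : ℝ) ≤ 𝔯.height 𝔯.Sp l) hX (not_le.2 h) hX'

lemma mem_fil_zero_of_mem_𝔞 {H : 𝔤} (hH : H ∈ 𝔯.𝔞) : H ∈ 𝔯.fil 0 := by
  refine 𝔯.weightSpace_le_fil (l := 0) (by simp [height]) (fun H' => ?_)
  rw [𝔯.𝔞_abelian _ H'.2 _ hH]; simp

/-! ### The filtration is determined by `𝔭` -/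

/-- `𝔤^(1, *)` is the orthocomplement of `𝔭` for the Killing form. -/
lemma mem_fil_one_iff [FiniteDimensional ℝ 𝔤] (X : 𝔤) :
    X ∈ 𝔯.fil 1 ↔ ∀ Y ∈ 𝔯.𝔭, killingForm ℝ 𝔤 X Y = 0 := by
  constructor
  · intro hX Y hY
    have h1 : 𝔯.fil 1 ≤ LinearMap.ker ((killingForm ℝ 𝔤).flip Y) := by
      rw [fil_eq]
      refine iSup₂_le fun l hl Z hZ => ?_
      have h2 : 𝔯.fil 0 ≤ LinearMap.ker (killingForm ℝ 𝔤 Z) := by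
        rw [fil_eq]
        refine iSup₂_le fun m hm Z' hZ' => ?_
        refine 𝔯.killingForm_weightSpace_eq_zero (fun h0 => ?_) hZ hZ'
        have := 𝔯.height_add 𝔯.Sp l m
        rw [h0] at this
        simp only [height, map_zero, Finsupp.coe_zero, Pi.zero_apply, Finset.sum_const_zero]
          at this hl hm
        push_cast at hl hm
        linarith
      exact h2 hY
    exact h1 hX
  · intro hX
    let W : Submodule ℝ 𝔤 :=
      { carrier := {X | ∀ Y ∈ 𝔯.𝔭, killingForm ℝ 𝔤 X Y = 0}
        zero_mem' := by intro Y _; simp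
        add_mem' := by
          intro X X' h h' Y hY
          rw [map_add, LinearMap.add_apply, h Y hY, h' Y hY, add_zero]
        smul_mem' := by
          intro c X h Y hY
          rw [map_smul, LinearMap.smul_apply, h Y hY, smul_zero] }
    have hW := 𝔯.le_iSup_inf_weightSpace W (by
      intro H hH X hX Y hY
      rw [← lie_skew, map_neg, LinearMap.neg_apply, killingForm_lie, hX, neg_zero]
      have := 𝔯.lie_mem_fil (𝔯.mem_fil_zero_of_mem_𝔞 hH) hY
      rwa [zero_add] at this)
    refine (hW.trans (iSup_le fun l => ?_)) hX
    rintro Z ⟨hZ, hZl⟩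
    rcases eq_or_ne Z 0 with rfl | hZ0
    · exact zero_mem _
    obtain ⟨n, hn⟩ := 𝔯.exists_int_height (fun h => hZ0 (by rwa [h] at hZl)) 𝔯.Sp
    refine 𝔯.weightSpace_le_fil (l := l) ?_ hZl
    rw [hn]
    by_contra hlt
    have hn0 : n ≤ 0 := by
      rw [not_le] at hlt
      have : n < 1 := by exact_mod_cast hlt
      omega
    refine (𝔯.θ_cartan Z hZ0).ne (hZ _ ?_)
    refine 𝔯.weightSpace_le_fil (l := -l) ?_ (𝔯.θ_mem_weightSpace hZl)
    rw [height_neg, hn]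
    push_cast
    have : (n : ℝ) ≤ 0 := by exact_mod_cast hn0
    linarith

/-- A weight vector of weight `l` which is annihilated by all simple restricted root spaces has
`l` in the closed dominant cone; so `l` cannot be a nonzero nonpositive combination of simple
roots.  The elements `⁅X_k, θ X_k⁆` of `𝔞` are negative multiples of the duals of the simple
roots. -/
lemma eq_zero_of_lie_simple_eq_zero {l : Module.Dual ℝ 𝔯.𝔞} (hl : 𝔯.height 𝔯.Sp l < 0) {Z : 𝔤}
    (hZ : Z ∈ weightSpace 𝔯.𝔞 l)
    (h : ∀ k, ∀ X ∈ weightSpace 𝔯.𝔞 (𝔯.simple k), ⁅X, Z⁆ = 0) : Z = 0 := by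
  by_contra hZ0
  have hlne : weightSpace 𝔯.𝔞 l ≠ ⊥ := fun h => hZ0 (by rwa [h] at hZ)
  -- `l` is a nonpositive combination of simple roots
  obtain ⟨n, hn⟩ : ∃ n : Fin 𝔯.rank → ℕ, ∀ k, 𝔯.simple.repr l k = -(n k : ℝ) := by
    rcases 𝔯.root_coeff l hlne with h1 | h1
    · exfalso
      refine absurd hl (not_lt.2 (Finset.sum_nonneg fun k _ => ?_))
      obtain ⟨m, hm⟩ := h1 k
      rw [hm]; exact Nat.cast_nonneg m
    · exact ⟨fun k => (h1 k).choose, fun k => (h1 k).choose_spec⟩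
  have hX : ∀ k, ∃ X ∈ weightSpace 𝔯.𝔞 (𝔯.simple k), X ≠ 0 := fun k =>
    (Submodule.ne_bot_iff _).1 (𝔯.simple_root k)
  choose X hX hX0 using hX
  set c : Fin 𝔯.rank → ℝ := fun k => -killingForm ℝ 𝔤 (X k) (𝔯.θ (X k)) with hc
  have hcpos : ∀ k, 0 < c k := fun k => neg_pos.2 (𝔯.θ_cartan _ (hX0 k))
  have hmem : ∀ k, ⁅X k, 𝔯.θ (X k)⁆ ∈ 𝔯.𝔞 := by
    intro k
    refine 𝔯.𝔞_maximal _ ?_ fun H hH => ?_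
    · rw [LieEquiv.map_lie, 𝔯.θ_involutive, lie_skew]
    · have := 𝔯.lie_mem_weightSpace (hX k) (𝔯.θ_mem_weightSpace (hX k)) ⟨H, hH⟩
      simpa using this
  let t : Fin 𝔯.rank → 𝔯.𝔞 := fun k => ⟨_, hmem k⟩
  have ht : ∀ k (H : 𝔯.𝔞), killingForm ℝ 𝔤 (t k) (H : 𝔤) = -c k * 𝔯.simple k H := by
    intro k H
    change killingForm ℝ 𝔤 ⁅X k, 𝔯.θ (X k)⁆ (H : 𝔤) = _
    rw [killingForm_lie, ← lie_skew, 𝔯.θ_mem_weightSpace (hX k) H]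
    simp [hc, mul_comm]
  have hlt : ∀ k, l (t k) ≤ 0 := by
    intro k
    have h1 : ⁅X k, ⁅𝔯.θ (X k), Z⁆⁆ = l (t k) • Z := by
      rw [leibniz_lie, h k _ (hX k), lie_zero, add_zero]
      exact hZ (t k)
    have h2 : killingForm ℝ 𝔤 ⁅𝔯.θ (X k), Z⁆ (𝔯.θ ⁅𝔯.θ (X k), Z⁆)
        = -(l (t k) * killingForm ℝ 𝔤 Z (𝔯.θ Z)) := by
      rw [LieEquiv.map_lie, 𝔯.θ_involutive, ← killingForm_lie, ← lie_skew, h1]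
      simp
    have h3 : killingForm ℝ 𝔤 ⁅𝔯.θ (X k), Z⁆ (𝔯.θ ⁅𝔯.θ (X k), Z⁆) ≤ 0 := by
      rcases eq_or_ne ⁅𝔯.θ (X k), Z⁆ 0 with h0 | h0
      · rw [h0]; simp
      · exact (𝔯.θ_cartan _ h0).le
    have h4 := 𝔯.θ_cartan Z hZ0
    rw [h2] at h3
    by_contra h5
    rw [not_le] at h5
    nlinarith
  -- the element of `𝔞` dual to `l`
  let Hl : 𝔯.𝔞 := ∑ k, ((n k : ℝ) * (c k)⁻¹) • t k
  have hHl : ∀ H : 𝔯.𝔞, killingForm ℝ 𝔤 (Hl : 𝔤) (H : 𝔤) = l H := by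
    intro H
    have h1 : l = ∑ k, (-(n k : ℝ)) • 𝔯.simple k := by
      conv_lhs => rw [← 𝔯.simple.sum_repr l]
      simp only [hn]
    rw [h1]
    simp only [Hl, Submodule.coe_sum, Submodule.coe_smul, map_sum, LinearMap.sum_apply, map_smul,
      LinearMap.smul_apply, ht, smul_eq_mul]
    refine Finset.sum_congr rfl fun k _ => ?_
    have := (hcpos k).ne'
    field_simp
  have h1 : l Hl ≤ 0 := by
    simp only [Hl, map_sum, map_smul, smul_eq_mul]
    exact Finset.sum_nonpos fun k _ => mul_nonpos_of_nonneg_of_nonpos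
      (mul_nonneg (Nat.cast_nonneg _) (inv_nonneg.2 (hcpos k).le)) (hlt k)
  have h2 : (Hl : 𝔤) = 0 := by
    by_contra h0
    have := 𝔯.θ_cartan _ h0
    rw [𝔯.𝔞_neg _ Hl.2, map_neg, hHl] at this
    linarith
  have h3 : l = 0 := by
    ext H
    rw [← hHl H, h2]; simp
  rw [h3] at hl
  simp [height] at hl

/-- For `j ≤ 0`, `𝔤^(j-1, *)` consists of the elements which `𝔤^(1, *)` maps into `𝔤^(j, *)`. -/
lemma mem_fil_sub_one_iff [FiniteDimensional ℝ 𝔤] {j : ℤ} (hj : j ≤ 0) (X : 𝔤) :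
    X ∈ 𝔯.fil (j - 1) ↔ ∀ Y ∈ 𝔯.fil 1, ⁅Y, X⁆ ∈ 𝔯.fil j := by
  constructor
  · intro hX Y hY
    have := 𝔯.lie_mem_fil hY hX
    rwa [show (1 : ℤ) + (j - 1) = j by ring] at this
  · intro hX
    let W : Submodule ℝ 𝔤 :=
      { carrier := {X | ∀ Y ∈ 𝔯.fil 1, ⁅Y, X⁆ ∈ 𝔯.fil j}
        zero_mem' := by intro Y _; simp
        add_mem' := by
          intro X X' h h' Y hY
          rw [lie_add]; exact add_mem (h Y hY) (h' Y hY)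
        smul_mem' := by
          intro c X h Y hY
          rw [lie_smul]; exact Submodule.smul_mem _ _ (h Y hY) }
    have hWlie : ∀ H ∈ 𝔯.fil 0, ∀ X ∈ W, ⁅H, X⁆ ∈ W := by
      intro H hH X hX Y hY
      rw [leibniz_lie]
      refine add_mem (hX _ ?_) ?_
      · have := 𝔯.lie_mem_fil hY hH
        rwa [add_zero] at this
      · have := 𝔯.lie_mem_fil hH (hX Y hY)
        rwa [zero_add] at this
    have hW := 𝔯.le_iSup_inf_weightSpace W
      (fun H hH => hWlie H (𝔯.mem_fil_zero_of_mem_𝔞 hH))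
    refine (hW.trans (iSup_le fun l => ?_)) hX
    by_cases hht : ((j - 1 : ℤ) : ℝ) ≤ 𝔯.height 𝔯.Sp l
    · exact inf_le_right.trans (𝔯.weightSpace_le_fil hht)
    suffices hbot : W ⊓ weightSpace 𝔯.𝔞 l = ⊥ by rw [hbot]; exact bot_le
    by_contra hne
    -- among the weights below `j - 1` in `W`, one of maximal height
    let S : Set (Module.Dual ℝ 𝔯.𝔞) :=
      {l | 𝔯.height 𝔯.Sp l < ((j - 1 : ℤ) : ℝ) ∧ W ⊓ weightSpace 𝔯.𝔞 l ≠ ⊥}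
    have hfin : S.Finite := by
      refine (WellFoundedGT.finite_ne_bot_of_iSupIndep 𝔯.iSupIndep_weightSpace).subset ?_
      intro m hm h0
      exact hm.2 (by rw [h0]; exact inf_bot_eq W)
    obtain ⟨m, ⟨hm1, hm2⟩, hmax⟩ := hfin.exists_maximalFor (𝔯.height Finset.univ) S
      ⟨l, not_le.1 hht, hne⟩
    obtain ⟨Z, ⟨hZW, hZm⟩, hZ0⟩ := (Submodule.ne_bot_iff _).1 hm2
    refine hZ0 (𝔯.eq_zero_of_lie_simple_eq_zero (l := m) ?_ hZm fun k X hX => ?_)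
    · have : ((j - 1 : ℤ) : ℝ) ≤ 0 := by exact_mod_cast (by omega : j - 1 ≤ 0)
      linarith
    have hmem := 𝔯.lie_mem_weightSpace hX hZm
    by_cases hk : k ∈ 𝔯.Sp
    · refine 𝔯.eq_zero_of_mem_fil (i := j) (l := 𝔯.simple k + m) ?_ hmem (hZW X ?_)
      · rw [height_add, height_simple, if_pos hk]
        push_cast at hm1
        linarith
      · refine 𝔯.weightSpace_le_fil ?_ hX
        rw [height_simple, if_pos hk]; simp
    · by_contra h0
      have hmS : 𝔯.simple k + m ∈ S := by
        refine ⟨?_, (Submodule.ne_bot_iff _).2 ⟨_, ⟨hWlie X ?_ Z hZW, hmem⟩, h0⟩⟩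
        · rwa [height_add, height_simple, if_neg hk, zero_add]
        · refine 𝔯.weightSpace_le_fil ?_ hX
          rw [height_simple, if_neg hk]; simp
      have h1 : 𝔯.height Finset.univ (𝔯.simple k + m) = 1 + 𝔯.height Finset.univ m := by
        rw [height_add, height_simple, if_pos (Finset.mem_univ k)]
      have := hmax hmS (by rw [h1]; linarith)
      rw [h1] at this
      linarith

/-- An automorphism of `𝔤` which preserves `𝔭` preserves the filtration in nonpositive degrees. -/
lemma map_fil_of_map_𝔭 [FiniteDimensional ℝ 𝔤] (T : 𝔤 ≃ₗ⁅ℝ⁆ 𝔤)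
    (hT : ∀ X, T X ∈ 𝔯.𝔭 ↔ X ∈ 𝔯.𝔭) {i : ℤ} (hi : i ≤ 0) (X : 𝔤) : T X ∈ 𝔯.fil i ↔ X ∈ 𝔯.fil i := by
  have h1 : ∀ X, T X ∈ 𝔯.fil 1 ↔ X ∈ 𝔯.fil 1 := by
    intro X
    rw [mem_fil_one_iff, mem_fil_one_iff]
    constructor
    · intro h Y hY
      rw [← LieAlgebra.killingForm_of_equiv_apply T]
      exact h _ ((hT Y).2 hY)
    · intro h Y hY
      rw [← T.apply_symm_apply Y, LieAlgebra.killingForm_of_equiv_apply T]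
      refine h _ ((hT _).1 ?_)
      rwa [T.apply_symm_apply]
  obtain ⟨n, rfl⟩ : ∃ n : ℕ, i = -(n : ℤ) := ⟨i.natAbs, by omega⟩
  clear hi
  induction n generalizing X with
  | zero => exact hT X
  | succ n ih =>
    rw [show -((n + 1 : ℕ) : ℤ) = -(n : ℤ) - 1 by push_cast; ring,
      mem_fil_sub_one_iff _ (by omega), mem_fil_sub_one_iff _ (by omega)]
    constructor
    · intro h Y hY
      refine (ih _).1 ?_
      rw [LieEquiv.map_lie]
      exact h _ ((h1 Y).2 hY)
    · intro h Y hY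
      rw [← T.apply_symm_apply Y, ← LieEquiv.map_lie]
      refine (ih _).2 (h _ ((h1 _).1 ?_))
      rwa [T.apply_symm_apply]

end NestedParabolics

/-! ### Smooth vector fields along maps -/

section Manifolds

variable {EX : Type*} [NormedAddCommGroup EX] [NormedSpace ℝ EX]
  {X : Type*} [TopologicalSpace X] [ChartedSpace EX X]
  [IsManifold 𝓘(ℝ, EX) ∞ X]
  {EY : Type*} [NormedAddCommGroup EY] [NormedSpace ℝ EY]
  {Y : Type*} [TopologicalSpace Y] [ChartedSpace EY Y]
  {EZ : Type*} [NormedAddCommGroup EZ] [NormedSpace ℝ EZ]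
  {Z : Type*} [TopologicalSpace Z] [ChartedSpace EZ Z]
  [IsManifold 𝓘(ℝ, EZ) ∞ Z]
  {F : Type*} [NormedAddCommGroup F] [NormedSpace ℝ F]
  {F' : Type*} [NormedAddCommGroup F'] [NormedSpace ℝ F']

/-- `V` is a smooth vector field along the map `s`, at the point `y₀`. -/
abbrev SmoothAlongAt (s : Y → X) (V : ∀ y, TangentSpace 𝓘(ℝ, EX) (s y)) (y₀ : Y) : Prop :=
  ContMDiffAt 𝓘(ℝ, EY) 𝓘(ℝ, EX).tangent ∞
    (fun y => (⟨s y, V y⟩ : TangentBundle 𝓘(ℝ, EX) X)) y₀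

/-- Smoothness of a vector field along a map, tested in the chart at the point. -/
lemma smoothAlongAt_iff {s : Y → X}
    {V : ∀ y, TangentSpace 𝓘(ℝ, EX) (s y)} {y₀ : Y} :
    SmoothAlongAt (EY := EY) s V y₀ ↔ ContMDiffAt 𝓘(ℝ, EY) 𝓘(ℝ, EX) ∞ s y₀ ∧
      ContMDiffAt 𝓘(ℝ, EY) 𝓘(ℝ, EX) ∞
        (fun y => mvfderiv 𝓘(ℝ, EX) (extChartAt 𝓘(ℝ, EX) (s y₀)) (s y) (V y)) y₀ := by
  unfold SmoothAlongAt
  rw [Bundle.contMDiffAt_totalSpace]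
  refine and_congr_right fun hs => ?_
  refine Filter.EventuallyEq.contMDiffAt_iff ?_
  have h : ∀ᶠ y in 𝓝 y₀, s y ∈ (chartAt EX (s y₀)).source :=
    hs.continuousAt.preimage_mem_nhds (chart_source_mem_nhds EX (s y₀))
  filter_upwards [h] with y hy
  have h1 := TangentBundle.continuousLinearMapAt_trivializationAt (I := 𝓘(ℝ, EX)) hy
  have h2 := congrArg (fun L => L (V y)) h1
  refine Eq.trans ?_ h2
  rw [Bundle.Trivialization.continuousLinearMapAt_apply, Bundle.Trivialization.linearMapAt_apply]
  exact (if_pos (by exact hy)).symm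

/-- The image under `Tf` of a smooth vector field along `s` is a smooth vector field along
`f ∘ s`. -/
lemma SmoothAlongAt.map {s : Y → X}
    {V : ∀ y, TangentSpace 𝓘(ℝ, EX) (s y)} {y₀ : Y} (hV : SmoothAlongAt (EY := EY) s V y₀)
    {f : X → Z} (hf : ContMDiffAt 𝓘(ℝ, EX) 𝓘(ℝ, EZ) ∞ f (s y₀)) :
    SmoothAlongAt (EY := EY) (EX := EZ) (fun y => f (s y))
      (fun y => mfderiv 𝓘(ℝ, EX) 𝓘(ℝ, EZ) f (s y) (V y)) y₀ := by
  have hs : ContMDiffAt 𝓘(ℝ, EY) 𝓘(ℝ, EX) ∞ s y₀ := (smoothAlongAt_iff.1 hV).1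
  have h1 := (hf.mfderiv_const (m := ∞) le_rfl).comp y₀ hs
  refine ContMDiffAt.clm_apply_of_inCoordinates (b₁ := s) (b₂ := fun y => f (s y))
    (ϕ := fun y => mfderiv 𝓘(ℝ, EX) 𝓘(ℝ, EZ) f (s y)) ?_ hV (hf.comp y₀ hs)
  exact h1

lemma smoothAlongAt_vector {s : Y → F} {V : ∀ y, TangentSpace 𝓘(ℝ, F) (s y)} {y₀ : Y} :
    SmoothAlongAt (EY := EY) (EX := F) s V y₀ ↔ ContMDiffAt 𝓘(ℝ, EY) 𝓘(ℝ, F) ∞ s y₀ ∧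
      ContMDiffAt 𝓘(ℝ, EY) 𝓘(ℝ, F) ∞ (fun y => NormedSpace.fromTangentSpace (s y) (V y)) y₀ := by
  rw [smoothAlongAt_iff]
  have : ∀ y, mvfderiv 𝓘(ℝ, F) (extChartAt 𝓘(ℝ, F) (s y₀)) (s y) (V y)
      = NormedSpace.fromTangentSpace (s y) (V y) := by
    intro y
    have h1 : ∀ (g : F → F), g = id → ∀ (x : F) (v : TangentSpace 𝓘(ℝ, F) x),
        mvfderiv 𝓘(ℝ, F) g x v = NormedSpace.fromTangentSpace x v := by
      rintro _ rfl x v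
      rw [mvfderiv, mfderiv_id]
      rfl
    exact h1 _ (by rw [extChartAt_model_space_eq_id]; rfl) _ _
  exact and_congr_right fun _ => by rw [funext this]

lemma SmoothAlongAt.mvfderiv {s : Y → X}
    {V : ∀ y, TangentSpace 𝓘(ℝ, EX) (s y)} {y₀ : Y} (hV : SmoothAlongAt (EY := EY) s V y₀)
    {g : X → F} (hg : ContMDiffAt 𝓘(ℝ, EX) 𝓘(ℝ, F) ∞ g (s y₀)) :
    ContMDiffAt 𝓘(ℝ, EY) 𝓘(ℝ, F) ∞ (fun y => mvfderiv 𝓘(ℝ, EX) g (s y) (V y)) y₀ :=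
  (smoothAlongAt_vector.1 (hV.map hg)).2

/-- The solution of a smooth family of invertible linear equations is smooth. -/
lemma contMDiffAt_of_solves [CompleteSpace F] {n : WithTop ℕ∞} {A : Y → F →L[ℝ] F'} {c : Y → F}
    {v : Y → F'} {y₀ : Y}
    (hA : ContMDiffAt 𝓘(ℝ, EY) 𝓘(ℝ, F →L[ℝ] F') n A y₀)
    (hv : ContMDiffAt 𝓘(ℝ, EY) 𝓘(ℝ, F') n v y₀)
    (hinv : (A y₀).IsInvertible) (h : ∀ᶠ y in 𝓝 y₀, A y (c y) = v y) :
    ContMDiffAt 𝓘(ℝ, EY) 𝓘(ℝ, F) n c y₀ := by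
  have h1 : ContMDiffAt 𝓘(ℝ, EY) 𝓘(ℝ, F' →L[ℝ] F) n
      (fun y => ContinuousLinearMap.inverse (A y)) y₀ :=
    (hinv.contDiffAt_map_inverse).contMDiffAt.comp y₀ hA
  refine (h1.clm_apply hv).congr_of_eventuallyEq ?_
  obtain ⟨e, he⟩ := hinv
  have h2 : ∀ᶠ y in 𝓝 y₀, A y ∈ range ((↑) : (F ≃L[ℝ] F') → F →L[ℝ] F') :=
    hA.continuousAt.preimage_mem_nhds (he ▸ ContinuousLinearEquiv.nhds e)
  filter_upwards [h, h2] with y hy hy2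
  obtain ⟨e', he'⟩ := hy2
  rw [← hy, ← he', ContinuousLinearMap.inverse_equiv]
  simp

lemma contMDiffAt_clm_of_apply [FiniteDimensional ℝ F] {n : WithTop ℕ∞}
    {A : Y → F →L[ℝ] F'} {y₀ : Y}
    (h : ∀ v, ContMDiffAt 𝓘(ℝ, EY) 𝓘(ℝ, F') n (fun y => A y v) y₀) :
    ContMDiffAt 𝓘(ℝ, EY) 𝓘(ℝ, F →L[ℝ] F') n A y₀ := by
  let b := Module.finBasis ℝ F
  have hA : A = fun y => ∑ i, ((ContinuousLinearMap.smulRightL ℝ F F'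
      (LinearMap.toContinuousLinearMap (b.coord i))) (A y (b i))) := by
    funext y
    refine ContinuousLinearMap.ext fun v => ?_
    conv_lhs => rw [← b.sum_repr v, map_sum]
    simp
  rw [hA]
  have hsum : ∀ t : Finset (Fin (Module.finrank ℝ F)),
      ContMDiffAt 𝓘(ℝ, EY) 𝓘(ℝ, F →L[ℝ] F') n
        (fun y => ∑ i ∈ t, ((ContinuousLinearMap.smulRightL ℝ F F'
          (LinearMap.toContinuousLinearMap (b.coord i))) (A y (b i)))) y₀ := by
    intro t
    refine contMDiffAt_finsetSum fun i _ => ?_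
    exact (ContinuousLinearMap.contDiff _).contMDiff.contMDiffAt.comp y₀ (h (b i))
  exact hsum _

end Manifolds

/-! ### Lie brackets as commutators of derivations -/

section Brackets

variable {EX : Type*} [NormedAddCommGroup EX] [NormedSpace ℝ EX]
  {X : Type*} [TopologicalSpace X] [ChartedSpace EX X]
  [IsManifold 𝓘(ℝ, EX) ∞ X]
  {F : Type*} [NormedAddCommGroup F] [NormedSpace ℝ F]

lemma extChartAt_symm_contMDiffAt {p : X} {y : EX} (hy : y ∈ (extChartAt 𝓘(ℝ, EX) p).target) :
    ContMDiffAt 𝓘(ℝ, EX) 𝓘(ℝ, EX) ∞ (extChartAt 𝓘(ℝ, EX) p).symm y :=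
  (contMDiffOn_extChartAt_symm p).contMDiffAt ((isOpen_extChartAt_target p).mem_nhds hy)

lemma extChartAt_symm_isInvertible {p : X} {y : EX} (hy : y ∈ (extChartAt 𝓘(ℝ, EX) p).target) :
    (mfderiv 𝓘(ℝ, EX) 𝓘(ℝ, EX) (extChartAt 𝓘(ℝ, EX) p).symm y).IsInvertible := by
  have := isInvertible_mfderivWithin_extChartAt_symm (I := 𝓘(ℝ, EX)) hy
  rwa [ModelWithCorners.range_eq_univ, mfderivWithin_univ] at this

/-- The Lie bracket of vector fields as a commutator of derivations, at the image of a point under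
a parametrization `β`. -/
lemma mvfderiv_mlieBracket_of_param [CompleteSpace EX]
    {V W : ∀ x : X, TangentSpace 𝓘(ℝ, EX) x} {g : X → F} {β : EX → X} {T : Set EX} {y₀ : EX}
    (hopen : IsOpen T) (hy : y₀ ∈ T)
    (hβ : ∀ y ∈ T, ContMDiffAt 𝓘(ℝ, EX) 𝓘(ℝ, EX) ∞ β y)
    (hβi : ∀ y ∈ T, (mfderiv 𝓘(ℝ, EX) 𝓘(ℝ, EX) β y).IsInvertible)
    (hV : SmoothAlongAt (EY := EX) (fun x => x) V (β y₀))
    (hW : SmoothAlongAt (EY := EX) (fun x => x) W (β y₀))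
    (hg : ContMDiffAt 𝓘(ℝ, EX) 𝓘(ℝ, F) ∞ g (β y₀)) :
    mvfderiv 𝓘(ℝ, EX) g (β y₀) (VectorField.mlieBracket 𝓘(ℝ, EX) V W (β y₀)) =
      mvfderiv 𝓘(ℝ, EX) (fun x => mvfderiv 𝓘(ℝ, EX) g x (W x)) (β y₀) (V (β y₀))
        - mvfderiv 𝓘(ℝ, EX) (fun x => mvfderiv 𝓘(ℝ, EX) g x (V x)) (β y₀) (W (β y₀)) := by
  have hgn : ∀ᶠ y in 𝓝 y₀, MDifferentiableAt 𝓘(ℝ, EX) 𝓘(ℝ, F) g (β y) := by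
    have h1 : ∀ᶠ x in 𝓝 (β y₀), ContMDiffAt 𝓘(ℝ, EX) 𝓘(ℝ, F) 1 g x :=
      ((contMDiffAt_iff_contMDiffAt_nhds (by decide)).1 (hg.of_le ENat.LEInfty.out))
    filter_upwards [(hβ y₀ hy).continuousAt.eventually h1] with y h
    exact h.mdifferentiableAt one_ne_zero
  have hT : ∀ᶠ y in 𝓝 y₀, y ∈ T := hopen.mem_nhds hy
  -- derivatives along the pulled back fields
  have key : ∀ (h : X → F) (U : ∀ x : X, TangentSpace 𝓘(ℝ, EX) x) (y : EX), y ∈ T →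
      MDifferentiableAt 𝓘(ℝ, EX) 𝓘(ℝ, F) h (β y) →
      fderiv ℝ (h ∘ β) y (VectorField.mpullback 𝓘(ℝ, EX) 𝓘(ℝ, EX) β U y)
        = mvfderiv 𝓘(ℝ, EX) h (β y) (U (β y)) := by
    intro h U y hy hh
    have h1 : mfderiv 𝓘(ℝ, EX) 𝓘(ℝ, EX) β y (VectorField.mpullback 𝓘(ℝ, EX) 𝓘(ℝ, EX) β U y)
        = U (β y) := by
      obtain ⟨e, he⟩ := hβi y hy
      rw [VectorField.mpullback_apply, ← he, ContinuousLinearMap.inverse_equiv]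
      exact e.apply_symm_apply _
    have h2 := mfderiv_comp_apply (I := 𝓘(ℝ, EX)) (I' := 𝓘(ℝ, EX)) (I'' := 𝓘(ℝ, F)) y hh
      ((hβ y hy).mdifferentiableAt (by simp))
      (VectorField.mpullback 𝓘(ℝ, EX) 𝓘(ℝ, EX) β U y)
    rw [h1] at h2
    rw [← mfderiv_eq_fderiv]
    exact h2
  have hsm : ∀ (U : ∀ x : X, TangentSpace 𝓘(ℝ, EX) x),
      SmoothAlongAt (EY := EX) (fun x => x) U (β y₀) →
      ContMDiffAt 𝓘(ℝ, EX) 𝓘(ℝ, F) ∞ (fun x => mvfderiv 𝓘(ℝ, EX) g x (U x)) (β y₀) :=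
    fun U hU => hU.mvfderiv hg
  have hd : ∀ (U : ∀ x : X, TangentSpace 𝓘(ℝ, EX) x),
      SmoothAlongAt (EY := EX) (fun x => x) U (β y₀) →
      DifferentiableAt ℝ (VectorField.mpullback 𝓘(ℝ, EX) 𝓘(ℝ, EX) β U : EX → EX) y₀ := by
    intro U hU
    have h1 : ContMDiffAt 𝓘(ℝ, EX) 𝓘(ℝ, EX).tangent 1
        (fun y => (⟨y, VectorField.mpullback 𝓘(ℝ, EX) 𝓘(ℝ, EX) β U y⟩ :
          TangentBundle 𝓘(ℝ, EX) EX)) y₀ :=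
      ContMDiffAt.mpullback_vectorField_preimage (n := ∞) (hU.of_le ENat.LEInfty.out)
        (hβ y₀ hy) (hβi y₀ hy) (by rw [one_add_one_eq_two]; exact ENat.LEInfty.out)
    exact (contMDiffAt_vectorSpace_iff_contDiffAt.1 h1).differentiableAt one_ne_zero
  have hG : ContDiffAt ℝ ∞ (g ∘ β) y₀ := contMDiffAt_iff_contDiffAt.1 (hg.comp y₀ (hβ y₀ hy))
  have main := VectorField.fderiv_apply_lieBracket (𝕜 := ℝ) (n := ∞) hG
    (by simpa using ENat.LEInfty.out) (hd W hW) (hd V hV)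
  have e1 : ∀ (U : ∀ x : X, TangentSpace 𝓘(ℝ, EX) x), (fun y => fderiv ℝ (g ∘ β) y
      (VectorField.mpullback 𝓘(ℝ, EX) 𝓘(ℝ, EX) β U y)) =ᶠ[𝓝 y₀]
      (fun x => mvfderiv 𝓘(ℝ, EX) g x (U x)) ∘ β := by
    intro U
    filter_upwards [hgn, hT] with y h1 h2
    exact key g U y h2 h1
  have e2 := (e1 W).fderiv_eq (𝕜 := ℝ)
  have e3 := (e1 V).fderiv_eq (𝕜 := ℝ)
  have e4 := key _ V y₀ hy ((hsm W hW).mdifferentiableAt (by simp))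
  have e5 := key _ W y₀ hy ((hsm V hV).mdifferentiableAt (by simp))
  have e6 := key g (VectorField.mlieBracket 𝓘(ℝ, EX) V W) y₀ hy (hg.mdifferentiableAt (by simp))
  have e7 : VectorField.mpullback 𝓘(ℝ, EX) 𝓘(ℝ, EX) β (VectorField.mlieBracket 𝓘(ℝ, EX) V W) y₀
      = VectorField.lieBracket ℝ (VectorField.mpullback 𝓘(ℝ, EX) 𝓘(ℝ, EX) β V : EX → EX)
        (VectorField.mpullback 𝓘(ℝ, EX) 𝓘(ℝ, EX) β W : EX → EX) y₀ := by
    have h1 := VectorField.mpullback_mlieBracket (I := 𝓘(ℝ, EX)) (I' := 𝓘(ℝ, EX)) (n := ∞)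
      (f := β) (x₀ := y₀) (V := V) (W := W) (hV.mdifferentiableAt (by simp))
      (hW.mdifferentiableAt (by simp)) (hβ y₀ hy) (by simpa using ENat.LEInfty.out)
    rw [h1]
    rw [← VectorField.mlieBracketWithin_univ, VectorField.mlieBracketWithin_eq_lieBracketWithin]
    exact congrFun VectorField.lieBracketWithin_univ y₀
  rw [← e4, ← e5, ← e6, e7, ← e2, ← e3]
  exact main

/-- The Lie bracket of vector fields is the commutator of derivations, for functions with values
in a normed space. -/
theorem mvfderiv_mlieBracket [CompleteSpace EX] {V W : ∀ x : X, TangentSpace 𝓘(ℝ, EX) x}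
    {g : X → F} {x₀ : X}
    (hV : SmoothAlongAt (EY := EX) (fun x => x) V x₀)
    (hW : SmoothAlongAt (EY := EX) (fun x => x) W x₀)
    (hg : ContMDiffAt 𝓘(ℝ, EX) 𝓘(ℝ, F) ∞ g x₀) :
    mvfderiv 𝓘(ℝ, EX) g x₀ (VectorField.mlieBracket 𝓘(ℝ, EX) V W x₀) =
      mvfderiv 𝓘(ℝ, EX) (fun x => mvfderiv 𝓘(ℝ, EX) g x (W x)) x₀ (V x₀)
        - mvfderiv 𝓘(ℝ, EX) (fun x => mvfderiv 𝓘(ℝ, EX) g x (V x)) x₀ (W x₀) := by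
  let P : X → Prop := fun x₀ => SmoothAlongAt (EY := EX) (fun x => x) V x₀ →
    SmoothAlongAt (EY := EX) (fun x => x) W x₀ → ContMDiffAt 𝓘(ℝ, EX) 𝓘(ℝ, F) ∞ g x₀ →
    mvfderiv 𝓘(ℝ, EX) g x₀ (VectorField.mlieBracket 𝓘(ℝ, EX) V W x₀) =
      mvfderiv 𝓘(ℝ, EX) (fun x => mvfderiv 𝓘(ℝ, EX) g x (W x)) x₀ (V x₀)
        - mvfderiv 𝓘(ℝ, EX) (fun x => mvfderiv 𝓘(ℝ, EX) g x (V x)) x₀ (W x₀)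
  have h : P ((extChartAt 𝓘(ℝ, EX) x₀).symm (extChartAt 𝓘(ℝ, EX) x₀ x₀)) :=
    mvfderiv_mlieBracket_of_param (isOpen_extChartAt_target x₀) (mem_extChartAt_target x₀)
      (fun _ hy => extChartAt_symm_contMDiffAt hy) (fun _ hy => extChartAt_symm_isInvertible hy)
  rw [extChartAt_to_inv] at h
  exact h hV hW hg

end Brackets

/-! ### Lie brackets as derivatives along motions -/

section Brackets

variable {EX : Type*} [NormedAddCommGroup EX] [NormedSpace ℝ EX]
  {X : Type*} [TopologicalSpace X] [ChartedSpace EX X]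
  {F : Type*} [NormedAddCommGroup F] [NormedSpace ℝ F]

/-- Symmetry of the mixed second derivatives of a function `h (y, t)`, in the form of a formula
for the derivative of `t ↦ ∂₁ h (y₀, t) (Z t)`. -/
lemma hasDerivAt_fderiv_partial {h : EX × ℝ → F} {y₀ : EX} (hh : ContDiffAt ℝ ∞ h (y₀, 0))
    {Z : ℝ → EX} {Z' : EX} (hZ : HasDerivAt Z Z' 0) :
    HasDerivAt (fun t => fderiv ℝ h (y₀, t) (Z t, 0))
      (fderiv ℝ (fun y => fderiv ℝ h (y, 0) (0, 1)) y₀ (Z 0) + fderiv ℝ h (y₀, 0) (Z', 0)) 0 := by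
  have hd : DifferentiableAt ℝ (fderiv ℝ h) (y₀, 0) :=
    (hh.fderiv_right (m := 1) (by rw [one_add_one_eq_two]; exact ENat.LEInfty.out)).differentiableAt
      one_ne_zero
  have hsymm : IsSymmSndFDerivAt ℝ h (y₀, 0) :=
    hh.isSymmSndFDerivAt (by simpa using ENat.LEInfty.out)
  have h1 : HasDerivAt (fun t : ℝ => fderiv ℝ h (y₀, t))
      (fderiv ℝ (fderiv ℝ h) (y₀, 0) (0, 1)) 0 :=
    hd.hasFDerivAt.comp_hasDerivAt (0 : ℝ) ((hasDerivAt_const (0 : ℝ) y₀).prodMk (hasDerivAt_id _))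
  have h2 : HasDerivAt (fun t : ℝ => (Z t, (0 : ℝ))) (Z', 0) 0 :=
    hZ.prodMk (hasDerivAt_const _ _)
  have h3 : HasFDerivAt (fun y : EX => fderiv ℝ h (y, 0))
      ((fderiv ℝ (fderiv ℝ h) (y₀, 0)).comp (ContinuousLinearMap.inl ℝ EX ℝ)) y₀ :=
    hd.hasFDerivAt.comp y₀ (hasFDerivAt_prodMk_left y₀ (0 : ℝ))
  have h4 := (h3.clm_apply (hasFDerivAt_const ((0 : EX), (1 : ℝ)) y₀)).fderiv
  rw [h4]
  convert! h1.clm_apply h2 using 1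
  simp only [ContinuousLinearMap.comp_zero, zero_add, ContinuousLinearMap.flip_apply,
    ContinuousLinearMap.comp_apply, ContinuousLinearMap.inl_apply]
  rw [hsymm.eq]

/-- The derivative of a vector-valued function is its derivative in the chart at the point. -/
lemma mvfderiv_eq_fderiv_chart {φ : X → F} {x₀ : X} (hφ : MDifferentiableAt 𝓘(ℝ, EX) 𝓘(ℝ, F) φ x₀)
    (v : TangentSpace 𝓘(ℝ, EX) x₀) :
    mvfderiv 𝓘(ℝ, EX) φ x₀ v
      = fderiv ℝ (φ ∘ (extChartAt 𝓘(ℝ, EX) x₀).symm) (extChartAt 𝓘(ℝ, EX) x₀ x₀) v := by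
  have h := congrArg (fun L => L v) hφ.mvfderiv
  rw [ModelWithCorners.range_eq_univ, fderivWithin_univ] at h
  refine h.trans ?_
  have h1 : writtenInExtChartAt 𝓘(ℝ, EX) 𝓘(ℝ, F) x₀ φ
      = φ ∘ (extChartAt 𝓘(ℝ, EX) x₀).symm := by
    unfold writtenInExtChartAt
    rw [extChartAt_model_space_eq_id]; rfl
  rw [h1]
  rfl

/-- Let `m : X × ℝ → X` be smooth with `m x 0 = x`, and `V` its velocity at time zero.  If the field
`W` at `m x₀ t` is the image of `Z t ∈ T_{x₀} X` under the derivative of `m · t`, then `[V, W]` at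
`x₀` is the derivative of `Z` at zero. -/
theorem mlieBracket_eq_of_motion [CompleteSpace EX] [IsManifold 𝓘(ℝ, EX) ∞ X]
    {V W : ∀ x : X, TangentSpace 𝓘(ℝ, EX) x}
    {m : X → ℝ → X} {x₀ : X} {Z : ℝ → EX} {Z' : EX}
    (hV : SmoothAlongAt (EY := EX) (fun x => x) V x₀)
    (hW : SmoothAlongAt (EY := EX) (fun x => x) W x₀)
    (hm : ContMDiffAt (𝓘(ℝ, EX).prod 𝓘(ℝ, ℝ)) 𝓘(ℝ, EX) ∞ (fun p : X × ℝ => m p.1 p.2) (x₀, 0))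
    (hm0 : ∀ x, m x 0 = x)
    (hmV : ∀ x, (mfderiv 𝓘(ℝ, ℝ) 𝓘(ℝ, EX) (m x) 0 (1 : ℝ) : EX) = V x)
    (hmW : ∀ t, (mfderiv 𝓘(ℝ, EX) 𝓘(ℝ, EX) (fun x => m x t) x₀ (Z t) : EX) = W (m x₀ t))
    (hZ : HasDerivAt Z Z' 0) :
    (VectorField.mlieBracket 𝓘(ℝ, EX) V W x₀ : EX) = Z' := by
  let g : X → EX := ⇑(extChartAt 𝓘(ℝ, EX) x₀)
  let β : EX → X := ⇑(extChartAt 𝓘(ℝ, EX) x₀).symm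
  let y₀ : EX := g x₀
  have hβy : β y₀ = x₀ := extChartAt_to_inv x₀
  have hgs : ∀ x ∈ (chartAt EX x₀).source, ContMDiffAt 𝓘(ℝ, EX) 𝓘(ℝ, EX) ∞ g x := fun x hx =>
    contMDiffAt_extChartAt' hx
  have hg : ContMDiffAt 𝓘(ℝ, EX) 𝓘(ℝ, EX) ∞ g x₀ := hgs x₀ (mem_chart_source EX x₀)
  have hβ : ContMDiffAt 𝓘(ℝ, EX) 𝓘(ℝ, EX) ∞ β y₀ :=
    extChartAt_symm_contMDiffAt (mem_extChartAt_target x₀)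
  have hdg : ∀ v : TangentSpace 𝓘(ℝ, EX) x₀, mvfderiv 𝓘(ℝ, EX) g x₀ v = v := by
    intro v
    change (mfderiv 𝓘(ℝ, EX) 𝓘(ℝ, EX) g x₀ v : EX) = v
    exact congrArg (fun L => L v) (mfderiv_extChartAt_self (I := 𝓘(ℝ, EX)) (x := x₀))
  -- `m` in the chart
  let h : EX × ℝ → EX := fun p => g (m (β p.1) p.2)
  have hT : ∀ᶠ y in 𝓝 y₀, y ∈ (extChartAt 𝓘(ℝ, EX) x₀).target := extChartAt_target_mem_nhds x₀
  have hβ' : ContMDiffAt (𝓘(ℝ, EX).prod 𝓘(ℝ, ℝ)) (𝓘(ℝ, EX).prod 𝓘(ℝ, ℝ)) ∞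
      (fun p : EX × ℝ => (β p.1, p.2)) (y₀, 0) :=
    ContMDiffAt.prodMap hβ contMDiffAt_id
  have hm1 : ContMDiffAt (𝓘(ℝ, EX).prod 𝓘(ℝ, ℝ)) 𝓘(ℝ, EX) ∞
      (fun p : EX × ℝ => m (β p.1) p.2) (y₀, 0) := by
    refine ContMDiffAt.comp (y₀, (0 : ℝ)) (g := fun p : X × ℝ => m p.1 p.2) ?_ hβ'
    rw [hβy]; exact hm
  have hh : ContDiffAt ℝ ∞ h (y₀, 0) := by
    have : ContMDiffAt (𝓘(ℝ, EX).prod 𝓘(ℝ, ℝ)) 𝓘(ℝ, EX) ∞ h (y₀, 0) := by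
      refine ContMDiffAt.comp (y₀, (0 : ℝ)) (g := g) ?_ hm1
      simp only [hβy, hm0]; exact hg
    rw [← modelWithCornersSelf_prod, chartedSpaceSelf_prod] at this
    exact contMDiffAt_iff_contDiffAt.1 this
  have hh1 : ∀ᶠ p in 𝓝 ((y₀, 0) : EX × ℝ), DifferentiableAt ℝ h p := by
    have := (hh.of_le (show (1 : WithTop ℕ∞) ≤ ∞ from ENat.LEInfty.out)).eventually (by simp)
    filter_upwards [this] with p hp
    exact hp.differentiableAt one_ne_zero
  have hmn : ∀ᶠ p in 𝓝 ((x₀, 0) : X × ℝ), MDifferentiableAt (𝓘(ℝ, EX).prod 𝓘(ℝ, ℝ)) 𝓘(ℝ, EX)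
      (fun p : X × ℝ => m p.1 p.2) p := by
    have := (contMDiffAt_iff_contMDiffAt_nhds (n := 1) (by decide)).1 (hm.of_le ENat.LEInfty.out)
    filter_upwards [this] with p hp
    exact hp.mdifferentiableAt one_ne_zero
  have hgd : ∀ x ∈ (chartAt EX x₀).source, MDifferentiableAt 𝓘(ℝ, EX) 𝓘(ℝ, EX) g x := fun x hx =>
    (hgs x hx).mdifferentiableAt (by simp)
  -- the two first-order partial derivatives of `h`
  have hb : (fun x => mvfderiv 𝓘(ℝ, EX) g x (V x)) ∘ β
      =ᶠ[𝓝 y₀] fun y => fderiv ℝ h (y, 0) (0, 1) := by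
    have c1 : Tendsto (fun y : EX => (y, (0 : ℝ))) (𝓝 y₀) (𝓝 (y₀, 0)) :=
      (by fun_prop : Continuous fun y : EX => (y, (0 : ℝ))).continuousAt
    have c2 : Tendsto (fun y : EX => (β y, (0 : ℝ))) (𝓝 y₀) (𝓝 (x₀, 0)) := by
      have := hβ.continuousAt
      rw [ContinuousAt, hβy] at this
      exact this.prodMk_nhds tendsto_const_nhds
    filter_upwards [hT, c1.eventually hh1, c2.eventually hmn] with y hy h1 h2
    have hx : β y ∈ (chartAt EX x₀).source := by
      have := (extChartAt 𝓘(ℝ, EX) x₀).map_target hy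
      rwa [extChartAt_source] at this
    have d1 : HasDerivAt (fun t : ℝ => h (y, t)) (fderiv ℝ h (y, 0) (0, 1)) 0 :=
      h1.hasFDerivAt.comp_hasDerivAt (0 : ℝ)
        ((hasDerivAt_const (0 : ℝ) y).prodMk (hasDerivAt_id _))
    have d2 : MDifferentiableAt 𝓘(ℝ, ℝ) 𝓘(ℝ, EX) (m (β y)) 0 :=
      h2.comp (0 : ℝ) (mdifferentiableAt_const.prodMk mdifferentiableAt_id)
    have d3 := mfderiv_comp_apply (I := 𝓘(ℝ, ℝ)) (I' := 𝓘(ℝ, EX)) (I'' := 𝓘(ℝ, EX)) (g := g)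
      (0 : ℝ) (by rw [hm0]; exact hgd _ hx) d2 (1 : ℝ)
    have d4 : ∀ x v, x = β y → v = (V (β y) : EX) → (mfderiv 𝓘(ℝ, EX) 𝓘(ℝ, EX) g x v : EX)
        = mvfderiv 𝓘(ℝ, EX) g (β y) (V (β y)) := by
      rintro _ _ rfl rfl; rfl
    rw [← d1.deriv, ← fderiv_apply_one_eq_deriv, ← mfderiv_eq_fderiv]
    exact (d3.trans (d4 _ _ (hm0 _) (hmV _))).symm
  have ha : (fun t => mvfderiv 𝓘(ℝ, EX) g (m x₀ t) (W (m x₀ t)))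
      =ᶠ[𝓝 0] fun t => fderiv ℝ h (y₀, t) (Z t, 0) := by
    have c1 : Tendsto (fun t : ℝ => (y₀, t)) (𝓝 0) (𝓝 (y₀, 0)) :=
      (by fun_prop : Continuous fun t : ℝ => (y₀, t)).continuousAt
    have c2 : Tendsto (fun t : ℝ => (x₀, t)) (𝓝 0) (𝓝 (x₀, 0)) :=
      (by fun_prop : Continuous fun t : ℝ => (x₀, t)).continuousAt
    have c3 : ∀ᶠ t in 𝓝 (0 : ℝ), m x₀ t ∈ (chartAt EX x₀).source := by
      have : ContinuousAt (fun t : ℝ => m x₀ t) 0 :=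
        ContinuousAt.comp (g := fun p : X × ℝ => m p.1 p.2) hm.continuousAt c2
      refine this.preimage_mem_nhds ?_
      rw [hm0]; exact chart_source_mem_nhds EX x₀
    filter_upwards [c3, c1.eventually hh1, c2.eventually hmn] with t hx h1 h2
    have d1 : HasFDerivAt (fun y : EX => h (y, t))
        ((fderiv ℝ h (y₀, t)).comp (ContinuousLinearMap.inl ℝ EX ℝ)) y₀ :=
      HasFDerivAt.comp (g := h) (f := fun y : EX => (y, t)) y₀ h1.hasFDerivAt
        (hasFDerivAt_prodMk_left y₀ t)
    have d2 : MDifferentiableAt 𝓘(ℝ, EX) 𝓘(ℝ, EX) (fun x => m x t) x₀ :=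
      h2.comp x₀ (mdifferentiableAt_id.prodMk mdifferentiableAt_const)
    have d3 := mfderiv_comp_apply (I := 𝓘(ℝ, EX)) (I' := 𝓘(ℝ, EX)) (I'' := 𝓘(ℝ, EX)) (g := g)
      x₀ (hgd _ hx) d2 (Z t)
    have d4 := mvfderiv_eq_fderiv_chart ((hgd _ hx).comp x₀ d2) (Z t)
    have d5 : fderiv ℝ h (y₀, t) (Z t, 0) = fderiv ℝ (fun y : EX => h (y, t)) y₀ (Z t) := by
      rw [d1.fderiv]; rfl
    rw [d5, ← hmW t]
    exact d3.symm.trans d4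
  -- differentiate once more
  have hZ0 : Z 0 = W x₀ := by
    have h1 := hmW 0
    have h2 : (fun x => m x 0) = id := funext hm0
    have h3 : ∀ f : X → X, f = id → (mfderiv 𝓘(ℝ, EX) 𝓘(ℝ, EX) f x₀ (Z 0) : EX) = Z 0 := by
      rintro _ rfl
      rw [mfderiv_id]; rfl
    have h4 : ∀ x, x = x₀ → (W x : EX) = W x₀ := by rintro _ rfl; rfl
    exact (h3 _ h2).symm.trans (h1.trans (h4 _ (hm0 x₀)))
  have kV := hV.mvfderiv hg
  have kW := hW.mvfderiv hg
  have e1 : mvfderiv 𝓘(ℝ, EX) (fun x => mvfderiv 𝓘(ℝ, EX) g x (V x)) x₀ (W x₀)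
      = fderiv ℝ (fun y => fderiv ℝ h (y, 0) (0, 1)) y₀ (Z 0) := by
    rw [← hb.fderiv_eq, hZ0]
    exact mvfderiv_eq_fderiv_chart (kV.mdifferentiableAt (by simp)) (W x₀)
  have e2 : mvfderiv 𝓘(ℝ, EX) (fun x => mvfderiv 𝓘(ℝ, EX) g x (W x)) x₀ (V x₀)
      = deriv (fun t => fderiv ℝ h (y₀, t) (Z t, 0)) 0 := by
    have d2 : MDifferentiableAt 𝓘(ℝ, ℝ) 𝓘(ℝ, EX) (m x₀) 0 :=
      MDifferentiableAt.comp (g := fun p : X × ℝ => m p.1 p.2) (0 : ℝ)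
        (hm.mdifferentiableAt (by simp)) (mdifferentiableAt_const.prodMk mdifferentiableAt_id)
    have d3 := mfderiv_comp_apply (I := 𝓘(ℝ, ℝ)) (I' := 𝓘(ℝ, EX)) (I'' := 𝓘(ℝ, EX))
      (g := fun x => mvfderiv 𝓘(ℝ, EX) g x (W x))
      (0 : ℝ) (by rw [hm0]; exact kW.mdifferentiableAt (by simp)) d2 (1 : ℝ)
    have d4 : ∀ x v, x = x₀ → v = (V x₀ : EX) →
        (mfderiv 𝓘(ℝ, EX) 𝓘(ℝ, EX) (fun x => mvfderiv 𝓘(ℝ, EX) g x (W x)) x v : EX)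
        = mvfderiv 𝓘(ℝ, EX) (fun x => mvfderiv 𝓘(ℝ, EX) g x (W x)) x₀ (V x₀) := by
      rintro _ _ rfl rfl; rfl
    rw [← ha.deriv_eq, ← fderiv_apply_one_eq_deriv, ← mfderiv_eq_fderiv]
    exact (d3.trans (d4 _ _ (hm0 _) (hmV _))).symm
  have e3 : fderiv ℝ h (y₀, 0) (Z', 0) = Z' := by
    have d1 : HasFDerivAt (fun y : EX => h (y, 0))
        ((fderiv ℝ h (y₀, 0)).comp (ContinuousLinearMap.inl ℝ EX ℝ)) y₀ :=
      HasFDerivAt.comp (g := h) (f := fun y : EX => (y, (0 : ℝ))) y₀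
        (hh1.self_of_nhds).hasFDerivAt (hasFDerivAt_prodMk_left y₀ (0 : ℝ))
    have d2 : (fun y : EX => h (y, 0)) =ᶠ[𝓝 y₀] id := by
      filter_upwards [hT] with y hy
      change g (m (β y) 0) = y
      rw [hm0]
      exact (extChartAt 𝓘(ℝ, EX) x₀).right_inv hy
    have d3 := d1.fderiv
    rw [d2.fderiv_eq, fderiv_id] at d3
    exact (congrArg (fun L => L Z') d3).symm
  have main := mvfderiv_mlieBracket hV hW hg
  rw [e1, e2, (hasDerivAt_fderiv_partial hh hZ).deriv, e3, add_sub_cancel_left] at main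
  exact (hdg _).symm.trans main

end Brackets

/-! ### Submersions -/

section Submersions

/-- Around a point at which the derivative of `G` is surjective, `G` is the first component of a
diffeomorphism. -/
lemma exists_straightening_vector {E F : Type*} [NormedAddCommGroup E] [NormedSpace ℝ E]
    [FiniteDimensional ℝ E] [NormedAddCommGroup F] [NormedSpace ℝ F] [FiniteDimensional ℝ F]
    {G : E → F} {O : Set E} (hO : IsOpen O) (hG : ContDiffOn ℝ ∞ G O) {y₀ : E} (hy₀ : y₀ ∈ O)
    (hs : Function.Surjective (fderiv ℝ G y₀)) :
    ∃ (K : Submodule ℝ E) (Φ : OpenPartialHomeomorph E (F × K)), y₀ ∈ Φ.source ∧ Φ.source ⊆ O ∧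
      (∀ y ∈ Φ.source, (Φ y).1 = G y) ∧ ContDiffOn ℝ ∞ Φ Φ.source ∧
      ContDiffOn ℝ ∞ Φ.symm Φ.target := by
  have : CompleteSpace E := FiniteDimensional.complete ℝ E
  have : CompleteSpace F := FiniteDimensional.complete ℝ F
  let K : Submodule ℝ E := LinearMap.ker (fderiv ℝ G y₀ : E →ₗ[ℝ] F)
  have : CompleteSpace K := FiniteDimensional.complete ℝ K
  obtain ⟨p, hp⟩ : ∃ p : E →L[ℝ] K, ∀ x : K, p x = x :=
    Submodule.ClosedComplemented.of_finiteDimensional K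
  have hpr : LinearMap.range (p : E →ₗ[ℝ] K) = ⊤ := LinearMap.range_eq_top.2 fun k => ⟨k, hp k⟩
  have hpc : IsCompl K (LinearMap.ker (p : E →ₗ[ℝ] K)) := LinearMap.isCompl_of_proj hp
  let L : E ≃L[ℝ] F × K := ContinuousLinearMap.equivProdOfSurjectiveOfIsCompl (fderiv ℝ G y₀) p
    (LinearMap.range_eq_top.2 hs) hpr hpc
  let Φ₀ : E → F × K := fun y => (G y, p y)
  have hΦ₀ : ContDiffOn ℝ ∞ Φ₀ O := hG.prodMk p.contDiff.contDiffOn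
  have hΦat : ∀ y ∈ O, ContDiffAt ℝ ∞ Φ₀ y := fun y hy => hΦ₀.contDiffAt (hO.mem_nhds hy)
  have hd₀ : HasFDerivAt Φ₀ (L : E →L[ℝ] F × K) y₀ :=
    (((hG.contDiffAt (hO.mem_nhds hy₀)).differentiableAt (by simp)).hasFDerivAt).prodMk
      p.hasFDerivAt
  let Φ₁ := ContDiffAt.toOpenPartialHomeomorph Φ₀ (hΦat y₀ hy₀) hd₀ (by simp)
  have hΦ₁ : ⇑Φ₁ = Φ₀ := ContDiffAt.toOpenPartialHomeomorph_coe (hΦat y₀ hy₀) hd₀ (by simp)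
  let O' : Set E := O ∩ fderiv ℝ Φ₀ ⁻¹' range ContinuousLinearEquiv.toContinuousLinearMap
  have hO' : IsOpen O' :=
    (hΦ₀.continuousOn_fderiv_of_isOpen hO ENat.LEInfty.out).isOpen_inter_preimage hO
      ContinuousLinearEquiv.isOpen
  have hsrc : (Φ₁.restr O').source = Φ₁.source ∩ O' := Φ₁.restr_source' O' hO'
  refine ⟨K, Φ₁.restr O', ?_, ?_, ?_, ?_, ?_⟩
  · rw [hsrc]
    exact ⟨ContDiffAt.mem_toOpenPartialHomeomorph_source (hΦat y₀ hy₀) hd₀ (by simp), hy₀,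
      L, hd₀.fderiv.symm⟩
  · rw [hsrc]; exact fun y hy => hy.2.1
  · intro y _
    change (Φ₁ y).1 = _
    rw [hΦ₁]
  · change ContDiffOn ℝ ∞ Φ₁ _
    rw [hΦ₁, hsrc]
    exact hΦ₀.mono fun y hy => hy.2.1
  · intro b hb
    have h1 : (Φ₁.restr O').symm b ∈ O' := by
      have := (Φ₁.restr O').map_target hb
      rw [hsrc] at this; exact this.2
    obtain ⟨L', hL'⟩ := h1.2
    have h2 := (hΦat _ h1.1).differentiableAt (by simp) |>.hasFDerivAt
    rw [← hL'] at h2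
    refine ((Φ₁.restr O').contDiffAt_symm (f₀' := L') hb ?_ ?_).contDiffWithinAt
    · change HasFDerivAt Φ₁ _ _
      rw [hΦ₁]; exact h2
    · change ContDiffAt ℝ ∞ Φ₁ _
      rw [hΦ₁]; exact hΦat _ h1.1

variable {EX : Type*} [NormedAddCommGroup EX] [NormedSpace ℝ EX]
  {X : Type*} [TopologicalSpace X] [ChartedSpace EX X]
  {EZ : Type*} [NormedAddCommGroup EZ] [NormedSpace ℝ EZ]
  {Z : Type*} [TopologicalSpace Z] [ChartedSpace EZ Z]

lemma mvfderiv_extChartAt_comp {f : X → Z} {u : X} {z : Z}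
    (hf : MDifferentiableAt 𝓘(ℝ, EX) 𝓘(ℝ, EZ) f u) [IsManifold 𝓘(ℝ, EZ) ∞ Z] (hz : f u = z)
    (v : TangentSpace 𝓘(ℝ, EX) u) :
    mvfderiv 𝓘(ℝ, EX) (fun x => extChartAt 𝓘(ℝ, EZ) z (f x)) u v
      = (mfderiv 𝓘(ℝ, EX) 𝓘(ℝ, EZ) f u v : EZ) := by
  subst hz
  have h1 : MDifferentiableAt 𝓘(ℝ, EZ) 𝓘(ℝ, EZ) (extChartAt 𝓘(ℝ, EZ) (f u)) (f u) :=
    (contMDiffAt_extChartAt (n := ∞)).mdifferentiableAt (by simp)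
  have h2 := mfderiv_comp_apply (I := 𝓘(ℝ, EX)) (I' := 𝓘(ℝ, EZ)) (I'' := 𝓘(ℝ, EZ))
    (g := extChartAt 𝓘(ℝ, EZ) (f u)) u h1 hf v
  refine h2.trans ?_
  exact congrArg (fun L => L (mfderiv 𝓘(ℝ, EX) 𝓘(ℝ, EZ) f u v))
    (mfderiv_extChartAt_self (I := 𝓘(ℝ, EZ)) (x := f u))

variable [IsManifold 𝓘(ℝ, EX) ∞ X] [IsManifold 𝓘(ℝ, EZ) ∞ Z]
  [FiniteDimensional ℝ EX] [FiniteDimensional ℝ EZ]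

/-- In suitable coordinates, a submersion is a linear projection. -/
lemma exists_straightening {f : X → Z} {V : Set X} (hV : IsOpen V)
    (hf : ContMDiffOn 𝓘(ℝ, EX) 𝓘(ℝ, EZ) ∞ f V) {u₀ : X} (hu₀ : u₀ ∈ V)
    (hs : Function.Surjective (mfderiv 𝓘(ℝ, EX) 𝓘(ℝ, EZ) f u₀)) :
    ∃ (K : Submodule ℝ EX) (Φ : OpenPartialHomeomorph X (EZ × K)), u₀ ∈ Φ.source ∧ Φ.source ⊆ V ∧
      (∀ u ∈ Φ.source, f u ∈ (extChartAt 𝓘(ℝ, EZ) (f u₀)).source ∧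
        (Φ u).1 = extChartAt 𝓘(ℝ, EZ) (f u₀) (f u)) ∧
      ContMDiffOn 𝓘(ℝ, EX) 𝓘(ℝ, EZ × K) ∞ Φ Φ.source ∧
      ContMDiffOn 𝓘(ℝ, EZ × K) 𝓘(ℝ, EX) ∞ Φ.symm Φ.target := by
  let φ := chartAt EX u₀
  let c := extChartAt 𝓘(ℝ, EZ) (f u₀)
  let V' : Set X := V ∩ f ⁻¹' c.source
  have hV' : IsOpen V' := hf.continuousOn.isOpen_inter_preimage hV (isOpen_extChartAt_source _)
  let O : Set EX := φ.target ∩ φ.symm ⁻¹' V'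
  have hO : IsOpen O := φ.isOpen_inter_preimage_symm hV'
  have hφu : φ.symm (φ u₀) = u₀ := φ.left_inv (mem_chart_source EX u₀)
  have hy₀ : φ u₀ ∈ O := by
    refine ⟨φ.map_source (mem_chart_source EX u₀), ?_⟩
    rw [mem_preimage, hφu]
    exact ⟨hu₀, mem_extChartAt_source _⟩
  let G : EX → EZ := fun y => c (f (φ.symm y))
  have hcf : ContMDiffOn 𝓘(ℝ, EX) 𝓘(ℝ, EZ) ∞ (fun x => c (f x)) V' := by
    have h1 : ContMDiffOn 𝓘(ℝ, EZ) 𝓘(ℝ, EZ) ∞ c (chartAt EZ (f u₀)).source :=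
      contMDiffOn_extChartAt
    refine h1.comp (hf.mono inter_subset_left) fun x hx => ?_
    have := hx.2
    rwa [mem_preimage, extChartAt_source] at this
  have hG : ContDiffOn ℝ ∞ G O := by
    rw [← contMDiffOn_iff_contDiffOn]
    exact hcf.comp ((contMDiffOn_chart_symm (I := 𝓘(ℝ, EX)) (x := u₀)).mono inter_subset_left)
      fun y hy => hy.2
  have hfd : MDifferentiableAt 𝓘(ℝ, EX) 𝓘(ℝ, EZ) f u₀ :=
    (hf.contMDiffAt (hV.mem_nhds hu₀)).mdifferentiableAt (by simp)
  have hsurj : Function.Surjective (fderiv ℝ G (φ u₀)) := by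
    intro b
    obtain ⟨v, hv⟩ := hs b
    refine ⟨v, ?_⟩
    have h1 := mvfderiv_extChartAt_comp hfd rfl v
    have h2 : MDifferentiableAt 𝓘(ℝ, EX) 𝓘(ℝ, EZ) (fun x => c (f x)) u₀ :=
      (hcf.contMDiffAt (hV'.mem_nhds ⟨hu₀, mem_extChartAt_source _⟩)).mdifferentiableAt (by simp)
    exact (mvfderiv_eq_fderiv_chart h2 v).symm.trans (h1.trans hv)
  obtain ⟨K, Ψ, hyΨ, hΨO, hΨ1, hΨs, hΨs'⟩ := exists_straightening_vector hO hG hy₀ hsurj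
  have hsrc : (φ.trans Ψ).source = φ.source ∩ φ ⁻¹' Ψ.source := φ.trans_source Ψ
  have htgt : (φ.trans Ψ).target = Ψ.target ∩ Ψ.symm ⁻¹' φ.target := φ.trans_target Ψ
  refine ⟨K, φ.trans Ψ, ?_, ?_, ?_, ?_, ?_⟩
  · rw [hsrc]; exact ⟨mem_chart_source EX u₀, hyΨ⟩
  · rw [hsrc]
    rintro u ⟨hu, hu'⟩
    have := (hΨO hu').2.1
    rwa [φ.left_inv hu] at this
  · rw [hsrc]
    rintro u ⟨hu, hu'⟩
    have h1 := (hΨO hu').2.2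
    have h2 := hΨ1 _ hu'
    change (Ψ (φ u)).1 = c (f (φ.symm (φ u))) at h2
    rw [φ.left_inv hu] at h1 h2
    exact ⟨h1, h2⟩
  · rw [hsrc]
    exact (contMDiffOn_iff_contDiffOn.2 hΨs).comp
      ((contMDiffOn_chart (I := 𝓘(ℝ, EX)) (x := u₀)).mono inter_subset_left) fun u hu => hu.2
  · rw [htgt]
    exact (contMDiffOn_chart_symm (I := 𝓘(ℝ, EX)) (x := u₀)).comp
      ((contMDiffOn_iff_contDiffOn.2 hΨs').mono inter_subset_left) fun u hu => hu.2

/-- A submersion has smooth local sections through every point. -/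
lemma exists_local_section {f : X → Z} {V : Set X} (hV : IsOpen V)
    (hf : ContMDiffOn 𝓘(ℝ, EX) 𝓘(ℝ, EZ) ∞ f V) {u₀ : X} (hu₀ : u₀ ∈ V)
    (hs : Function.Surjective (mfderiv 𝓘(ℝ, EX) 𝓘(ℝ, EZ) f u₀)) :
    ∃ (O : Set Z) (s : Z → X), IsOpen O ∧ f u₀ ∈ O ∧ s (f u₀) = u₀ ∧
      ContMDiffOn 𝓘(ℝ, EZ) 𝓘(ℝ, EX) ∞ s O ∧ ∀ z ∈ O, s z ∈ V ∧ f (s z) = z := by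
  obtain ⟨K, Φ, hu, hΦV, hΦ1, -, hΦs⟩ := exists_straightening hV hf hu₀ hs
  let c := extChartAt 𝓘(ℝ, EZ) (f u₀)
  let k₀ : K := (Φ u₀).2
  let j : Z → EZ × K := fun z => (c z, k₀)
  have hj : ContMDiffOn 𝓘(ℝ, EZ) 𝓘(ℝ, EZ × K) ∞ j c.source := by
    have h1 : ContMDiffOn 𝓘(ℝ, EZ) 𝓘(ℝ, EZ) ∞ c c.source := by
      rw [extChartAt_source]; exact contMDiffOn_extChartAt
    exact h1.prodMk_space contMDiffOn_const
  refine ⟨c.source ∩ j ⁻¹' Φ.target, fun z => Φ.symm (j z), ?_, ?_, ?_, ?_, ?_⟩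
  · exact hj.continuousOn.isOpen_inter_preimage (isOpen_extChartAt_source _) Φ.open_target
  · refine ⟨mem_extChartAt_source _, ?_⟩
    have : j (f u₀) = Φ u₀ := Prod.ext (hΦ1 _ hu).2.symm rfl
    rw [mem_preimage, this]; exact Φ.map_source hu
  · have : j (f u₀) = Φ u₀ := Prod.ext (hΦ1 _ hu).2.symm rfl
    simp only [this, Φ.left_inv hu]
  · exact hΦs.comp (hj.mono inter_subset_left) fun z hz => hz.2
  · rintro z ⟨hz, hz'⟩
    have h1 := Φ.map_target hz'
    refine ⟨hΦV h1, ?_⟩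
    obtain ⟨h2, h3⟩ := hΦ1 _ h1
    rw [Φ.right_inv hz'] at h3
    exact c.injOn h2 hz h3.symm

/-- A vector tangent to the fibre of a submersion is the velocity of a curve in the fibre. -/
lemma exists_curve_in_fibre_of_ker {f : X → Z} {V : Set X} (hV : IsOpen V)
    (hf : ContMDiffOn 𝓘(ℝ, EX) 𝓘(ℝ, EZ) ∞ f V) {u₀ : X} (hu₀ : u₀ ∈ V)
    (hs : Function.Surjective (mfderiv 𝓘(ℝ, EX) 𝓘(ℝ, EZ) f u₀))
    {w : TangentSpace 𝓘(ℝ, EX) u₀} (hw : mfderiv 𝓘(ℝ, EX) 𝓘(ℝ, EZ) f u₀ w = 0) :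
    ∃ γ : ℝ → X, ContMDiffAt 𝓘(ℝ, ℝ) 𝓘(ℝ, EX) ∞ γ 0 ∧ γ 0 = u₀ ∧
      (mfderiv 𝓘(ℝ, ℝ) 𝓘(ℝ, EX) γ 0 (1 : ℝ) : EX) = w ∧ ∀ᶠ t in 𝓝 0, γ t ∈ V ∧ f (γ t) = f u₀ := by
  obtain ⟨K, Φ, hu, hΦV, hΦ1, hΦs, hΦs'⟩ := exists_straightening hV hf hu₀ hs
  have hΦd : MDifferentiableAt 𝓘(ℝ, EX) 𝓘(ℝ, EZ × K) Φ u₀ :=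
    (hΦs.contMDiffAt (Φ.open_source.mem_nhds hu)).mdifferentiableAt (by simp)
  have hfd : MDifferentiableAt 𝓘(ℝ, EX) 𝓘(ℝ, EZ) f u₀ :=
    (hf.contMDiffAt (hV.mem_nhds hu₀)).mdifferentiableAt (by simp)
  let w' : EZ × K := mvfderiv 𝓘(ℝ, EX) Φ u₀ w
  have hw1 : w'.1 = 0 := by
    have h1 := mvfderiv_extChartAt_comp hfd rfl w
    rw [hw] at h1
    have h2 : (fun x => extChartAt 𝓘(ℝ, EZ) (f u₀) (f x)) =ᶠ[𝓝 u₀]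
        fun x => ContinuousLinearMap.fst ℝ EZ K (Φ x) := by
      filter_upwards [Φ.open_source.mem_nhds hu] with x hx
      exact (hΦ1 x hx).2.symm
    have h3 := mfderiv_comp_apply (I := 𝓘(ℝ, EX)) (I' := 𝓘(ℝ, EZ × K)) (I'' := 𝓘(ℝ, EZ))
      (g := ContinuousLinearMap.fst ℝ EZ K) u₀
      ((ContinuousLinearMap.fst ℝ EZ K).differentiableAt.mdifferentiableAt) hΦd w
    rw [mfderiv_eq_fderiv, ContinuousLinearMap.fderiv] at h3
    have h4 := congrArg (fun L => L w) (h2.mfderiv_eq (I := 𝓘(ℝ, EX)) (I' := 𝓘(ℝ, EZ)))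
    exact h3.symm.trans (h4.symm.trans h1)
  let l : ℝ → EZ × K := fun t => Φ u₀ + t • w'
  have hl0 : l 0 = Φ u₀ := by simp [l]
  have hl : ContDiff ℝ ∞ l := by fun_prop
  have hΦat : ContMDiffAt 𝓘(ℝ, EZ × K) 𝓘(ℝ, EX) ∞ Φ.symm (l 0) := by
    rw [hl0]; exact hΦs'.contMDiffAt (Φ.open_target.mem_nhds (Φ.map_source hu))
  have hγ : ContMDiffAt 𝓘(ℝ, ℝ) 𝓘(ℝ, EX) ∞ (fun t => Φ.symm (l t)) 0 :=
    hΦat.comp 0 hl.contMDiff.contMDiffAt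
  have hγ0 : Φ.symm (l 0) = u₀ := by rw [hl0, Φ.left_inv hu]
  have hlt : ∀ᶠ t in 𝓝 0, l t ∈ Φ.target := by
    refine hl.continuous.continuousAt.preimage_mem_nhds ?_
    rw [hl0]; exact Φ.open_target.mem_nhds (Φ.map_source hu)
  refine ⟨fun t => Φ.symm (l t), hγ, hγ0, ?_, ?_⟩
  · have h1 : HasDerivAt l w' 0 := by
      have := ((hasDerivAt_id (0 : ℝ)).smul_const w').const_add (Φ u₀)
      rwa [one_smul] at this
    have h2 := mfderiv_comp_apply (I := 𝓘(ℝ, ℝ)) (I' := 𝓘(ℝ, EZ × K)) (I'' := 𝓘(ℝ, EX))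
      (g := Φ.symm) (f := l) (0 : ℝ) (hΦat.mdifferentiableAt (by simp))
      (hl.contMDiff.contMDiffAt.mdifferentiableAt (by simp)) (1 : ℝ)
    have h3 : (mfderiv 𝓘(ℝ, ℝ) 𝓘(ℝ, EZ × K) l 0 (1 : ℝ) : EZ × K) = w' := by
      rw [mfderiv_eq_fderiv]
      exact (fderiv_apply_one_eq_deriv (f := l)).trans h1.deriv
    have h4 := mfderiv_comp_apply (I := 𝓘(ℝ, EX)) (I' := 𝓘(ℝ, EZ × K)) (I'' := 𝓘(ℝ, EX))
      (g := Φ.symm) (f := Φ) u₀ (by rw [← hl0]; exact hΦat.mdifferentiableAt (by simp)) hΦd w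
    have h5 : Φ.symm ∘ Φ =ᶠ[𝓝 u₀] id := by
      filter_upwards [Φ.open_source.mem_nhds hu] with x hx using Φ.left_inv hx
    rw [h5.mfderiv_eq] at h4
    have h6 : ∀ y v, y = Φ u₀ → v = w' → (mfderiv 𝓘(ℝ, EZ × K) 𝓘(ℝ, EX) Φ.symm y v : EX)
        = mfderiv 𝓘(ℝ, EZ × K) 𝓘(ℝ, EX) Φ.symm (Φ u₀) (mfderiv 𝓘(ℝ, EX) 𝓘(ℝ, EZ × K) Φ u₀ w) := by
      rintro _ _ rfl rfl; rfl
    refine (h2.trans (h6 _ _ hl0 h3)).trans (Eq.trans h4.symm ?_)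
    exact congrArg (fun L => L w) (mfderiv_id (I := 𝓘(ℝ, EX)) (x := u₀))
  · filter_upwards [hlt] with t ht
    have h1 := Φ.map_target ht
    refine ⟨hΦV h1, ?_⟩
    obtain ⟨h2, h3⟩ := hΦ1 _ h1
    rw [Φ.right_inv ht] at h3
    refine (extChartAt 𝓘(ℝ, EZ) (f u₀)).injOn h2 (mem_extChartAt_source _) ?_
    rw [← h3, ← (hΦ1 _ hu).2]
    simp [l, hw1]

/-- Nearby points in the same fibre of a submersion are joined by a smooth curve in the fibre. -/
lemma eventually_exists_curve_in_fibre {f : X → Z} {V : Set X} (hV : IsOpen V)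
    (hf : ContMDiffOn 𝓘(ℝ, EX) 𝓘(ℝ, EZ) ∞ f V) {u₀ : X} (hu₀ : u₀ ∈ V)
    (hs : Function.Surjective (mfderiv 𝓘(ℝ, EX) 𝓘(ℝ, EZ) f u₀)) :
    ∀ᶠ u in 𝓝 u₀, f u = f u₀ → ∃ (γ : ℝ → X) (T : Set ℝ), IsOpen T ∧ Icc 0 1 ⊆ T ∧
      ContMDiffOn 𝓘(ℝ, ℝ) 𝓘(ℝ, EX) ∞ γ T ∧ γ 0 = u₀ ∧ γ 1 = u ∧
      ∀ t ∈ T, γ t ∈ V ∧ f (γ t) = f u₀ := by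
  obtain ⟨K, Φ, hu, hΦV, hΦ1, hΦs, hΦs'⟩ := exists_straightening hV hf hu₀ hs
  obtain ⟨r, hr, hball⟩ := Metric.isOpen_iff.1 Φ.open_target _ (Φ.map_source hu)
  have h1 : ∀ᶠ u in 𝓝 u₀, Φ u ∈ Metric.ball (Φ u₀) r :=
    (hΦs.continuousOn.continuousAt (Φ.open_source.mem_nhds hu)).preimage_mem_nhds
      (Metric.ball_mem_nhds _ hr)
  filter_upwards [h1, Φ.open_source.mem_nhds hu] with u hur hus hfu
  let l : ℝ → EZ × K := fun t => Φ u₀ + t • (Φ u - Φ u₀)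
  have hl : ContDiff ℝ ∞ l := by fun_prop
  have hl1 : ∀ t, (l t).1 = extChartAt 𝓘(ℝ, EZ) (f u₀) (f u₀) := by
    intro t
    have : (Φ u).1 = (Φ u₀).1 := by rw [(hΦ1 _ hu).2, (hΦ1 _ hus).2, hfu]
    simp [l, this, (hΦ1 _ hu).2]
  refine ⟨fun t => Φ.symm (l t), l ⁻¹' Φ.target, Φ.open_target.preimage hl.continuous, ?_, ?_, ?_,
    ?_, ?_⟩
  · rintro t ⟨h0, h1⟩
    refine hball ?_
    rw [Metric.mem_ball, dist_eq_norm] at hur ⊢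
    simp only [l, add_sub_cancel_left, norm_smul, Real.norm_of_nonneg h0]
    exact lt_of_le_of_lt (mul_le_of_le_one_left (norm_nonneg _) h1) hur
  · exact hΦs'.comp hl.contMDiff.contMDiffOn fun t ht => ht
  · simp [l, Φ.left_inv hu]
  · simp [l, Φ.left_inv hus]
  · intro t ht
    have h1 := Φ.map_target ht
    refine ⟨hΦV h1, ?_⟩
    obtain ⟨h2, h3⟩ := hΦ1 _ h1
    rw [Φ.right_inv ht, hl1] at h3
    exact (extChartAt 𝓘(ℝ, EZ) (f u₀)).injOn h2 (mem_extChartAt_source _) h3.symm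

end Submersions

/-! ### Related vector fields -/

section Related

variable {EX : Type*} [NormedAddCommGroup EX] [NormedSpace ℝ EX]
  {X : Type*} [TopologicalSpace X] [ChartedSpace EX X]
  {EY : Type*} [NormedAddCommGroup EY] [NormedSpace ℝ EY]
  {Y : Type*} [TopologicalSpace Y] [ChartedSpace EY Y]
  {EZ : Type*} [NormedAddCommGroup EZ] [NormedSpace ℝ EZ]
  {Z : Type*} [TopologicalSpace Z] [ChartedSpace EZ Z] [IsManifold 𝓘(ℝ, EZ) ∞ Z]

lemma castTangent_apply {x y : X} (h : x = y) (v : TangentSpace 𝓘(ℝ, EX) x) :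
    (castTangent h v : EX) = v := by
  subst h; rfl

variable [IsManifold 𝓘(ℝ, EX) ∞ X]

/-- The Lie brackets of `f`-related vector fields are `f`-related. -/
theorem mfderiv_mlieBracket_of_related [CompleteSpace EX] [CompleteSpace EZ]
    {V W : ∀ x : X, TangentSpace 𝓘(ℝ, EX) x} {V' W' : ∀ z : Z, TangentSpace 𝓘(ℝ, EZ) z}
    {f : X → Z} (hf : ContMDiff 𝓘(ℝ, EX) 𝓘(ℝ, EZ) ∞ f) {x₀ : X}
    (hV : SmoothAlongAt (EY := EX) (fun x => x) V x₀)
    (hW : SmoothAlongAt (EY := EX) (fun x => x) W x₀)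
    (hV' : SmoothAlongAt (EY := EZ) (fun x => x) V' (f x₀))
    (hW' : SmoothAlongAt (EY := EZ) (fun x => x) W' (f x₀))
    (hfV : ∀ x, mfderiv 𝓘(ℝ, EX) 𝓘(ℝ, EZ) f x (V x) = V' (f x))
    (hfW : ∀ x, mfderiv 𝓘(ℝ, EX) 𝓘(ℝ, EZ) f x (W x) = W' (f x)) :
    mfderiv 𝓘(ℝ, EX) 𝓘(ℝ, EZ) f x₀ (VectorField.mlieBracket 𝓘(ℝ, EX) V W x₀)
      = VectorField.mlieBracket 𝓘(ℝ, EZ) V' W' (f x₀) := by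
  let g : Z → EZ := extChartAt 𝓘(ℝ, EZ) (f x₀)
  have hg : ContMDiffAt 𝓘(ℝ, EZ) 𝓘(ℝ, EZ) ∞ g (f x₀) := contMDiffAt_extChartAt
  have hd : ∀ x, MDifferentiableAt 𝓘(ℝ, EX) 𝓘(ℝ, EZ) f x := fun x =>
    (hf x).mdifferentiableAt (by simp)
  have h1 := mvfderiv_mlieBracket hV' hW' hg
  have h2 := mvfderiv_mlieBracket hV hW (hg.comp x₀ (hf x₀))
  have hchain : ∀ (k : Z → EZ) (x : X), MDifferentiableAt 𝓘(ℝ, EZ) 𝓘(ℝ, EZ) k (f x) →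
      ∀ v, mvfderiv 𝓘(ℝ, EX) (k ∘ f) x v
        = mvfderiv 𝓘(ℝ, EZ) k (f x) (mfderiv 𝓘(ℝ, EX) 𝓘(ℝ, EZ) f x v) := fun k x hk v =>
    mfderiv_comp_apply x hk (hd x) v
  have hev : ∀ᶠ x in 𝓝 x₀, MDifferentiableAt 𝓘(ℝ, EZ) 𝓘(ℝ, EZ) g (f x) := by
    have h3 : ∀ᶠ z in 𝓝 (f x₀), MDifferentiableAt 𝓘(ℝ, EZ) 𝓘(ℝ, EZ) g z := by
      filter_upwards [chart_source_mem_nhds EZ (f x₀)] with z hz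
      exact (contMDiffAt_extChartAt' (n := ∞) hz).mdifferentiableAt (by simp)
    exact (hf x₀).continuousAt.eventually h3
  have hrel : ∀ (V : ∀ x : X, TangentSpace 𝓘(ℝ, EX) x) (V' : ∀ z : Z, TangentSpace 𝓘(ℝ, EZ) z),
      SmoothAlongAt (EY := EZ) (fun x => x) V' (f x₀) →
      (∀ x, mfderiv 𝓘(ℝ, EX) 𝓘(ℝ, EZ) f x (V x) = V' (f x)) →
      ∀ v, mvfderiv 𝓘(ℝ, EX) (fun x => mvfderiv 𝓘(ℝ, EX) (g ∘ f) x (V x)) x₀ v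
        = mvfderiv 𝓘(ℝ, EZ) (fun z => mvfderiv 𝓘(ℝ, EZ) g z (V' z)) (f x₀)
          (mfderiv 𝓘(ℝ, EX) 𝓘(ℝ, EZ) f x₀ v) := by
    intro V V' hV' hfV v
    have h4 : (fun x => mvfderiv 𝓘(ℝ, EX) (g ∘ f) x (V x))
        =ᶠ[𝓝 x₀] (fun z => mvfderiv 𝓘(ℝ, EZ) g z (V' z)) ∘ f := by
      filter_upwards [hev] with x hx
      rw [hchain g x hx, hfV]; rfl
    have h5 := congrArg (fun L => L v) (h4.mfderiv_eq (I := 𝓘(ℝ, EX)) (I' := 𝓘(ℝ, EZ)))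
    exact h5.trans (hchain _ x₀ ((hV'.mvfderiv hg).mdifferentiableAt (by simp)) v)
  rw [hrel V V' hV' hfV, hrel W W' hW' hfW, hfV, hfW, ← h1,
    hchain g x₀ (hg.mdifferentiableAt (by simp))] at h2
  have h6 : ∀ v : TangentSpace 𝓘(ℝ, EZ) (f x₀), (mvfderiv 𝓘(ℝ, EZ) g (f x₀) v : EZ) = v :=
    fun v => congrArg (fun L => L v) (mfderiv_extChartAt_self (I := 𝓘(ℝ, EZ)) (x := f x₀))
  rw [h6, h6] at h2
  exact h2

/-- The derivative of a smooth family of maps, at a fixed point in a fixed direction, is smooth. -/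
lemma smoothAlongAt_mfderiv_param {m : Y → X → Z} {y₀ : Y} {x₀ : X} (w : TangentSpace 𝓘(ℝ, EX) x₀)
    (hm : ContMDiffAt (𝓘(ℝ, EY).prod 𝓘(ℝ, EX)) 𝓘(ℝ, EZ) ∞ (fun p : Y × X => m p.1 p.2) (y₀, x₀))
    [IsManifold 𝓘(ℝ, EY) ∞ Y] :
    SmoothAlongAt (EY := EY) (EX := EZ) (fun y => m y x₀)
      (fun y => mfderiv 𝓘(ℝ, EX) 𝓘(ℝ, EZ) (m y) x₀ w) y₀ := by
  have h1 := ContMDiffAt.mfderiv (m := ∞) (n := ∞) (J := 𝓘(ℝ, EY)) m (fun _ => x₀) hm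
    contMDiffAt_const le_rfl
  have hm' : ContMDiffAt 𝓘(ℝ, EY) 𝓘(ℝ, EZ) ∞ (fun y => m y x₀) y₀ :=
    ContMDiffAt.comp (g := fun p : Y × X => m p.1 p.2) y₀ hm
      (contMDiffAt_id.prodMk contMDiffAt_const)
  refine ContMDiffAt.clm_apply_of_inCoordinates (b₁ := fun _ => x₀) (b₂ := fun y => m y x₀)
    (ϕ := fun y => mfderiv 𝓘(ℝ, EX) 𝓘(ℝ, EZ) (m y) x₀) (v := fun _ => w) h1
    (contMDiffAt_const : ContMDiffAt 𝓘(ℝ, EY) 𝓘(ℝ, EX).tangent ∞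
      (fun _ => (⟨x₀, w⟩ : TangentBundle 𝓘(ℝ, EX) X)) y₀) hm'

/-- Every tangent vector is the velocity of a smooth curve. -/
lemma exists_curve [FiniteDimensional ℝ EX] (x₀ : X) (w : TangentSpace 𝓘(ℝ, EX) x₀) :
    ∃ γ : ℝ → X, ContMDiffAt 𝓘(ℝ, ℝ) 𝓘(ℝ, EX) ∞ γ 0 ∧ γ 0 = x₀ ∧
      (mfderiv 𝓘(ℝ, ℝ) 𝓘(ℝ, EX) γ 0 (1 : ℝ) : EX) = w := by
  let f : X → (Fin 0 → ℝ) := fun _ => 0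
  obtain ⟨γ, h1, h2, h3, -⟩ := exists_curve_in_fibre_of_ker (f := f) (V := univ) isOpen_univ
    contMDiffOn_const (mem_univ x₀)
    (fun b => ⟨0, (Subsingleton.elim (α := Fin 0 → ℝ) _ _)⟩) (w := w)
    (Subsingleton.elim (α := Fin 0 → ℝ) _ _)
  exact ⟨γ, h1, h2, h3⟩

end Related

/-! ### The adjoint action -/

section LieGroups

variable {EG : Type*} [NormedAddCommGroup EG] [NormedSpace ℝ EG]
  {G : Type*} [TopologicalSpace G] [ChartedSpace EG G] [Group G]

lemma tangentConj_apply (g : G) (v : GroupLieAlgebra 𝓘(ℝ, EG) G) :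
    (tangentConj g v : EG) = mfderiv 𝓘(ℝ, EG) 𝓘(ℝ, EG) (fun h : G => g * h * g⁻¹) 1 v :=
  castTangent_apply _ _

variable [LieGroup 𝓘(ℝ, EG) ∞ G]

lemma smoothAlongAt_mulInvariantVectorField (v : GroupLieAlgebra 𝓘(ℝ, EG) G) (g : G) :
    SmoothAlongAt (EY := EG) (fun g : G => g) (mulInvariantVectorField v) g := by
  have h := smoothAlongAt_mfderiv_param (EY := EG) (EX := EG) (EZ := EG)
    (m := fun g h : G => g * h) (y₀ := g) (x₀ := 1) v
    ((contMDiff_mul 𝓘(ℝ, EG) ∞).contMDiffAt)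
  have h1 : ∀ (s : G → G), s = (fun g => g) → ∀ (V : ∀ g, TangentSpace 𝓘(ℝ, EG) (s g)),
      (∀ g, (V g : EG) = mulInvariantVectorField v g) → SmoothAlongAt (EY := EG) s V g →
      SmoothAlongAt (EY := EG) (fun g : G => g) (mulInvariantVectorField v) g := by
    rintro _ rfl V hV h
    have : V = mulInvariantVectorField v := funext hV
    rwa [this] at h
  exact h1 _ (funext fun g => mul_one g) _ (fun g => rfl) h

lemma contMDiff_conj (g : G) : ContMDiff 𝓘(ℝ, EG) 𝓘(ℝ, EG) ∞ (fun h : G => g * h * g⁻¹) :=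
  (contMDiff_const.mul contMDiff_id).mul contMDiff_const

lemma mfderiv_conj_mulInvariantVectorField (g : G) (v : GroupLieAlgebra 𝓘(ℝ, EG) G) (x : G) :
    mfderiv 𝓘(ℝ, EG) 𝓘(ℝ, EG) (fun h : G => g * h * g⁻¹) x (mulInvariantVectorField v x)
      = mulInvariantVectorField (tangentConj g v) (g * x * g⁻¹) := by
  have hd : ∀ (a y : G), MDifferentiableAt 𝓘(ℝ, EG) 𝓘(ℝ, EG) (fun h => a * h) y := fun a y =>
    (contMDiff_mul_left (I := 𝓘(ℝ, EG)) (n := ∞)).contMDiffAt.mdifferentiableAt (by simp)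
  have hc : ∀ y, MDifferentiableAt 𝓘(ℝ, EG) 𝓘(ℝ, EG) (fun h => g * h * g⁻¹) y := fun y =>
    (contMDiff_conj g y).mdifferentiableAt (by simp)
  have h1 := mfderiv_comp_apply (I := 𝓘(ℝ, EG)) (I' := 𝓘(ℝ, EG)) (I'' := 𝓘(ℝ, EG))
    (g := fun h => g * h * g⁻¹) (f := fun h => x * h) (1 : G) (hc _) (hd x 1) v
  have h2 := mfderiv_comp_apply (I := 𝓘(ℝ, EG)) (I' := 𝓘(ℝ, EG)) (I'' := 𝓘(ℝ, EG))
    (g := fun h => g * x * g⁻¹ * h) (f := fun h => g * h * g⁻¹) (1 : G) (hd _ _) (hc 1) v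
  have h3 : (fun h => g * h * g⁻¹) ∘ (fun h => x * h)
      = (fun h => g * x * g⁻¹ * h) ∘ (fun h => g * h * g⁻¹) := by
    funext h; simp [mul_assoc]
  have h4 : ∀ (y z : G) (v w : EG), y = z → v = w →
      ∀ k : G → G, (mfderiv 𝓘(ℝ, EG) 𝓘(ℝ, EG) k y v : EG) = mfderiv 𝓘(ℝ, EG) 𝓘(ℝ, EG) k z w := by
    rintro _ _ _ _ rfl rfl k; rfl
  have h5 : ∀ k k' : G → G, k = k' → (mfderiv 𝓘(ℝ, EG) 𝓘(ℝ, EG) k 1 v : EG)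
      = mfderiv 𝓘(ℝ, EG) 𝓘(ℝ, EG) k' 1 v := by
    rintro _ _ rfl; rfl
  refine (h4 x (x * 1) _ _ (mul_one x).symm rfl _).trans
    (h1.symm.trans ((h5 _ _ h3).trans (h2.trans ?_)))
  exact h4 _ _ _ _ (by simp) (tangentConj_apply g v).symm _

/-- As conjugation relates the left-invariant vector fields of `v` and of `tangentConj g v`,
`tangentConj g` is a homomorphism of Lie algebras. -/
lemma tangentConj_lie [CompleteSpace EG] (g : G) (v w : GroupLieAlgebra 𝓘(ℝ, EG) G) :
    tangentConj g ⁅v, w⁆ = ⁅tangentConj g v, tangentConj g w⁆ := by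
  have h := mfderiv_mlieBracket_of_related (contMDiff_conj g)
    (smoothAlongAt_mulInvariantVectorField v 1) (smoothAlongAt_mulInvariantVectorField w 1)
    (smoothAlongAt_mulInvariantVectorField (tangentConj g v) _)
    (smoothAlongAt_mulInvariantVectorField (tangentConj g w) _)
    (mfderiv_conj_mulInvariantVectorField g v) (mfderiv_conj_mulInvariantVectorField g w)
  rw [GroupLieAlgebra.bracket_def, GroupLieAlgebra.bracket_def]
  refine (tangentConj_apply g _).trans (h.trans ?_)
  have h1 : ∀ y : G, y = 1 → (VectorField.mlieBracket 𝓘(ℝ, EG)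
      (mulInvariantVectorField (tangentConj g v))
      (mulInvariantVectorField (tangentConj g w)) y : EG)
      = VectorField.mlieBracket 𝓘(ℝ, EG)
      (mulInvariantVectorField (tangentConj g v))
      (mulInvariantVectorField (tangentConj g w)) 1 := by
    rintro _ rfl; rfl
  exact h1 _ (by group)

lemma tangentConj_inv_tangentConj (g : G) (v : GroupLieAlgebra 𝓘(ℝ, EG) G) :
    tangentConj g⁻¹ (tangentConj g v) = v := by
  have hc : ∀ g y : G, MDifferentiableAt 𝓘(ℝ, EG) 𝓘(ℝ, EG) (fun h => g * h * g⁻¹) y := fun g y =>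
    (contMDiff_conj g y).mdifferentiableAt (by simp)
  have h1 := mfderiv_comp_apply (I := 𝓘(ℝ, EG)) (I' := 𝓘(ℝ, EG)) (I'' := 𝓘(ℝ, EG))
    (g := fun h => g⁻¹ * h * g⁻¹⁻¹) (f := fun h => g * h * g⁻¹) (1 : G) (hc _ _) (hc _ 1) v
  have h3 : (fun h => g⁻¹ * h * g⁻¹⁻¹) ∘ (fun h => g * h * g⁻¹) = id := by
    funext h; simp [mul_assoc]
  have h4 : ∀ (y z : G) (v w : EG), y = z → v = w →
      ∀ k : G → G, (mfderiv 𝓘(ℝ, EG) 𝓘(ℝ, EG) k y v : EG) = mfderiv 𝓘(ℝ, EG) 𝓘(ℝ, EG) k z w := by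
    rintro _ _ _ _ rfl rfl k; rfl
  have h5 : (mfderiv 𝓘(ℝ, EG) 𝓘(ℝ, EG)
      ((fun h : G => g⁻¹ * h * g⁻¹⁻¹) ∘ (fun h => g * h * g⁻¹)) 1 v : EG) = v := by
    have : ∀ k : G → G, k = id → (mfderiv 𝓘(ℝ, EG) 𝓘(ℝ, EG) k 1 v : EG) = v := by
      rintro _ rfl; rw [mfderiv_id]; rfl
    exact this _ h3
  refine (tangentConj_apply _ _).trans (Eq.trans ?_ (h1.symm.trans h5))
  exact h4 _ _ _ _ (by simp) (tangentConj_apply g v) _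

variable [FiniteDimensional ℝ EG] {𝔤 : Type*} [LieRing 𝔤] [LieAlgebra ℝ 𝔤]
  (e : 𝔤 ≃ₗ⁅ℝ⁆ GroupLieAlgebra 𝓘(ℝ, EG) G)

lemma Ad_apply (g : G) (X : 𝔤) : Ad e g X = e.symm (tangentConj g (e X)) := rfl

lemma Ad_inv_Ad (g : G) (X : 𝔤) : Ad e g⁻¹ (Ad e g X) = X := by
  simp only [Ad_apply, LieEquiv.apply_symm_apply, tangentConj_inv_tangentConj,
    LieEquiv.symm_apply_apply]

/-- The adjoint action, by automorphisms of the Lie algebra. -/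
def AdEquiv (g : G) : 𝔤 ≃ₗ⁅ℝ⁆ 𝔤 :=
  { Ad e g with
    map_lie' := by
      intro X Y
      change Ad e g ⁅X, Y⁆ = ⁅Ad e g X, Ad e g Y⁆
      simp only [Ad_apply]
      rw [← LieEquiv.map_lie, ← tangentConj_lie, LieEquiv.map_lie]
    invFun := Ad e g⁻¹
    left_inv := Ad_inv_Ad e g
    right_inv := fun X => by
      have := Ad_inv_Ad e g⁻¹ X
      rwa [inv_inv] at this }

lemma AdEquiv_apply (g : G) (X : 𝔤) : AdEquiv e g X = Ad e g X := rfl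

variable {e} in
/-- Elements of `P` preserve the filtration in non-positive degrees. -/
lemma IsParabolicPair.Ad_mem_fil [FiniteDimensional ℝ 𝔤] {𝔯 : NestedParabolics 𝔤}
    {P Q : Subgroup G} {EQ : Type*} [NormedAddCommGroup EQ] [NormedSpace ℝ EQ] [ChartedSpace EQ Q]
    [LieAlgebra.IsSemisimple ℝ 𝔤]
    (hPQ : IsParabolicPair (EQ := EQ) 𝔯 e P Q) {g : G} (hg : g ∈ P) {i : ℤ} (hi : i ≤ 0) (X : 𝔤) :
    Ad e g X ∈ 𝔯.fil i ↔ X ∈ 𝔯.fil i := by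
  refine 𝔯.map_fil_of_map_𝔭 (AdEquiv e g) (fun X => ?_) hi X
  have h := hPQ.P_le g hg
  constructor
  · intro hX
    rw [← h] at hX
    obtain ⟨Y, hY, hYX⟩ := hX
    have := (AdEquiv e g).injective (hYX.trans (AdEquiv_apply e g X).symm)
    exact this ▸ hY
  · intro hX
    rw [← h]
    exact ⟨X, hX, rfl⟩

/-- The derivative of the adjoint action is the adjoint representation. -/
lemma hasDerivAt_Ad [FiniteDimensional ℝ 𝔤] {c : ℝ → G}
    (hc : ContMDiffAt 𝓘(ℝ, ℝ) 𝓘(ℝ, EG) ∞ c 0) (hc0 : c 0 = 1) {a : 𝔤}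
    (ha : (mfderiv 𝓘(ℝ, ℝ) 𝓘(ℝ, EG) c 0 (1 : ℝ) : EG) = e a) (Y : 𝔤) :
    HasDerivAt (F := EG) (fun t => e (Ad e (c t) Y)) (e ⁅a, Y⁆) 0 := by
  have : CompleteSpace EG := FiniteDimensional.complete ℝ EG
  have hZ : ∀ t, (e (Ad e (c t) Y) : EG)
      = mfderiv 𝓘(ℝ, EG) 𝓘(ℝ, EG) (fun h : G => c t * h * (c t)⁻¹) 1 (e Y) := by
    intro t
    rw [Ad_apply, LieEquiv.apply_symm_apply]
    exact tangentConj_apply _ _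
  have hdiff : DifferentiableAt ℝ (F := EG) (fun t => e (Ad e (c t) Y)) 0 := by
    have hm : ContMDiffAt (𝓘(ℝ, ℝ).prod 𝓘(ℝ, EG)) 𝓘(ℝ, EG) ∞
        (fun p : ℝ × G => c p.1 * p.2 * (c p.1)⁻¹) (0, 1) := by
      have h1 : ContMDiffAt (𝓘(ℝ, ℝ).prod 𝓘(ℝ, EG)) 𝓘(ℝ, EG) ∞
          (fun p : ℝ × G => c p.1) (0, 1) :=
        ContMDiffAt.comp (g := c) ((0 : ℝ), (1 : G)) hc contMDiffAt_fst
      exact (h1.mul contMDiffAt_snd).mul h1.inv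
    have h2 := (smoothAlongAt_iff.1 (smoothAlongAt_mfderiv_param (EY := ℝ)
      (m := fun (t : ℝ) (h : G) => c t * h * (c t)⁻¹) (e Y) hm)).2
    have h3 : (fun t => (e (Ad e (c t) Y) : EG)) = fun t => mvfderiv 𝓘(ℝ, EG)
        (extChartAt 𝓘(ℝ, EG) (c 0 * 1 * (c 0)⁻¹)) (c t * 1 * (c t)⁻¹)
        (mfderiv 𝓘(ℝ, EG) 𝓘(ℝ, EG) (fun h : G => c t * h * (c t)⁻¹) 1 (e Y)) := by
      funext t
      rw [hZ]
      have h4 : ∀ (x y : G) (v : EG), x = y →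
          (mvfderiv 𝓘(ℝ, EG) (extChartAt 𝓘(ℝ, EG) x) y v : EG) = v := by
        rintro x _ v rfl
        exact congrArg (fun L => L v) (mfderiv_extChartAt_self (I := 𝓘(ℝ, EG)) (x := x))
      exact (h4 _ _ _ (by simp)).symm
    rw [h3]
    exact h2.contDiffAt.differentiableAt (by simp)
  have hd : HasDerivAt (F := EG) (fun t => (e (Ad e (c t) Y) : EG))
    (deriv (F := EG) (fun t => e (Ad e (c t) Y)) 0) 0 := hdiff.hasDerivAt
  have hmul : ∀ (a y : G), MDifferentiableAt 𝓘(ℝ, EG) 𝓘(ℝ, EG) (fun h => a * h) y := fun a y =>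
    (contMDiff_mul_left (I := 𝓘(ℝ, EG)) (n := ∞)).contMDiffAt.mdifferentiableAt (by simp)
  have hmul' : ∀ (a y : G), MDifferentiableAt 𝓘(ℝ, EG) 𝓘(ℝ, EG) (fun h => h * a) y := fun a y =>
    (contMDiff_mul_right (I := 𝓘(ℝ, EG)) (n := ∞)).contMDiffAt.mdifferentiableAt (by simp)
  have key := mlieBracket_eq_of_motion (m := fun g t => g * c t) (x₀ := (1 : G))
    (smoothAlongAt_mulInvariantVectorField (e a) 1)
    (smoothAlongAt_mulInvariantVectorField (e Y) 1)
    (contMDiffAt_fst.mul (ContMDiffAt.comp (g := c) ((1 : G), (0 : ℝ)) hc contMDiffAt_snd))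
    (fun x => by simp only [hc0, mul_one])
    (fun x => by
      have h1 := mfderiv_comp_apply (I := 𝓘(ℝ, ℝ)) (I' := 𝓘(ℝ, EG)) (I'' := 𝓘(ℝ, EG))
        (g := fun h => x * h) (f := c) (0 : ℝ) (hmul _ _) (hc.mdifferentiableAt (by simp)) (1 : ℝ)
      have h2 : ∀ (y : G) (v : EG), y = 1 → v = e a →
          (mfderiv 𝓘(ℝ, EG) 𝓘(ℝ, EG) (fun h => x * h) y v : EG)
            = mulInvariantVectorField (e a) x := by
        rintro _ _ rfl rfl; rfl
      exact h1.trans (h2 _ _ hc0 ha))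
    (fun t => by
      have hcd : MDifferentiableAt 𝓘(ℝ, EG) 𝓘(ℝ, EG) (fun h : G => c t * h * (c t)⁻¹) 1 :=
        (contMDiff_conj (c t) 1).mdifferentiableAt (by simp)
      have h1 := mfderiv_comp_apply (I := 𝓘(ℝ, EG)) (I' := 𝓘(ℝ, EG)) (I'' := 𝓘(ℝ, EG))
        (g := fun h => h * c t) (f := fun h : G => c t * h * (c t)⁻¹) (1 : G) (hmul' _ _) hcd (e Y)
      have h2 : (fun h => h * c t) ∘ (fun h : G => c t * h * (c t)⁻¹) = fun h => c t * h := by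
        funext h; simp
      have h3 : ∀ (y : G) (v : EG), y = c t * 1 * (c t)⁻¹ →
          v = mfderiv 𝓘(ℝ, EG) 𝓘(ℝ, EG) (fun h : G => c t * h * (c t)⁻¹) 1 (e Y) →
          (mfderiv 𝓘(ℝ, EG) 𝓘(ℝ, EG) (fun h => h * c t) y v : EG)
            = mfderiv 𝓘(ℝ, EG) 𝓘(ℝ, EG) (fun h => h * c t) (c t * 1 * (c t)⁻¹)
              (mfderiv 𝓘(ℝ, EG) 𝓘(ℝ, EG) (fun h : G => c t * h * (c t)⁻¹) 1 (e Y)) := by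
        rintro _ _ rfl rfl; rfl
      have h4 : ∀ (k : G → G) (y : G), k = (fun h => c t * h) → y = c t →
          (mfderiv 𝓘(ℝ, EG) 𝓘(ℝ, EG) k 1 (e Y) : EG) = mulInvariantVectorField (e Y) y := by
        rintro _ _ rfl rfl; rfl
      exact (h3 1 _ (by simp) (hZ t)).trans (h1.symm.trans (h4 _ _ h2 (one_mul _))))
    hd
  have h5 : (e ⁅a, Y⁆ : EG) = deriv (F := EG) (fun t => e (Ad e (c t) Y)) 0 := by
    rw [LieEquiv.map_lie]
    exact key
  rw [h5]
  exact hd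

end LieGroups

/-! ### The vector fields `ω⁻¹(X)` -/

section Cartan

variable {EG : Type*} [NormedAddCommGroup EG] [NormedSpace ℝ EG] [FiniteDimensional ℝ EG]
  {G : Type*} [TopologicalSpace G] [ChartedSpace EG G] [Group G] [LieGroup 𝓘(ℝ, EG) ∞ G]
  {𝔤 : Type*} [LieRing 𝔤] [LieAlgebra ℝ 𝔤]
  {EQ : Type*} [NormedAddCommGroup EQ] [NormedSpace ℝ EQ]
  {EP : Type*} [NormedAddCommGroup EP] [NormedSpace ℝ EP]
  {EM : Type*} [NormedAddCommGroup EM] [NormedSpace ℝ EM]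

namespace CartanGeometry

variable {e : 𝔤 ≃ₗ⁅ℝ⁆ GroupLieAlgebra 𝓘(ℝ, EG) G} {Q : Subgroup G} [ChartedSpace EQ Q]
  {𝒢 : Type*} [TopologicalSpace 𝒢] [ChartedSpace EP 𝒢] [IsManifold 𝓘(ℝ, EP) ∞ 𝒢]
  {M : Type*} [TopologicalSpace M] [ChartedSpace EM M] [IsManifold 𝓘(ℝ, EM) ∞ M]
  (A : CartanGeometry (EQ := EQ) (EP := EP) (EM := EM) e Q 𝒢 M)

lemma conn_congr {u u' : 𝒢} (h : u' = u) {v : TangentSpace 𝓘(ℝ, EP) u'}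
    {w : TangentSpace 𝓘(ℝ, EP) u} (hvw : (v : EP) = w) : A.conn u' v = A.conn u w := by
  subst h; subst hvw; rfl

lemma toTangent_apply {x : M} (u : 𝒢) (h : A.proj u = x) (X : 𝔤) :
    (A.toTangent u h X : EM) = mfderiv 𝓘(ℝ, EP) 𝓘(ℝ, EM) A.proj u (A.constField X u) :=
  castTangent_apply h _

lemma constField_add (X Y : 𝔤) : A.constField (X + Y) = A.constField X + A.constField Y :=
  funext fun u => map_add (A.conn u).symm X Y

lemma conn_constField (X : 𝔤) (u : 𝒢) : A.conn u (A.constField X u) = X :=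
  (A.conn u).apply_symm_apply X

lemma constField_conn (u : 𝒢) (w : TangentSpace 𝓘(ℝ, EP) u) :
    A.constField (A.conn u w) u = w :=
  (A.conn u).symm_apply_apply w

lemma curvature_swap (u : 𝒢) (X Y : 𝔤) : A.curvature u X Y = - A.curvature u Y X := by
  unfold curvature
  rw [VectorField.mlieBracket_swap_apply, map_neg, ← lie_skew X Y]
  abel

section Smoothness

variable {EY : Type*} [NormedAddCommGroup EY] [NormedSpace ℝ EY]
  {Y : Type*} [TopologicalSpace Y] [ChartedSpace EY Y]

/-- The Cartan connection takes smooth vector fields along maps to smooth functions. -/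
lemma contMDiffAt_conn {s : Y → 𝒢} {V : ∀ y, TangentSpace 𝓘(ℝ, EP) (s y)} {y₀ : Y}
    (hV : SmoothAlongAt (EY := EY) s V y₀) (ℓ : 𝔤 →ₗ[ℝ] ℝ) :
    ContMDiffAt 𝓘(ℝ, EY) 𝓘(ℝ, ℝ) ∞ (fun y => ℓ (A.conn (s y) (V y))) y₀ :=
  ContMDiffAt.comp (g := fun v : TangentBundle 𝓘(ℝ, EP) 𝒢 => ℓ (A.conn v.1 v.2)) y₀
    (A.conn_smooth ℓ).contMDiffAt hV

variable [FiniteDimensional ℝ 𝔤] [FiniteDimensional ℝ EP]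

/-- The vector fields `ω⁻¹(X)` are smooth. -/
lemma smoothAlongAt_constField (X : 𝔤) (u : 𝒢) :
    SmoothAlongAt (EY := EP) (fun u : 𝒢 => u) (A.constField X) u := by
  have : CompleteSpace EP := FiniteDimensional.complete ℝ EP
  rw [smoothAlongAt_iff]
  refine ⟨contMDiffAt_id, ?_⟩
  let φ := extChartAt 𝓘(ℝ, EP) u
  let b := (Module.finBasis ℝ 𝔤).equivFun
  let c : EP → EP := fun y => mvfderiv 𝓘(ℝ, EP) φ (φ.symm y) (A.constField X (φ.symm y))
  let B : EP → EP →L[ℝ] (Fin (Module.finrank ℝ 𝔤) → ℝ) := fun y =>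
    LinearMap.toContinuousLinearMap (b.toLinearMap ∘ₗ (A.conn (φ.symm y)).toLinearMap ∘ₗ
      (mfderiv 𝓘(ℝ, EP) 𝓘(ℝ, EP) φ.symm y).toLinearMap)
  have hφu : φ.symm (φ u) = u := extChartAt_to_inv u
  have hβ : ∀ y ∈ φ.target, ContMDiffAt 𝓘(ℝ, EP) 𝓘(ℝ, EP) ∞ φ.symm y := fun y hy =>
    extChartAt_symm_contMDiffAt hy
  have hB : ContMDiffAt 𝓘(ℝ, EP) 𝓘(ℝ, EP →L[ℝ] (Fin (Module.finrank ℝ 𝔤) → ℝ)) ∞ B (φ u) := by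
    refine contMDiffAt_clm_of_apply fun v => ?_
    rw [contMDiffAt_pi_space]
    intro k
    have h1 : SmoothAlongAt (EY := EP) (fun y : EP => y)
        (fun y => (v : TangentSpace 𝓘(ℝ, EP) y)) (φ u) :=
      smoothAlongAt_vector.2 ⟨contMDiffAt_id, contMDiffAt_const⟩
    exact A.contMDiffAt_conn (h1.map (hβ _ (mem_extChartAt_target u)))
      ((Module.finBasis ℝ 𝔤).coord k)
  have hinv : (B (φ u)).IsInvertible := by
    have h1 : (mfderiv 𝓘(ℝ, EP) 𝓘(ℝ, EP) φ.symm (φ u)).IsInvertible :=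
      extChartAt_symm_isInvertible (mem_extChartAt_target u)
    obtain ⟨L, hL⟩ := h1
    let L' : EP ≃ₗ[ℝ] (Fin (Module.finrank ℝ 𝔤) → ℝ) :=
      (L.toLinearEquiv.trans (A.conn (φ.symm (φ u)))).trans b
    refine ⟨L'.toContinuousLinearEquiv, ?_⟩
    refine ContinuousLinearMap.ext fun v => ?_
    have h2 : ∀ v, mfderiv 𝓘(ℝ, EP) 𝓘(ℝ, EP) φ.symm (φ u) v = L v := fun v => by rw [← hL]; rfl
    exact (congrArg (fun w => b (A.conn (φ.symm (φ u)) w)) (h2 v)).symm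
  have hc : ∀ᶠ y in 𝓝 (φ u), B y (c y) = b X := by
    filter_upwards [extChartAt_target_mem_nhds (I := 𝓘(ℝ, EP)) u] with y hy
    have hs : φ.symm y ∈ (chartAt EP u).source := by
      have := φ.map_target hy
      rwa [extChartAt_source] at this
    have h1 := mfderiv_comp_apply (I := 𝓘(ℝ, EP)) (I' := 𝓘(ℝ, EP)) (I'' := 𝓘(ℝ, EP))
      (g := φ.symm) (f := φ) (φ.symm y)
      (by
        rw [φ.right_inv hy]
        exact (hβ y hy).mdifferentiableAt (by simp))
      ((contMDiffAt_extChartAt' (n := ∞) hs).mdifferentiableAt (by simp))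
      (A.constField X (φ.symm y))
    have h2 : φ.symm ∘ φ =ᶠ[𝓝 (φ.symm y)] id := by
      filter_upwards [(chartAt EP u).open_source.mem_nhds hs] with x hx
      rw [← extChartAt_source 𝓘(ℝ, EP)] at hx
      exact φ.left_inv hx
    rw [h2.mfderiv_eq, mfderiv_id] at h1
    have h3 : ∀ (y' : EP), y' = y → ∀ v : EP,
        (mfderiv 𝓘(ℝ, EP) 𝓘(ℝ, EP) φ.symm y' v : EP) = mfderiv 𝓘(ℝ, EP) 𝓘(ℝ, EP) φ.symm y v := by
      rintro _ rfl v; rfl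
    have h4 := h1.trans (h3 _ (φ.right_inv hy) _)
    change b (A.conn _ (mfderiv 𝓘(ℝ, EP) 𝓘(ℝ, EP) φ.symm y (c y))) = _
    refine congrArg b (Eq.trans (congrArg _ ?_) (A.conn_constField X (φ.symm y)))
    exact h4.symm
  have hcs : ContMDiffAt 𝓘(ℝ, EP) 𝓘(ℝ, EP) ∞ c (φ u) :=
    contMDiffAt_of_solves hB contMDiffAt_const hinv hc
  have hcs' := hcs.comp u (contMDiffAt_extChartAt (I := 𝓘(ℝ, EP)) (x := u) (n := ∞))
  refine hcs'.congr_of_eventuallyEq ?_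
  filter_upwards [extChartAt_source_mem_nhds (I := 𝓘(ℝ, EP)) u] with x hx
  have h5 : ∀ x', x' = x → (mvfderiv 𝓘(ℝ, EP) φ x (A.constField X x) : EP)
      = mvfderiv 𝓘(ℝ, EP) φ x' (A.constField X x') := by
    rintro _ rfl; rfl
  exact h5 _ (φ.left_inv hx)

lemma mdifferentiableAt_constField (X : 𝔤) (u : 𝒢) :
    MDifferentiableAt 𝓘(ℝ, EP) 𝓘(ℝ, EP).tangent
      (fun u : 𝒢 => (⟨u, A.constField X u⟩ : TangentBundle 𝓘(ℝ, EP) 𝒢)) u :=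
  (A.smoothAlongAt_constField X u).mdifferentiableAt (by simp)

lemma curvature_add_left (u : 𝒢) (X X' Y : 𝔤) :
    A.curvature u (X + X') Y = A.curvature u X Y + A.curvature u X' Y := by
  have : CompleteSpace EP := FiniteDimensional.complete ℝ EP
  unfold curvature
  rw [constField_add, VectorField.mlieBracket_add_left (A.mdifferentiableAt_constField _ u)
    (A.mdifferentiableAt_constField _ u), map_add, add_lie]
  abel

lemma curvature_add_right (u : 𝒢) (X Y Y' : 𝔤) :
    A.curvature u X (Y + Y') = A.curvature u X Y + A.curvature u X Y' := by
  rw [curvature_swap, curvature_add_left, neg_add, ← curvature_swap, ← curvature_swap]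

end Smoothness

/-! ### The fibres of the bundle projection -/

lemma exists_act_eq {u u' : 𝒢} (h : A.proj u = A.proj u') : ∃ q, A.act u q = u' := by
  obtain ⟨W, φ, -, hx, hs, -, -, -, hφ⟩ := A.locally_trivial (A.proj u)
  have hu : u ∈ φ.source := by rw [hs]; exact hx
  have hu' : u' ∈ φ.source := by rw [hs, mem_preimage, ← h]; exact hx
  refine ⟨(φ u).2⁻¹ * (φ u').2, φ.injOn ?_ hu' ?_⟩
  · rw [hs, mem_preimage, A.proj_act]; exact hx
  · rw [(hφ u hu).2, mul_inv_cancel_left]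
    exact Prod.ext (by rw [(hφ u hu).1, (hφ u' hu').1, h]) rfl

lemma contMDiff_act_right (q : Q) : ContMDiff 𝓘(ℝ, EP) 𝓘(ℝ, EP) ∞ (fun u => A.act u q) :=
  A.act_smooth.comp (contMDiff_id.prodMk contMDiff_const)

lemma contMDiff_act_left (u : 𝒢) : ContMDiff 𝓘(ℝ, EQ) 𝓘(ℝ, EP) ∞ (fun q => A.act u q) :=
  A.act_smooth.comp (contMDiff_const.prodMk contMDiff_id)

lemma mdifferentiableAt_proj (u : 𝒢) : MDifferentiableAt 𝓘(ℝ, EP) 𝓘(ℝ, EM) A.proj u :=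
  (A.proj_smooth u).mdifferentiableAt (by simp)

/-- The bundle `𝒢 → M` has smooth local sections. -/
lemma exists_local_section_proj (u : 𝒢) : ∃ (W : Set M) (s : M → 𝒢), IsOpen W ∧ A.proj u ∈ W ∧
    s (A.proj u) = u ∧ ContMDiffOn 𝓘(ℝ, EM) 𝓘(ℝ, EP) ∞ s W ∧ ∀ x ∈ W, A.proj (s x) = x := by
  obtain ⟨W, φ, hW, hx, hs, ht, -, hφs, hφ⟩ := A.locally_trivial (A.proj u)
  have hu : u ∈ φ.source := by rw [hs]; exact hx
  have hm : ∀ x ∈ W, (x, (φ u).2) ∈ φ.target := fun x hx => by rw [ht]; exact ⟨hx, trivial⟩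
  refine ⟨W, fun x => φ.symm (x, (φ u).2), hW, hx, ?_, ?_, ?_⟩
  · have : (A.proj u, (φ u).2) = φ u := Prod.ext (hφ u hu).1.symm rfl
    simp only [this, φ.left_inv hu]
  · exact hφs.comp (contMDiffOn_id.prodMk contMDiffOn_const) hm
  · intro x hx
    rw [← (hφ _ (φ.map_target (hm x hx))).1, φ.right_inv (hm x hx)]

lemma mfderiv_proj_surjective (u : 𝒢) :
    Function.Surjective (mfderiv 𝓘(ℝ, EP) 𝓘(ℝ, EM) A.proj u) := by
  intro v
  obtain ⟨W, s, hW, hx, hsu, hss, hps⟩ := A.exists_local_section_proj u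
  have hsd : MDifferentiableAt 𝓘(ℝ, EM) 𝓘(ℝ, EP) s (A.proj u) :=
    (hss.contMDiffAt (hW.mem_nhds hx)).mdifferentiableAt (by simp)
  have h1 := mfderiv_comp_apply (I := 𝓘(ℝ, EM)) (I' := 𝓘(ℝ, EP)) (I'' := 𝓘(ℝ, EM))
    (g := A.proj) (f := s) (A.proj u) (A.mdifferentiableAt_proj _) hsd v
  have h2 : A.proj ∘ s =ᶠ[𝓝 (A.proj u)] id := by
    filter_upwards [hW.mem_nhds hx] with x hx using hps x hx
  rw [h2.mfderiv_eq, mfderiv_id] at h1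
  refine ⟨(mfderiv 𝓘(ℝ, EM) 𝓘(ℝ, EP) s (A.proj u) v : EP), ?_⟩
  have h3 : ∀ u', u' = u → ∀ w : EP, (mfderiv 𝓘(ℝ, EP) 𝓘(ℝ, EM) A.proj u w : EM)
      = mfderiv 𝓘(ℝ, EP) 𝓘(ℝ, EM) A.proj u' w := by
    rintro _ rfl w; rfl
  exact (h3 _ hsu _).trans h1.symm

/-- The fundamental vector fields span the vertical subspaces. -/
lemma exists_mfderiv_act_of_mfderiv_proj_eq_zero [FiniteDimensional ℝ EP] [FiniteDimensional ℝ EM]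
    [LieGroup 𝓘(ℝ, EQ) ∞ Q] {u : 𝒢} {w : TangentSpace 𝓘(ℝ, EP) u}
    (hw : mfderiv 𝓘(ℝ, EP) 𝓘(ℝ, EM) A.proj u w = 0) :
    ∃ a : TangentSpace 𝓘(ℝ, EQ) (1 : Q),
      (mfderiv 𝓘(ℝ, EQ) 𝓘(ℝ, EP) (fun q : Q => A.act u q) 1 a : EP) = w := by
  obtain ⟨γ, hγ, hγ0, hγw, hγf⟩ := exists_curve_in_fibre_of_ker isOpen_univ
    A.proj_smooth.contMDiffOn (mem_univ u) (A.mfderiv_proj_surjective u) hw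
  obtain ⟨W, φ, hW, hx, hs, -, hφs, -, hφ⟩ := A.locally_trivial (A.proj u)
  have hu : u ∈ φ.source := by rw [hs]; exact hx
  let q : ℝ → Q := fun t => (φ u).2⁻¹ * (φ (γ t)).2
  have hq0 : q 0 = 1 := by simp [q, hγ0]
  have hqs : ContMDiffAt 𝓘(ℝ, ℝ) 𝓘(ℝ, EQ) ∞ q 0 := by
    have h1 : ContMDiffAt 𝓘(ℝ, EP) (𝓘(ℝ, EM).prod 𝓘(ℝ, EQ)) ∞ φ (γ 0) := by
      rw [hγ0]; exact hφs.contMDiffAt (φ.open_source.mem_nhds hu)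
    exact contMDiffAt_const.mul (h1.comp 0 hγ).snd
  have h2 : γ =ᶠ[𝓝 0] (fun q => A.act u q) ∘ q := by
    filter_upwards [hγf] with t ht
    have ht' : γ t ∈ φ.source := by rw [hs, mem_preimage, ht.2]; exact hx
    refine φ.injOn ht' (by rw [hs, mem_preimage, Function.comp_apply, A.proj_act]; exact hx) ?_
    rw [Function.comp_apply, (hφ u hu).2, mul_inv_cancel_left]
    exact Prod.ext (by rw [(hφ u hu).1, (hφ _ ht').1, ht.2]) rfl
  have h3 := mfderiv_comp_apply (I := 𝓘(ℝ, ℝ)) (I' := 𝓘(ℝ, EQ)) (I'' := 𝓘(ℝ, EP))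
    (g := fun q => A.act u q) (f := q) (0 : ℝ) ((A.contMDiff_act_left u _).mdifferentiableAt
    (by simp)) (hqs.mdifferentiableAt (by simp)) (1 : ℝ)
  rw [← h2.mfderiv_eq] at h3
  refine ⟨(mfderiv 𝓘(ℝ, ℝ) 𝓘(ℝ, EQ) q 0 (1 : ℝ) : EQ), ?_⟩
  have h4 : ∀ q', q' = 1 → ∀ w : EQ,
      (mfderiv 𝓘(ℝ, EQ) 𝓘(ℝ, EP) (fun q : Q => A.act u q) 1 w : EP)
      = mfderiv 𝓘(ℝ, EQ) 𝓘(ℝ, EP) (fun q : Q => A.act u q) q' w := by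
    rintro _ rfl w; rfl
  exact (h4 _ hq0 _).trans (h3.symm.trans hγw)

lemma conn_mfderiv_act (u : 𝒢) (a : TangentSpace 𝓘(ℝ, EQ) (1 : Q)) {w : TangentSpace 𝓘(ℝ, EP) u}
    (hw : (mfderiv 𝓘(ℝ, EQ) 𝓘(ℝ, EP) (fun q : Q => A.act u q) 1 a : EP) = w) :
    A.conn u w = subgroupDeriv e Q a := by
  rw [← A.conn_fundamental u a]
  exact (A.conn_congr (A.act_one u) hw).symm

lemma mfderiv_proj_mfderiv_act (u : 𝒢) (a : TangentSpace 𝓘(ℝ, EQ) (1 : Q))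
    {w : TangentSpace 𝓘(ℝ, EP) u}
    (hw : (mfderiv 𝓘(ℝ, EQ) 𝓘(ℝ, EP) (fun q : Q => A.act u q) 1 a : EP) = w) :
    mfderiv 𝓘(ℝ, EP) 𝓘(ℝ, EM) A.proj u w = 0 := by
  have h1 := mfderiv_comp_apply (I := 𝓘(ℝ, EQ)) (I' := 𝓘(ℝ, EP)) (I'' := 𝓘(ℝ, EM))
    (g := A.proj) (f := fun q => A.act u q) (1 : Q) (A.mdifferentiableAt_proj _)
    ((A.contMDiff_act_left u _).mdifferentiableAt (by simp)) a
  have h2 : A.proj ∘ (fun q => A.act u q) = fun _ => A.proj u := funext fun q => A.proj_act u q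
  have h3 : ∀ k : Q → M, (k = fun _ => A.proj u) →
      (mfderiv 𝓘(ℝ, EQ) 𝓘(ℝ, EM) k 1 a : EM) = 0 := by
    rintro _ rfl; rw [mfderiv_const]; rfl
  have h4 : ∀ (u' : 𝒢) (w' : EP), u' = u → w' = w →
      (mfderiv 𝓘(ℝ, EP) 𝓘(ℝ, EM) A.proj u w : EM)
      = mfderiv 𝓘(ℝ, EP) 𝓘(ℝ, EM) A.proj u' w' := by
    rintro _ _ rfl rfl; rfl
  exact (h4 _ _ (A.act_one u) hw).trans (h1.symm.trans (h3 _ h2))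

end CartanGeometry

end Cartan

section Cartan

variable {EG : Type*} [NormedAddCommGroup EG] [NormedSpace ℝ EG] [FiniteDimensional ℝ EG]
  {G : Type*} [TopologicalSpace G] [ChartedSpace EG G] [Group G] [LieGroup 𝓘(ℝ, EG) ∞ G]
  {𝔤 : Type*} [LieRing 𝔤] [LieAlgebra ℝ 𝔤]
  {EQ : Type*} [NormedAddCommGroup EQ] [NormedSpace ℝ EQ]
  {EP : Type*} [NormedAddCommGroup EP] [NormedSpace ℝ EP]
  {EM : Type*} [NormedAddCommGroup EM] [NormedSpace ℝ EM]

namespace CartanGeometry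

variable {e : 𝔤 ≃ₗ⁅ℝ⁆ GroupLieAlgebra 𝓘(ℝ, EG) G} {Q : Subgroup G} [ChartedSpace EQ Q]
  {𝒢 : Type*} [TopologicalSpace 𝒢] [ChartedSpace EP 𝒢] [IsManifold 𝓘(ℝ, EP) ∞ 𝒢]
  {M : Type*} [TopologicalSpace M] [ChartedSpace EM M] [IsManifold 𝓘(ℝ, EM) ∞ M]
  (A : CartanGeometry (EQ := EQ) (EP := EP) (EM := EM) e Q 𝒢 M)

/-! ### Equivariance -/

lemma mfderiv_act_constField (u : 𝒢) (q : Q) (X : 𝔤) :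
    mfderiv 𝓘(ℝ, EP) 𝓘(ℝ, EP) (fun u' => A.act u' q) u (A.constField X u)
      = A.constField (Ad e ((q : G)⁻¹) X) (A.act u q) := by
  apply (A.conn (A.act u q)).injective
  rw [A.conn_equivariant, conn_constField, conn_constField]

lemma toTangent_act {x : M} {u : 𝒢} (h : A.proj u = x) (q : Q) (h' : A.proj (A.act u q) = x)
    (X : 𝔤) : A.toTangent (A.act u q) h' (Ad e ((q : G)⁻¹) X) = A.toTangent u h X := by
  have h1 := mfderiv_comp_apply (I := 𝓘(ℝ, EP)) (I' := 𝓘(ℝ, EP)) (I'' := 𝓘(ℝ, EM))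
    (g := A.proj) (f := fun u' => A.act u' q) u (A.mdifferentiableAt_proj _)
    ((A.contMDiff_act_right q _).mdifferentiableAt (by simp)) (A.constField X u)
  have h2 : A.proj ∘ (fun u' => A.act u' q) = A.proj := funext fun u => A.proj_act u q
  have h3 : ∀ k : 𝒢 → M, k = A.proj →
      (mfderiv 𝓘(ℝ, EP) 𝓘(ℝ, EM) k u (A.constField X u) : EM)
        = mfderiv 𝓘(ℝ, EP) 𝓘(ℝ, EM) A.proj u (A.constField X u) := by
    rintro _ rfl; rfl
  rw [A.mfderiv_act_constField u q X] at h1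
  exact (A.toTangent_apply _ h' _).trans
    (h1.symm.trans ((h3 _ h2).trans (A.toTangent_apply u h X).symm))

/-- The curvature function is equivariant. -/
lemma curvature_act [FiniteDimensional ℝ 𝔤] [FiniteDimensional ℝ EP] (u : 𝒢) (q : Q) (X Y : 𝔤) :
    A.curvature (A.act u q) (Ad e ((q : G)⁻¹) X) (Ad e ((q : G)⁻¹) Y)
      = Ad e ((q : G)⁻¹) (A.curvature u X Y) := by
  have : CompleteSpace EP := FiniteDimensional.complete ℝ EP
  have h1 := mfderiv_mlieBracket_of_related (A.contMDiff_act_right q)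
    (A.smoothAlongAt_constField X u) (A.smoothAlongAt_constField Y u)
    (A.smoothAlongAt_constField (Ad e ((q : G)⁻¹) X) _)
    (A.smoothAlongAt_constField (Ad e ((q : G)⁻¹) Y) _)
    (fun u => A.mfderiv_act_constField u q X) (fun u => A.mfderiv_act_constField u q Y)
  have h2 : Ad e ((q : G)⁻¹) ⁅X, Y⁆ = ⁅Ad e ((q : G)⁻¹) X, Ad e ((q : G)⁻¹) Y⁆ :=
    (AdEquiv e (q : G)⁻¹).map_lie X Y
  unfold curvature
  rw [map_sub, h2, ← h1, A.conn_equivariant]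

lemma toTangent_surjective {x : M} {u : 𝒢} (h : A.proj u = x) :
    Function.Surjective (A.toTangent u h) := by
  subst h
  intro v
  obtain ⟨w, hw⟩ := A.mfderiv_proj_surjective u v
  refine ⟨A.conn u w, ?_⟩
  have := A.toTangent_apply u rfl (A.conn u w)
  rw [constField_conn] at this
  exact this.trans hw

/-! ### Horizontality -/

/-- If `a` lies in the Lie algebra of `Q`, then the bracket of `ω⁻¹(a)` and `ω⁻¹(Y)` is
`ω⁻¹([a, Y])`: along the flow of the fundamental field `ω⁻¹(a)`, the equivariance of `ω` expresses
the field `ω⁻¹(Y)` by the adjoint action. -/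
lemma curvature_subgroupDeriv [FiniteDimensional ℝ 𝔤] [FiniteDimensional ℝ EP]
    [FiniteDimensional ℝ EQ] [LieGroup 𝓘(ℝ, EQ) ∞ Q]
    (hincl : ContMDiff 𝓘(ℝ, EQ) 𝓘(ℝ, EG) ∞ (fun q : Q => (q : G))) (u : 𝒢)
    (a : TangentSpace 𝓘(ℝ, EQ) (1 : Q)) (Y : 𝔤) :
    A.curvature u (subgroupDeriv e Q a) Y = 0 := by
  have : CompleteSpace EP := FiniteDimensional.complete ℝ EP
  obtain ⟨c, hc, hc0, hca⟩ := exists_curve (1 : Q) a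
  have hcd : MDifferentiableAt 𝓘(ℝ, ℝ) 𝓘(ℝ, EQ) c 0 := hc.mdifferentiableAt (by simp)
  let Z : ℝ → EP := fun t => A.constField (Ad e (c t : G) Y) u
  have hZ : HasDerivAt Z (A.constField ⁅subgroupDeriv e Q a, Y⁆ u) 0 := by
    have h1 : (mfderiv 𝓘(ℝ, ℝ) 𝓘(ℝ, EG) (fun t => (c t : G)) 0 (1 : ℝ) : EG)
        = e (subgroupDeriv e Q a) := by
      have h2 := mfderiv_comp_apply (I := 𝓘(ℝ, ℝ)) (I' := 𝓘(ℝ, EQ)) (I'' := 𝓘(ℝ, EG))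
        (g := fun q : Q => (q : G)) (f := c) (0 : ℝ)
        ((hincl _).mdifferentiableAt (by simp)) hcd (1 : ℝ)
      have h3 : ∀ (q : Q) (w : EQ), q = 1 → w = a →
          (mfderiv 𝓘(ℝ, EQ) 𝓘(ℝ, EG) (fun q : Q => (q : G)) q w : EG)
            = mfderiv 𝓘(ℝ, EQ) 𝓘(ℝ, EG) (fun q : Q => (q : G)) 1 a := by
        rintro _ _ rfl rfl; rfl
      refine (h2.trans (h3 _ _ hc0 hca)).trans ?_
      exact (e.apply_symm_apply _).symm
    have h4 := hasDerivAt_Ad e (c := fun t => (c t : G))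
      (ContMDiffAt.comp (g := fun q : Q => (q : G)) (0 : ℝ) (hincl _) hc)
      (by simp [hc0]) h1 Y
    let L : EG →ₗ[ℝ] EP := (A.conn u).symm.toLinearMap ∘ₗ e.symm.toLinearMap
    have h5 := (LinearMap.toContinuousLinearMap L).hasFDerivAt.comp_hasDerivAt (0 : ℝ) h4
    have h6 : ∀ X : 𝔤, LinearMap.toContinuousLinearMap L (e X) = A.constField X u := fun X =>
      congrArg (A.conn u).symm (e.symm_apply_apply X)
    rw [h6] at h5
    refine h5.congr_of_eventuallyEq (Eventually.of_forall fun t => ?_)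
    exact (h6 _).symm
  have key := mlieBracket_eq_of_motion (m := fun u t => A.act u (c t)) (x₀ := u)
    (A.smoothAlongAt_constField (subgroupDeriv e Q a) u) (A.smoothAlongAt_constField Y u)
    (ContMDiffAt.comp (g := fun p : 𝒢 × Q => A.act p.1 p.2) (u, (0 : ℝ)) A.act_smooth.contMDiffAt
      (contMDiffAt_fst.prodMk (ContMDiffAt.comp (g := c) (u, (0 : ℝ)) hc contMDiffAt_snd)))
    (fun u => by simp only [hc0, A.act_one])
    (fun u => by
      have h1 := mfderiv_comp_apply (I := 𝓘(ℝ, ℝ)) (I' := 𝓘(ℝ, EQ)) (I'' := 𝓘(ℝ, EP))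
        (g := fun q => A.act u q) (f := c) (0 : ℝ)
        ((A.contMDiff_act_left u _).mdifferentiableAt (by simp)) hcd (1 : ℝ)
      have h2 : ∀ (q : Q) (w : EQ), q = 1 → w = a →
          (mfderiv 𝓘(ℝ, EQ) 𝓘(ℝ, EP) (fun q => A.act u q) q w : EP)
            = A.constField (subgroupDeriv e Q a) u := by
        rintro _ w rfl rfl
        have h3 := A.conn_mfderiv_act u w
          (w := (mfderiv 𝓘(ℝ, EQ) 𝓘(ℝ, EP) (fun q => A.act u q) 1 w : EP)) rfl
        rw [← h3]
        exact (A.constField_conn u _).symm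
      exact h1.trans (h2 _ _ hc0 hca))
    (fun t => by
      have h1 := A.mfderiv_act_constField u (c t) (Ad e (c t : G) Y)
      rw [Ad_inv_Ad] at h1
      exact h1)
    hZ
  have h7 : VectorField.mlieBracket 𝓘(ℝ, EP) (A.constField (subgroupDeriv e Q a))
      (A.constField Y) u = A.constField ⁅subgroupDeriv e Q a, Y⁆ u := key
  rw [curvature, h7, conn_constField, sub_self]

variable {𝔯 : NestedParabolics 𝔤} {P : Subgroup G} (hPQ : IsParabolicPair (EQ := EQ) 𝔯 e P Q)

/-! ### The torsion in terms of the curvature function -/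

section Parabolic

include hPQ

/-- Since `Ad Q` preserves `𝔤^(i, *)`, any single point over `x` determines `T^i_P M` at `x`. -/
lemma TP_eq_map [FiniteDimensional ℝ 𝔤] [LieAlgebra.IsSemisimple ℝ 𝔤] {i : ℤ} (hi : i ≤ 0)
    {x : M} {u : 𝒢} (h : A.proj u = x) : A.TP 𝔯 i x = (𝔯.fil i).map (A.toTangent u h) := by
  refine le_antisymm (iSup₂_le fun u' h' => ?_) (A.map_fil_le 𝔯 i u h)
  obtain ⟨q, rfl⟩ := A.exists_act_eq (h'.trans h.symm)
  rintro _ ⟨X, hX, rfl⟩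
  rw [← A.toTangent_act h' q h X]
  exact Submodule.mem_map_of_mem
    ((hPQ.Ad_mem_fil (P.inv_mem (hPQ.Q_le _ q.2).1) hi X).2 hX)

/-- The curvature is horizontal. -/
lemma curvature_eq_zero_of_mem_𝔮 [FiniteDimensional ℝ EP] [LieGroup 𝓘(ℝ, EQ) ∞ Q]
    [FiniteDimensional ℝ 𝔤] [FiniteDimensional ℝ EQ] (u : 𝒢) {X : 𝔤} (hX : X ∈ 𝔯.𝔮) (Y : 𝔤) :
    A.curvature u X Y = 0 := by
  rw [← hPQ.range_deriv] at hX
  obtain ⟨a, rfl⟩ := hX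
  exact A.curvature_subgroupDeriv hPQ.smooth_incl u a Y

lemma curvature_congr [FiniteDimensional ℝ EP] [LieGroup 𝓘(ℝ, EQ) ∞ Q]
    [FiniteDimensional ℝ 𝔤] [FiniteDimensional ℝ EQ] (u : 𝒢) {X X' Y Y' : 𝔤}
    (hX : X - X' ∈ 𝔯.𝔮) (hY : Y - Y' ∈ 𝔯.𝔮) :
    A.curvature u X Y = A.curvature u X' Y' := by
  rw [← sub_add_cancel X X', ← sub_add_cancel Y Y', curvature_add_left,
    A.curvature_eq_zero_of_mem_𝔮 hPQ u hX, curvature_add_right, A.curvature_swap u X' (Y - Y'),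
    A.curvature_eq_zero_of_mem_𝔮 hPQ u hY]
  simp

variable [FiniteDimensional ℝ EP] [FiniteDimensional ℝ EM] [LieGroup 𝓘(ℝ, EQ) ∞ Q]

lemma mfderiv_proj_eq_zero_iff {u : 𝒢} {w : TangentSpace 𝓘(ℝ, EP) u} :
    mfderiv 𝓘(ℝ, EP) 𝓘(ℝ, EM) A.proj u w = 0 ↔ A.conn u w ∈ 𝔯.𝔮 := by
  rw [← hPQ.range_deriv]
  constructor
  · intro h
    obtain ⟨a, ha⟩ := A.exists_mfderiv_act_of_mfderiv_proj_eq_zero h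
    exact ⟨a, (A.conn_mfderiv_act u a ha).symm⟩
  · rintro ⟨a, ha⟩
    refine A.mfderiv_proj_mfderiv_act u a ?_
    have h1 := A.conn_mfderiv_act u a
      (w := (mfderiv 𝓘(ℝ, EQ) 𝓘(ℝ, EP) (fun q : Q => A.act u q) 1 a : EP)) rfl
    exact (A.conn u).injective (h1.trans ha)

lemma toTangent_eq_zero_iff {x : M} {u : 𝒢} (h : A.proj u = x) {X : 𝔤} :
    A.toTangent u h X = 0 ↔ X ∈ 𝔯.𝔮 := by
  have h1 := A.mfderiv_proj_eq_zero_iff hPQ (u := u) (w := A.constField X u)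
  rw [conn_constField] at h1
  rw [← h1]
  subst h
  rfl

variable [FiniteDimensional ℝ 𝔤] [LieAlgebra.IsSemisimple ℝ 𝔤]

lemma toTangent_mem_TP_iff {i : ℤ} (hi : i ≤ 0) {x : M} {u : 𝒢} (h : A.proj u = x) {X : 𝔤} :
    A.toTangent u h X ∈ A.TP 𝔯 i x ↔ X ∈ 𝔯.fil i := by
  rw [A.TP_eq_map hPQ hi h]
  refine ⟨?_, fun hX => Submodule.mem_map_of_mem hX⟩
  rintro ⟨Y, hY, hYX⟩
  have h1 : X - Y ∈ 𝔯.𝔮 := by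
    rw [← A.toTangent_eq_zero_iff hPQ h, map_sub, hYX, sub_self]
  have := add_mem (𝔯.𝔭_le_fil hi (𝔯.𝔮_le_𝔭 h1)) hY
  rwa [sub_add_cancel] at this

/-- The torsion condition, expressed by the curvature function. -/
lemma torsionCond_iff [FiniteDimensional ℝ EQ] {U : Set M} {i j : ℤ} (hi : i ≤ 0) (hj : j ≤ 0) :
    A.TorsionCond 𝔯 U i j ↔ ∀ u : 𝒢, A.proj u ∈ U → ∀ X ∈ 𝔯.𝔭, ∀ Y ∈ 𝔯.fil i,
      A.curvature u X Y ∈ 𝔯.fil j := by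
  have hinv : ∀ (x : M) (ξ : TangentSpace 𝓘(ℝ, EM) x),
      A.toTangent (A.point x) (A.proj_point x)
        (Function.invFun (A.toTangent (A.point x) (A.proj_point x)) ξ) = ξ := fun x ξ =>
    Function.invFun_eq (A.toTangent_surjective (A.proj_point x) ξ)
  constructor
  · intro h
    have h0 : ∀ x ∈ U, ∀ X ∈ 𝔯.𝔭, ∀ Y ∈ 𝔯.fil i, A.curvature (A.point x) X Y ∈ 𝔯.fil j := by
      intro x hx X hX Y hY
      have h1 := h x hx (A.toTangent (A.point x) (A.proj_point x) X)
        ((A.toTangent_mem_TP_iff hPQ le_rfl _).2 hX) (A.toTangent (A.point x) (A.proj_point x) Y)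
        ((A.toTangent_mem_TP_iff hPQ hi _).2 hY)
      rw [torsion, A.toTangent_mem_TP_iff hPQ hj] at h1
      rwa [A.curvature_congr hPQ (A.point x) (X' := X) (Y' := Y)] at h1 <;>
        rw [← A.toTangent_eq_zero_iff hPQ (A.proj_point x), map_sub, hinv, sub_self]
    intro u hu X hX Y hY
    obtain ⟨q, hqu⟩ := A.exists_act_eq (A.proj_point (A.proj u))
    have hq : (q : G)⁻¹ ∈ P := P.inv_mem (hPQ.Q_le _ q.2).1
    have hq' : (q : G) ∈ P := (hPQ.Q_le _ q.2).1
    have hAd : ∀ X, Ad e (q : G)⁻¹ (Ad e (q : G) X) = X := Ad_inv_Ad e (q : G)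
    rw [← hqu, ← hAd X, ← hAd Y, curvature_act, hPQ.Ad_mem_fil hq hj]
    exact h0 _ hu _ ((hPQ.Ad_mem_fil hq' le_rfl X).2 hX) _ ((hPQ.Ad_mem_fil hq' hi Y).2 hY)
  · intro h x hx ξ hξ η hη
    rw [torsion, A.toTangent_mem_TP_iff hPQ hj]
    refine h _ ((A.proj_point x).symm ▸ hx) _ ?_ _ ?_
    · rw [← hinv x ξ, relTangent, A.toTangent_mem_TP_iff hPQ le_rfl] at hξ
      exact hξ
    · rw [← hinv x η, A.toTangent_mem_TP_iff hPQ hi] at hη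
      exact hη

end Parabolic

end CartanGeometry

end Cartan

/-! ### Constancy along curves -/

section Constancy

/-- If the derivative of a curve `A` of linear maps takes values in the images of the maps `A t`,
and the `A t` stay injective, then the image of `A t` is constant: normalized by a left inverse
`r` of one of them to `A t ∘ (r ∘ A t)⁻¹`, the curve has derivative zero. -/
lemma range_eq_of_hasDerivAt {C W : Type*} [NormedAddCommGroup C] [NormedSpace ℝ C]
    [CompleteSpace C] [NormedAddCommGroup W] [NormedSpace ℝ W] {A A' : ℝ → C →L[ℝ] W}
    {r : W →L[ℝ] C} (hA : ∀ t ∈ Icc (0 : ℝ) 1, HasDerivAt A (A' t) t)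
    (hA' : ∀ t ∈ Icc (0 : ℝ) 1, ∀ v, ∃ w, A' t v = A t w)
    (hr : ∀ t ∈ Icc (0 : ℝ) 1, IsUnit (r ∘L A t)) :
    range (A 1) = range (A 0) := by
  let R : ℝ → C →L[ℝ] C := fun t => Ring.inverse (r ∘L A t)
  let n : ℝ → C →L[ℝ] W := fun t => A t ∘L R t
  have hn : ∀ t ∈ Icc (0 : ℝ) 1, HasDerivAt n 0 t := by
    intro t ht
    obtain ⟨x, hx⟩ := hr t ht
    have h1 : HasDerivAt (fun t => r ∘L A t) (r ∘L A' t) t :=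
      (ContinuousLinearMap.compL ℝ C W C r).hasFDerivAt.comp_hasDerivAt t (hA t ht)
    have h2 := hasFDerivAt_ringInverse (𝕜 := ℝ) x
    have h3 := HasFDerivAt.comp_hasDerivAt (l := Ring.inverse) (f := fun t => r ∘L A t) t
      (by rw [hx] at h2; exact h2) h1
    have h4 : HasDerivAt n _ t := (hA t ht).clm_comp h3
    convert! h4 using 1
    refine ContinuousLinearMap.ext fun c => ?_
    obtain ⟨w, hw⟩ := hA' t ht (R t c)
    have hR : R t = (↑x⁻¹ : C →L[ℝ] C) := by simp [R, ← hx]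
    have h5 : (↑x⁻¹ : C →L[ℝ] C) (r (A t w)) = w := by
      have h6 : (↑x⁻¹ * ↑x : C →L[ℝ] C) w = w := by rw [Units.inv_mul]; rfl
      rw [hx] at h6
      exact h6
    rw [hR] at hw
    simp [hR, hw, h5]
  have hconst := constant_of_has_deriv_right_zero (f := n) (a := 0) (b := 1)
    (fun t ht => (hn t ht).continuousAt.continuousWithinAt)
    (fun t ht => (hn t (Ico_subset_Icc_self ht)).hasDerivWithinAt) 1 (by simp)
  have hrange : ∀ t ∈ Icc (0 : ℝ) 1, range (A t) = range (n t) := by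
    intro t ht
    obtain ⟨x, hx⟩ := hr t ht
    have hR : R t = (↑x⁻¹ : C →L[ℝ] C) := by simp [R, ← hx]
    refine subset_antisymm ?_ ?_
    · rintro _ ⟨c, rfl⟩
      refine ⟨(↑x : C →L[ℝ] C) c, ?_⟩
      have h6 : (↑x⁻¹ * ↑x : C →L[ℝ] C) c = c := by rw [Units.inv_mul]; rfl
      change A t (R t _) = _
      rw [hR]
      exact congrArg (A t) h6
    · rintro _ ⟨c, rfl⟩
      exact ⟨R t c, rfl⟩
  rw [hrange 1 (by simp), hrange 0 (by simp), hconst]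

/-- A locally constant function, with values in a type without topology, is constant on connected
sets. -/
lemma eq_of_isPreconnected {α β : Type*} [TopologicalSpace α] {s : Set α} (hs : IsPreconnected s)
    {f : α → β} (hf : ∀ x ∈ s, ∀ᶠ y in 𝓝[s] x, f y = f x) {x y : α} (hx : x ∈ s) (hy : y ∈ s) :
    f x = f y := by
  let _ : TopologicalSpace β := ⊥
  have : DiscreteTopology β := ⟨rfl⟩
  refine hs.constant (fun x hx => ?_) hx hy
  exact continuousWithinAt_const.congr_of_eventuallyEq (hf x hx) rfl

variable {EX : Type*} [NormedAddCommGroup EX] [NormedSpace ℝ EX]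
  {X : Type*} [TopologicalSpace X] [ChartedSpace EX X]
  {F : Type*} [NormedAddCommGroup F] [NormedSpace ℝ F]

lemma hasDerivAt_comp_curve {f : X → F} {γ : ℝ → X} {t : ℝ}
    (hf : MDifferentiableAt 𝓘(ℝ, EX) 𝓘(ℝ, F) f (γ t))
    (hγ : MDifferentiableAt 𝓘(ℝ, ℝ) 𝓘(ℝ, EX) γ t) :
    HasDerivAt (fun t => f (γ t))
      (mvfderiv 𝓘(ℝ, EX) f (γ t) (mfderiv 𝓘(ℝ, ℝ) 𝓘(ℝ, EX) γ t (1 : ℝ))) t := by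
  have h1 : MDifferentiableAt 𝓘(ℝ, ℝ) 𝓘(ℝ, F) (f ∘ γ) t := hf.comp t hγ
  have h2 := h1.differentiableAt.hasDerivAt
  have h3 := mfderiv_comp_apply (I := 𝓘(ℝ, ℝ)) (I' := 𝓘(ℝ, EX)) (I'' := 𝓘(ℝ, F)) t hf hγ (1 : ℝ)
  have h4 : deriv (f ∘ γ) t
      = mvfderiv 𝓘(ℝ, EX) f (γ t) (mfderiv 𝓘(ℝ, ℝ) 𝓘(ℝ, EX) γ t (1 : ℝ)) := by
    rw [← fderiv_apply_one_eq_deriv, ← mfderiv_eq_fderiv]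
    exact h3
  rw [← h4]
  exact h2

/-- The velocity of a curve in a fibre is vertical. -/
lemma mfderiv_eq_zero_of_curve {EZ : Type*} [NormedAddCommGroup EZ] [NormedSpace ℝ EZ]
    {Z : Type*} [TopologicalSpace Z] [ChartedSpace EZ Z] {f : X → Z} {γ : ℝ → X} {t : ℝ} {z : Z}
    (hf : MDifferentiableAt 𝓘(ℝ, EX) 𝓘(ℝ, EZ) f (γ t))
    (hγ : MDifferentiableAt 𝓘(ℝ, ℝ) 𝓘(ℝ, EX) γ t) (hz : ∀ᶠ s in 𝓝 t, f (γ s) = z) :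
    mfderiv 𝓘(ℝ, EX) 𝓘(ℝ, EZ) f (γ t) (mfderiv 𝓘(ℝ, ℝ) 𝓘(ℝ, EX) γ t (1 : ℝ)) = 0 := by
  have h3 := mfderiv_comp_apply (I := 𝓘(ℝ, ℝ)) (I' := 𝓘(ℝ, EX)) (I'' := 𝓘(ℝ, EZ)) t hf hγ (1 : ℝ)
  have h4 : f ∘ γ =ᶠ[𝓝 t] fun _ => z := hz
  rw [h4.mfderiv_eq, mfderiv_const] at h3
  exact h3.symm

end Constancy

/-! ### The derivative of the projection to the leaf space -/

section Leaves

variable {EG : Type*} [NormedAddCommGroup EG] [NormedSpace ℝ EG] [FiniteDimensional ℝ EG]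
  {G : Type*} [TopologicalSpace G] [ChartedSpace EG G] [Group G] [LieGroup 𝓘(ℝ, EG) ∞ G]
  {𝔤 : Type*} [LieRing 𝔤] [LieAlgebra ℝ 𝔤]
  {EQ : Type*} [NormedAddCommGroup EQ] [NormedSpace ℝ EQ]
  {EP : Type*} [NormedAddCommGroup EP] [NormedSpace ℝ EP]
  {EM : Type*} [NormedAddCommGroup EM] [NormedSpace ℝ EM]
  {EN : Type*} [NormedAddCommGroup EN] [NormedSpace ℝ EN]

namespace CartanGeometry

variable {e : 𝔤 ≃ₗ⁅ℝ⁆ GroupLieAlgebra 𝓘(ℝ, EG) G} {Q : Subgroup G} [ChartedSpace EQ Q]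
  {𝒢 : Type*} [TopologicalSpace 𝒢] [ChartedSpace EP 𝒢] [IsManifold 𝓘(ℝ, EP) ∞ 𝒢]
  {M : Type*} [TopologicalSpace M] [ChartedSpace EM M] [IsManifold 𝓘(ℝ, EM) ∞ M]
  {N : Type*} [TopologicalSpace N] [ChartedSpace EN N]
  (A : CartanGeometry (EQ := EQ) (EP := EP) (EM := EM) e Q 𝒢 M)

variable (EN) in
/-- The derivative at `u` of `ψ ∘ p : 𝒢 → N`, as a linear map on `𝔤` by means of `ω_u⁻¹`.  Its
values are regarded as elements of the model space of `N`, so that values at different points of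
a fibre of `ψ ∘ p` can be compared. -/
def leafMap (ψ : M → N) (u : 𝒢) : 𝔤 →ₗ[ℝ] EN :=
  (mfderiv 𝓘(ℝ, EP) 𝓘(ℝ, EN) (fun u => ψ (A.proj u)) u).toLinearMap ∘ₗ (A.conn u).symm.toLinearMap

variable (EN) in
/-- The analogue of `leafMap` for `ψ ∘ p` composed with the chart of `N` at `z`; it agrees with
`leafMap` over `z`. -/
def leafMapChart (ψ : M → N) (z : N) (u : 𝒢) : 𝔤 →ₗ[ℝ] EN :=
  (mvfderiv 𝓘(ℝ, EP) (fun u => extChartAt 𝓘(ℝ, EN) z (ψ (A.proj u))) u).toLinearMap ∘ₗ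
    (A.conn u).symm.toLinearMap

variable (EN) in
lemma leafMap_apply (ψ : M → N) (u : 𝒢) (X : 𝔤) : A.leafMap EN ψ u X
    = mfderiv 𝓘(ℝ, EP) 𝓘(ℝ, EN) (fun u => ψ (A.proj u)) u (A.constField X u) := rfl

variable (EN) in
lemma leafMapChart_apply (ψ : M → N) (z : N) (u : 𝒢) (X : 𝔤) : A.leafMapChart EN ψ z u X
    = mvfderiv 𝓘(ℝ, EP) (fun u => extChartAt 𝓘(ℝ, EN) z (ψ (A.proj u))) u (A.constField X u) :=
  rfl

variable {𝔯 : NestedParabolics 𝔤} {U : Set M} {ψ : M → N}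

section

variable (hψ : IsLocalLeafSpace (EN := EN) (A.relTangent 𝔯) U ψ)

include hψ

lemma isOpen_preimage_proj : IsOpen (A.proj ⁻¹' U) :=
  hψ.isOpen.preimage A.proj_smooth.continuous

lemma contMDiffOn_leaf : ContMDiffOn 𝓘(ℝ, EP) 𝓘(ℝ, EN) ∞ (fun u => ψ (A.proj u)) (A.proj ⁻¹' U) :=
  hψ.smooth.comp A.proj_smooth.contMDiffOn fun _ hu => hu

lemma contMDiffAt_leaf {u : 𝒢} (hu : A.proj u ∈ U) :
    ContMDiffAt 𝓘(ℝ, EP) 𝓘(ℝ, EN) ∞ (fun u => ψ (A.proj u)) u :=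
  (A.contMDiffOn_leaf hψ).contMDiffAt ((A.isOpen_preimage_proj hψ).mem_nhds hu)

lemma mdifferentiableAt_leaf {u : 𝒢} (hu : A.proj u ∈ U) :
    MDifferentiableAt 𝓘(ℝ, EP) 𝓘(ℝ, EN) (fun u => ψ (A.proj u)) u :=
  (A.contMDiffAt_leaf hψ hu).mdifferentiableAt (by simp)

lemma leafMap_eq {u : 𝒢} (hu : A.proj u ∈ U) (X : 𝔤) : A.leafMap EN ψ u X
    = mfderiv 𝓘(ℝ, EM) 𝓘(ℝ, EN) ψ (A.proj u) (A.toTangent u rfl X) :=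
  mfderiv_comp_apply (I := 𝓘(ℝ, EP)) (I' := 𝓘(ℝ, EM)) (I'' := 𝓘(ℝ, EN)) (g := ψ) (f := A.proj) u
    ((hψ.smooth.contMDiffAt (hψ.isOpen.mem_nhds hu)).mdifferentiableAt (by simp))
    (A.mdifferentiableAt_proj u) (A.constField X u)

lemma leafMap_surjective {u : 𝒢} (hu : A.proj u ∈ U) : Function.Surjective (A.leafMap EN ψ u) := by
  intro v
  obtain ⟨ξ, hξ⟩ := hψ.submersion _ hu v
  obtain ⟨X, rfl⟩ := A.toTangent_surjective (u := u) rfl ξ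
  exact ⟨X, (A.leafMap_eq hψ hu X).trans hξ⟩

lemma mfderiv_leaf_surjective {u : 𝒢} (hu : A.proj u ∈ U) :
    Function.Surjective (mfderiv 𝓘(ℝ, EP) 𝓘(ℝ, EN) (fun u => ψ (A.proj u)) u) := by
  intro v
  obtain ⟨X, hX⟩ := A.leafMap_surjective hψ hu v
  exact ⟨A.constField X u, hX⟩

lemma eventually_leaf_mem_source {z : N} {u : 𝒢} (hu : A.proj u ∈ U)
    (hz : ψ (A.proj u) ∈ (chartAt EN z).source) :
    ∀ᶠ u' in 𝓝 u, A.proj u' ∈ U ∧ ψ (A.proj u') ∈ (chartAt EN z).source :=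
  Filter.Eventually.and ((A.isOpen_preimage_proj hψ).mem_nhds hu)
    ((A.contMDiffAt_leaf hψ hu).continuousAt.preimage_mem_nhds
      ((chartAt EN z).open_source.mem_nhds hz))

/-- The fields `ω⁻¹(X)` with `X ∈ 𝔭` span the vertical subspaces of `ψ ∘ p`. -/
lemma leafMap_eq_zero_iff {P : Subgroup G} (hPQ : IsParabolicPair (EQ := EQ) 𝔯 e P Q)
    [FiniteDimensional ℝ EP] [FiniteDimensional ℝ EM] [LieGroup 𝓘(ℝ, EQ) ∞ Q]
    [FiniteDimensional ℝ 𝔤] [LieAlgebra.IsSemisimple ℝ 𝔤] {u : 𝒢} (hu : A.proj u ∈ U) {X : 𝔤} :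
    A.leafMap EN ψ u X = 0 ↔ X ∈ 𝔯.𝔭 := by
  rw [leafMap_eq A hψ hu]
  refine Iff.trans ?_ (A.toTangent_mem_TP_iff hPQ le_rfl (u := u) rfl)
  have h : A.TP 𝔯 0 (A.proj u) = _ := (hψ.ker_eq _ hu).symm
  rw [h]
  exact Iff.rfl

variable [IsManifold 𝓘(ℝ, EN) ∞ N]

lemma leafMapChart_eq {z : N} {u : 𝒢} (hu : A.proj u ∈ U)
    (hz : ψ (A.proj u) ∈ (chartAt EN z).source) (X : 𝔤) : A.leafMapChart EN ψ z u X
      = mvfderiv 𝓘(ℝ, EN) (extChartAt 𝓘(ℝ, EN) z) (ψ (A.proj u)) (A.leafMap EN ψ u X) :=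
  mfderiv_comp_apply (I := 𝓘(ℝ, EP)) (I' := 𝓘(ℝ, EN)) (I'' := 𝓘(ℝ, EN))
    (g := extChartAt 𝓘(ℝ, EN) z) (f := fun u => ψ (A.proj u)) u
    ((contMDiffAt_extChartAt' (n := ∞) hz).mdifferentiableAt (by simp))
    (A.mdifferentiableAt_leaf hψ hu) (A.constField X u)

lemma leafMapChart_self {z : N} {u : 𝒢} (hu : A.proj u ∈ U) (hz : ψ (A.proj u) = z) :
    A.leafMapChart EN ψ z u = A.leafMap EN ψ u :=
  LinearMap.ext fun X =>
    mvfderiv_extChartAt_comp (A.mdifferentiableAt_leaf hψ hu) hz (A.constField X u)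

lemma contMDiffAt_extChartAt_leaf {z : N} {u : 𝒢} (hu : A.proj u ∈ U)
    (hz : ψ (A.proj u) ∈ (chartAt EN z).source) :
    ContMDiffAt 𝓘(ℝ, EP) 𝓘(ℝ, EN) ∞ (fun u => extChartAt 𝓘(ℝ, EN) z (ψ (A.proj u))) u :=
  ContMDiffAt.comp (g := extChartAt 𝓘(ℝ, EN) z) u (contMDiffAt_extChartAt' hz)
    (A.contMDiffAt_leaf hψ hu)

lemma contMDiffAt_leafMapChart [FiniteDimensional ℝ 𝔤] [FiniteDimensional ℝ EP] {z : N} {u : 𝒢}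
    (hu : A.proj u ∈ U) (hz : ψ (A.proj u) ∈ (chartAt EN z).source) (X : 𝔤) :
    ContMDiffAt 𝓘(ℝ, EP) 𝓘(ℝ, EN) ∞ (fun u => A.leafMapChart EN ψ z u X) u :=
  (A.smoothAlongAt_constField X u).mvfderiv (A.contMDiffAt_extChartAt_leaf hψ hu hz)

variable {P : Subgroup G} (hPQ : IsParabolicPair (EQ := EQ) 𝔯 e P Q)
  [FiniteDimensional ℝ EP] [FiniteDimensional ℝ EM] [LieGroup 𝓘(ℝ, EQ) ∞ Q]
  [FiniteDimensional ℝ 𝔤] [LieAlgebra.IsSemisimple ℝ 𝔤]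

include hPQ

lemma leafMapChart_eq_zero {z : N} {u : 𝒢} (hu : A.proj u ∈ U)
    (hz : ψ (A.proj u) ∈ (chartAt EN z).source) {X : 𝔤} (hX : X ∈ 𝔯.𝔭) :
    A.leafMapChart EN ψ z u X = 0 := by
  rw [A.leafMapChart_eq hψ hu hz, (A.leafMap_eq_zero_iff hψ hPQ hu).2 hX]
  exact map_zero _

/-- The derivative of `leafMapChart` in the directions of the leaves.  The field `ω⁻¹(X)` is
vertical for `X ∈ 𝔭`, so this is the derivative of `ψ ∘ p` on `[ω⁻¹(X), ω⁻¹(Y)]`. -/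
lemma mvfderiv_leafMapChart {z : N} {u : 𝒢} (hu : A.proj u ∈ U)
    (hz : ψ (A.proj u) ∈ (chartAt EN z).source) {X : 𝔤} (hX : X ∈ 𝔯.𝔭) (Y : 𝔤) :
    mvfderiv 𝓘(ℝ, EP) (fun u => A.leafMapChart EN ψ z u Y) u (A.constField X u)
      = A.leafMapChart EN ψ z u (⁅X, Y⁆ - A.curvature u X Y) := by
  have : CompleteSpace EP := FiniteDimensional.complete ℝ EP
  have h1 := mvfderiv_mlieBracket (A.smoothAlongAt_constField X u)
    (A.smoothAlongAt_constField Y u) (A.contMDiffAt_extChartAt_leaf hψ hu hz)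
  have h2 : (fun u => mvfderiv 𝓘(ℝ, EP) (fun u => extChartAt 𝓘(ℝ, EN) z (ψ (A.proj u))) u
      (A.constField X u)) =ᶠ[𝓝 u] fun _ => 0 := by
    filter_upwards [A.eventually_leaf_mem_source hψ hu hz] with u' hu'
    exact A.leafMapChart_eq_zero hψ hPQ hu'.1 hu'.2 hX
  have h3 := congrArg (fun L => L (A.constField Y u))
    (h2.mfderiv_eq (I := 𝓘(ℝ, EP)) (I' := 𝓘(ℝ, EN)))
  have h4 : mvfderiv 𝓘(ℝ, EP) (fun u => mvfderiv 𝓘(ℝ, EP)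
      (fun u => extChartAt 𝓘(ℝ, EN) z (ψ (A.proj u))) u (A.constField X u)) u
        (A.constField Y u) = 0 := by
    refine h3.trans ?_
    change mfderiv 𝓘(ℝ, EP) 𝓘(ℝ, EN) (fun _ : 𝒢 => (0 : EN)) u (A.constField Y u) = 0
    rw [mfderiv_const]; rfl
  rw [h4, sub_zero] at h1
  rw [curvature, sub_sub_cancel, leafMapChart_apply EN A ψ z u (A.conn u _), constField_conn]
  exact h1.symm

end

end CartanGeometry

end Leaves

/-! ### Images of subspaces of `𝔤` along the leaves -/

/-- Linear coordinates on a complement of `p` in `F`. -/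
lemma exists_complement_param {V : Type*} [AddCommGroup V] [Module ℝ V] [FiniteDimensional ℝ V]
    {p F : Submodule ℝ V} (hpF : p ≤ F) :
    ∃ (n : ℕ) (ι : (Fin n → ℝ) →ₗ[ℝ] V), (∀ c, ι c ∈ p → c = 0) ∧ (∀ c, ι c ∈ F) ∧
      ∀ Y ∈ F, ∃ c, Y - ι c ∈ p := by
  obtain ⟨C, hC⟩ := Submodule.exists_isCompl p
  let D : Submodule ℝ V := C ⊓ F
  refine ⟨Module.finrank ℝ D,
    D.subtype ∘ₗ (Module.finBasis ℝ D).equivFun.symm.toLinearMap, ?_, ?_, ?_⟩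
  · intro c hc
    have h1 : ((Module.finBasis ℝ D).equivFun.symm c : V) = 0 := by
      have : ((Module.finBasis ℝ D).equivFun.symm c : V) ∈ p ⊓ C :=
        ⟨hc, ((Module.finBasis ℝ D).equivFun.symm c).2.1⟩
      rwa [hC.inf_eq_bot, Submodule.mem_bot] at this
    have h2 : (Module.finBasis ℝ D).equivFun.symm c = 0 := Subtype.ext h1
    exact (LinearEquiv.map_eq_zero_iff _).1 h2
  · exact fun c => ((Module.finBasis ℝ D).equivFun.symm c).2.2
  · intro Y hY
    have h1 : Y ∈ p ⊔ C := by rw [hC.sup_eq_top]; trivial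
    obtain ⟨a, ha, b, hb, rfl⟩ := Submodule.mem_sup.1 h1
    have hbF : b ∈ F := by
      have := F.sub_mem hY (hpF ha)
      rwa [add_sub_cancel_left] at this
    refine ⟨(Module.finBasis ℝ D).equivFun ⟨b, hb, hbF⟩, ?_⟩
    simpa using ha

section Leaves

variable {EG : Type*} [NormedAddCommGroup EG] [NormedSpace ℝ EG] [FiniteDimensional ℝ EG]
  {G : Type*} [TopologicalSpace G] [ChartedSpace EG G] [Group G] [LieGroup 𝓘(ℝ, EG) ∞ G]
  {𝔤 : Type*} [LieRing 𝔤] [LieAlgebra ℝ 𝔤]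
  {EQ : Type*} [NormedAddCommGroup EQ] [NormedSpace ℝ EQ]
  {EP : Type*} [NormedAddCommGroup EP] [NormedSpace ℝ EP]
  {EM : Type*} [NormedAddCommGroup EM] [NormedSpace ℝ EM]
  {EN : Type*} [NormedAddCommGroup EN] [NormedSpace ℝ EN]

namespace CartanGeometry

variable {e : 𝔤 ≃ₗ⁅ℝ⁆ GroupLieAlgebra 𝓘(ℝ, EG) G} {Q : Subgroup G} [ChartedSpace EQ Q]
  {𝒢 : Type*} [TopologicalSpace 𝒢] [ChartedSpace EP 𝒢] [IsManifold 𝓘(ℝ, EP) ∞ 𝒢]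
  {M : Type*} [TopologicalSpace M] [ChartedSpace EM M] [IsManifold 𝓘(ℝ, EM) ∞ M]
  {N : Type*} [TopologicalSpace N] [ChartedSpace EN N]
  (A : CartanGeometry (EQ := EQ) (EP := EP) (EM := EM) e Q 𝒢 M)
  {𝔯 : NestedParabolics 𝔤} {U : Set M} {ψ : M → N}

/-- A function on `U` that is locally constant along the fibres of `ψ ∘ p` when pulled back to
`𝒢` is constant along the fibres of `ψ`, as these are connected. -/
lemma eq_of_leaf_eq {L : Type*} {ψ : M → L} (hconn : ∀ z, IsConnected (U ∩ ψ ⁻¹' {z}))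
    {β : Type*} {f : M → β}
    (hf : ∀ u₀, A.proj u₀ ∈ U → ∀ᶠ u in 𝓝 u₀, ψ (A.proj u) = ψ (A.proj u₀) →
      f (A.proj u) = f (A.proj u₀)) {x y : M} (hx : x ∈ U) (hy : y ∈ U) (hxy : ψ x = ψ y) :
    f x = f y := by
  refine eq_of_isPreconnected (hconn (ψ y)).isPreconnected (f := f) ?_ ⟨hx, hxy⟩ ⟨hy, rfl⟩
  rintro x₀ ⟨hx₀, hx₀y⟩
  obtain ⟨u₀, rfl⟩ := A.proj_surjective x₀
  obtain ⟨W, s, hW, hxW, hsu, hs, hps⟩ := A.exists_local_section_proj u₀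
  have h1 : Tendsto s (𝓝 (A.proj u₀)) (𝓝 u₀) := by
    have := hs.continuousOn.continuousAt (hW.mem_nhds hxW)
    rwa [ContinuousAt, hsu] at this
  have h2 := h1.eventually (hf u₀ hx₀)
  filter_upwards [mem_nhdsWithin_of_mem_nhds h2, mem_nhdsWithin_of_mem_nhds (hW.mem_nhds hxW),
    self_mem_nhdsWithin] with x h3 h4 h5
  have h6 : ψ x = ψ (A.proj u₀) := Eq.trans h5.2 (Eq.symm hx₀y)
  rw [hps x h4] at h3
  exact h3 h6

section

variable (hψ : IsLocalLeafSpace (EN := EN) (A.relTangent 𝔯) U ψ)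
include hψ

variable {P : Subgroup G} (hPQ : IsParabolicPair (EQ := EQ) 𝔯 e P Q)
  [FiniteDimensional ℝ EP] [FiniteDimensional ℝ EM] [LieGroup 𝓘(ℝ, EQ) ∞ Q]
  [FiniteDimensional ℝ 𝔤] [LieAlgebra.IsSemisimple ℝ 𝔤]
include hPQ

/-- Curves in the fibres of `ψ ∘ p` have velocities in `ω⁻¹(𝔭)`. -/
lemma conn_velocity_mem_𝔭 {γ : ℝ → 𝒢} {t : ℝ} (hγ : MDifferentiableAt 𝓘(ℝ, ℝ) 𝓘(ℝ, EP) γ t)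
    (hγt : A.proj (γ t) ∈ U) (hfib : ∀ᶠ s in 𝓝 t, ψ (A.proj (γ s)) = ψ (A.proj (γ t))) :
    A.conn (γ t) (mfderiv 𝓘(ℝ, ℝ) 𝓘(ℝ, EP) γ t (1 : ℝ)) ∈ 𝔯.𝔭 := by
  rw [← A.leafMap_eq_zero_iff hψ hPQ hγt, leafMap_apply, constField_conn]
  exact mfderiv_eq_zero_of_curve (f := fun u => ψ (A.proj u)) (A.mdifferentiableAt_leaf hψ hγt)
    hγ hfib

variable [IsManifold 𝓘(ℝ, EN) ∞ N]

/-- The derivative of `leafMapChart` along a curve in a leaf. -/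
lemma hasDerivAt_leafMapChart {z : N} {γ : ℝ → 𝒢} {t : ℝ}
    (hγ : MDifferentiableAt 𝓘(ℝ, ℝ) 𝓘(ℝ, EP) γ t) (hγt : A.proj (γ t) ∈ U)
    (hfib : ∀ᶠ s in 𝓝 t, ψ (A.proj (γ s)) = ψ (A.proj (γ t)))
    (hz : ψ (A.proj (γ t)) ∈ (chartAt EN z).source) {X : 𝔤}
    (hX : X = A.conn (γ t) (mfderiv 𝓘(ℝ, ℝ) 𝓘(ℝ, EP) γ t (1 : ℝ))) (Y : 𝔤) :
    HasDerivAt (fun t => A.leafMapChart EN ψ z (γ t) Y)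
      (A.leafMapChart EN ψ z (γ t) (⁅X, Y⁆ - A.curvature (γ t) X Y)) t := by
  have h1 := A.conn_velocity_mem_𝔭 hψ hPQ hγ hγt hfib
  rw [← hX] at h1
  rw [← A.mvfderiv_leafMapChart hψ hPQ hγt hz h1 Y]
  have h2 := hasDerivAt_comp_curve (f := fun u => A.leafMapChart EN ψ z u Y)
    ((A.contMDiffAt_leafMapChart hψ hγt hz Y).mdifferentiableAt (by simp)) hγ
  rw [hX, constField_conn]
  exact h2

/-- As `leafMapChart` vanishes on `𝔭`, a complement of `𝔭` in `F` has the same image as `F`. -/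
lemma range_leafMapChart {z : N} {u : 𝒢} (hu : A.proj u ∈ U)
    (hz : ψ (A.proj u) ∈ (chartAt EN z).source) {F : Submodule ℝ 𝔤} {n : ℕ}
    {ι : (Fin n → ℝ) →ₗ[ℝ] 𝔤} (hι : ∀ c, ι c ∈ F) (hι' : ∀ Y ∈ F, ∃ c, Y - ι c ∈ 𝔯.𝔭) :
    F.map (A.leafMapChart EN ψ z u) = LinearMap.range (A.leafMapChart EN ψ z u ∘ₗ ι) := by
  refine le_antisymm ?_ ?_
  · rintro _ ⟨Y, hY, rfl⟩
    obtain ⟨c, hc⟩ := hι' Y hY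
    have h1 := A.leafMapChart_eq_zero hψ hPQ hu hz hc
    rw [map_sub, sub_eq_zero] at h1
    exact ⟨c, h1.symm⟩
  · rintro _ ⟨c, rfl⟩
    exact Submodule.mem_map_of_mem (hι c)

/-- If the bracket with `𝔭` and the curvature preserve `F`, then the image of `F` in `TN` is
locally constant along the fibres of `ψ ∘ p`. -/
lemma eventually_map_leafMap_eq [FiniteDimensional ℝ EN] {F : Submodule ℝ 𝔤} (hF : 𝔯.𝔭 ≤ F)
    (hlie : ∀ X ∈ 𝔯.𝔭, ∀ Y ∈ F, ⁅X, Y⁆ ∈ F)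
    (hκ : ∀ u, A.proj u ∈ U → ∀ X ∈ 𝔯.𝔭, ∀ Y ∈ F, A.curvature u X Y ∈ F)
    {u₀ : 𝒢} (hu₀ : A.proj u₀ ∈ U) :
    ∀ᶠ u in 𝓝 u₀, ψ (A.proj u) = ψ (A.proj u₀) →
      F.map (A.leafMap EN ψ u) = F.map (A.leafMap EN ψ u₀) := by
  obtain ⟨n, ι, hι0, hιF, hιF'⟩ := exists_complement_param hF
  set z := ψ (A.proj u₀) with hz
  let a : 𝒢 → (Fin n → ℝ) →L[ℝ] EN := fun u =>
    LinearMap.toContinuousLinearMap (A.leafMapChart EN ψ z u ∘ₗ ι)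
  have hzs : ψ (A.proj u₀) ∈ (chartAt EN z).source := mem_chart_source EN z
  have hzz : ∀ {y : M}, ψ y = z → ψ y ∈ (chartAt EN z).source := fun h => by
    rw [h]; exact mem_chart_source EN z
  have ha : ∀ u, A.proj u ∈ U → ψ (A.proj u) ∈ (chartAt EN z).source →
      ContMDiffAt 𝓘(ℝ, EP) 𝓘(ℝ, (Fin n → ℝ) →L[ℝ] EN) ∞ a u := fun u hu hz =>
    contMDiffAt_clm_of_apply fun v => A.contMDiffAt_leafMapChart hψ hu hz (ι v)
  -- a left inverse of `a u₀`
  have hinj : LinearMap.ker (A.leafMapChart EN ψ z u₀ ∘ₗ ι) = ⊥ := by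
    rw [LinearMap.ker_eq_bot']
    intro c hc
    rw [LinearMap.comp_apply, A.leafMapChart_self hψ hu₀ rfl,
      A.leafMap_eq_zero_iff hψ hPQ hu₀] at hc
    exact hι0 c hc
  obtain ⟨r₀, hr₀⟩ := LinearMap.exists_leftInverse_of_injective _ hinj
  let r : EN →L[ℝ] (Fin n → ℝ) := LinearMap.toContinuousLinearMap r₀
  have hr1 : r ∘L a u₀ = 1 := ContinuousLinearMap.ext fun c => congrArg (fun L => L c) hr₀
  have hev : ∀ᶠ u in 𝓝 u₀, IsUnit (r ∘L a u) := by
    have h1 : ContinuousAt (fun u => r ∘L a u) u₀ :=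
      ((ContinuousLinearMap.compL ℝ (Fin n → ℝ) EN (Fin n → ℝ) r).continuous.continuousAt).comp
        (ha u₀ hu₀ hzs).continuousAt
    refine h1.preimage_mem_nhds (Units.isOpen.mem_nhds ?_)
    rw [hr1]; exact isUnit_one
  obtain ⟨O, hO, hOopen, hu₀O⟩ := mem_nhds_iff.1
    (hev.and (A.eventually_leaf_mem_source hψ hu₀ hzs))
  have hcurve := eventually_exists_curve_in_fibre hOopen
    ((A.contMDiffOn_leaf hψ).mono fun u hu => (hO hu).2.1) hu₀O (A.mfderiv_leaf_surjective hψ hu₀)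
  filter_upwards [hcurve] with u hγ hu
  obtain ⟨γ, T, hT, hIT, hγs, hγ0, hγ1, hγf⟩ := hγ hu
  have hsub : ∀ t ∈ Icc (0 : ℝ) 1, A.proj (γ t) ∈ U ∧ ψ (A.proj (γ t)) = z ∧
      IsUnit (r ∘L a (γ t)) ∧ MDifferentiableAt 𝓘(ℝ, ℝ) 𝓘(ℝ, EP) γ t ∧
      ∀ᶠ s in 𝓝 t, ψ (A.proj (γ s)) = ψ (A.proj (γ t)) := by
    intro t ht
    have h1 := hγf t (hIT ht)
    refine ⟨(hO h1.1).2.1, h1.2, (hO h1.1).1,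
      (hγs.contMDiffAt (hT.mem_nhds (hIT ht))).mdifferentiableAt (by simp), ?_⟩
    filter_upwards [hT.mem_nhds (hIT ht)] with s hs
    exact (hγf s hs).2.trans h1.2.symm
  have key : range (a (γ 1)) = range (a (γ 0)) := by
    refine range_eq_of_hasDerivAt (A := fun t => a (γ t)) (A' := fun t =>
      mvfderiv 𝓘(ℝ, EP) a (γ t) (mfderiv 𝓘(ℝ, ℝ) 𝓘(ℝ, EP) γ t (1 : ℝ))) (r := r) ?_ ?_
      fun t ht => (hsub t ht).2.2.1
    · intro t ht
      obtain ⟨h1, h2, -, h4, -⟩ := hsub t ht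
      exact hasDerivAt_comp_curve ((ha _ h1 (hzz h2)).mdifferentiableAt (by simp)) h4
    · intro t ht c
      obtain ⟨h1, h2, -, h4, h5⟩ := hsub t ht
      have h6 := hasDerivAt_comp_curve ((ha _ h1 (hzz h2)).mdifferentiableAt (by simp)) h4
      have h7 := h6.clm_apply (hasDerivAt_const t c)
      rw [map_zero, add_zero] at h7
      have h8 := A.hasDerivAt_leafMapChart hψ hPQ h4 h1 h5 (z := z) (hzz h2) rfl (ι c)
      have h9 := h7.unique h8
      have hX := A.conn_velocity_mem_𝔭 hψ hPQ h4 h1 h5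
      have h10 := Submodule.mem_map_of_mem (f := A.leafMapChart EN ψ z (γ t))
        (F.sub_mem (hlie _ hX _ (hιF c)) (hκ _ h1 _ hX _ (hιF c)))
      rw [A.range_leafMapChart hψ hPQ h1 (hzz h2) hιF hιF'] at h10
      obtain ⟨c', hc'⟩ := h10
      exact ⟨c', h9.trans hc'.symm⟩
  have hfin : ∀ t ∈ Icc (0 : ℝ) 1,
      F.map (A.leafMap EN ψ (γ t)) = LinearMap.range (a (γ t)).toLinearMap := by
    intro t ht
    obtain ⟨h1, h2, -⟩ := hsub t ht
    rw [← A.leafMapChart_self hψ h1 h2, A.range_leafMapChart hψ hPQ h1 (hzz h2) hιF hιF']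
    rfl
  rw [← hγ1, ← hγ0, hfin 1 (by simp), hfin 0 (by simp)]
  exact SetLike.coe_injective key

/-- Conversely, if the image of `F` in `TN` is constant along the fibres of `ψ ∘ p`, then the
curvature preserves `F`. -/
lemma curvature_mem_of_map_leafMap_eq [FiniteDimensional ℝ EN] {F : Submodule ℝ 𝔤}
    (hF : 𝔯.𝔭 ≤ F) (hlie : ∀ X ∈ 𝔯.𝔭, ∀ Y ∈ F, ⁅X, Y⁆ ∈ F) {u₀ : 𝒢} (hu₀ : A.proj u₀ ∈ U)
    (h : ∀ u, A.proj u ∈ U → ψ (A.proj u) = ψ (A.proj u₀) →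
      F.map (A.leafMap EN ψ u) = F.map (A.leafMap EN ψ u₀))
    {X Y : 𝔤} (hX : X ∈ 𝔯.𝔭) (hY : Y ∈ F) : A.curvature u₀ X Y ∈ F := by
  set z := ψ (A.proj u₀) with hz
  have hzs : ψ (A.proj u₀) ∈ (chartAt EN z).source := mem_chart_source EN z
  have hX' : mfderiv 𝓘(ℝ, EP) 𝓘(ℝ, EN) (fun u => ψ (A.proj u)) u₀ (A.constField X u₀) = 0 :=
    (A.leafMap_eq_zero_iff hψ hPQ hu₀).2 hX
  obtain ⟨γ, hγ, rfl, hγX, hγf⟩ := exists_curve_in_fibre_of_ker (A.isOpen_preimage_proj hψ)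
    (A.contMDiffOn_leaf hψ) hu₀ (A.mfderiv_leaf_surjective hψ hu₀) hX'
  have hγd : MDifferentiableAt 𝓘(ℝ, ℝ) 𝓘(ℝ, EP) γ 0 := hγ.mdifferentiableAt (by simp)
  have hXc : X = A.conn (γ 0) (mfderiv 𝓘(ℝ, ℝ) 𝓘(ℝ, EP) γ 0 (1 : ℝ)) := by
    rw [← A.conn_constField X (γ 0)]
    exact A.conn_congr rfl hγX.symm
  have h1 := A.hasDerivAt_leafMapChart hψ hPQ hγd hu₀ (hγf.mono fun t ht => ht.2) (z := z) hzs hXc Y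
  let S : Submodule ℝ EN := F.map (A.leafMap EN ψ (γ 0))
  have hS : IsClosed (S : Set EN) := S.closed_of_finiteDimensional
  have h2 : ∀ᶠ t in 𝓝 (0 : ℝ), A.leafMapChart EN ψ z (γ t) Y ∈ S := by
    filter_upwards [hγf] with t ht
    rw [A.leafMapChart_self hψ ht.1 ht.2]
    change _ ∈ F.map (A.leafMap EN ψ (γ 0))
    rw [← h _ ht.1 ht.2]
    exact Submodule.mem_map_of_mem hY
  -- the derivative of a curve in the closed subspace `S` lies in `S`
  have h3 : A.leafMapChart EN ψ z (γ 0) (⁅X, Y⁆ - A.curvature (γ 0) X Y) ∈ S := by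
    have h4 := hasDerivAt_iff_tendsto_slope.1 h1
    refine hS.mem_of_tendsto h4 ?_
    filter_upwards [nhdsWithin_le_nhds h2] with t ht
    exact S.smul_mem _ (S.sub_mem ht h2.self_of_nhds)
  rw [A.leafMapChart_self hψ hu₀ rfl] at h3
  obtain ⟨W, hW, hWX⟩ := h3
  have h5 : (⁅X, Y⁆ - A.curvature (γ 0) X Y) - W ∈ F := by
    refine hF ((A.leafMap_eq_zero_iff hψ hPQ hu₀).1 ?_)
    rw [map_sub, hWX, sub_self]
  have h6 := F.sub_mem (F.sub_mem (hlie X hX Y hY) h5) hW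
  have h7 : ⁅X, Y⁆ - (⁅X, Y⁆ - A.curvature (γ 0) X Y - W) - W = A.curvature (γ 0) X Y := by abel
  rwa [h7] at h6

end

end CartanGeometry

end Leaves

/-! ### The subbundles of `TN` -/

section Leaves

variable {EG : Type*} [NormedAddCommGroup EG] [NormedSpace ℝ EG] [FiniteDimensional ℝ EG]
  {G : Type*} [TopologicalSpace G] [ChartedSpace EG G] [Group G] [LieGroup 𝓘(ℝ, EG) ∞ G]
  {𝔤 : Type*} [LieRing 𝔤] [LieAlgebra ℝ 𝔤]
  {EQ : Type*} [NormedAddCommGroup EQ] [NormedSpace ℝ EQ]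
  {EP : Type*} [NormedAddCommGroup EP] [NormedSpace ℝ EP]
  {EM : Type*} [NormedAddCommGroup EM] [NormedSpace ℝ EM]
  {EN : Type*} [NormedAddCommGroup EN] [NormedSpace ℝ EN]

namespace CartanGeometry

variable {e : 𝔤 ≃ₗ⁅ℝ⁆ GroupLieAlgebra 𝓘(ℝ, EG) G} {Q : Subgroup G} [ChartedSpace EQ Q]
  {𝒢 : Type*} [TopologicalSpace 𝒢] [ChartedSpace EP 𝒢] [IsManifold 𝓘(ℝ, EP) ∞ 𝒢]
  {M : Type*} [TopologicalSpace M] [ChartedSpace EM M] [IsManifold 𝓘(ℝ, EM) ∞ M]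
  {N : Type*} [TopologicalSpace N] [ChartedSpace EN N]
  (A : CartanGeometry (EQ := EQ) (EP := EP) (EM := EM) e Q 𝒢 M)
  {𝔯 : NestedParabolics 𝔤} {U : Set M} {ψ : M → N}

section

variable (hψ : IsLocalLeafSpace (EN := EN) (A.relTangent 𝔯) U ψ)
  {P : Subgroup G} (hPQ : IsParabolicPair (EQ := EQ) 𝔯 e P Q)
  [FiniteDimensional ℝ 𝔤] [LieAlgebra.IsSemisimple ℝ 𝔤]
include hψ hPQ

/-- The image of `T^i_P M` in `TN`, computed on `𝒢`. -/
lemma map_mfderiv_TP {i : ℤ} (hi : i ≤ 0) {u : 𝒢} (hu : A.proj u ∈ U) :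
    (A.TP 𝔯 i (A.proj u)).map (mfderiv 𝓘(ℝ, EM) 𝓘(ℝ, EN) ψ (A.proj u)).toLinearMap
      = (𝔯.fil i).map (A.leafMap EN ψ u) := by
  rw [A.TP_eq_map hPQ hi (u := u) rfl, ← Submodule.map_comp]
  congr 1
  exact LinearMap.ext fun X => (A.leafMap_eq hψ hu X).symm

variable [FiniteDimensional ℝ EP] [FiniteDimensional ℝ EM] [LieGroup 𝓘(ℝ, EQ) ∞ Q]
  [IsManifold 𝓘(ℝ, EN) ∞ N] [FiniteDimensional ℝ EN] [FiniteDimensional ℝ EQ]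

/-- If the torsion preserves `T^i_P M`, then the image of `T^i_P M` in `TN` is constant along the
leaves and defines a smooth subbundle. -/
theorem exists_subbundle (hconn : ∀ z : N, IsConnected (U ∩ ψ ⁻¹' {z})) {i : ℤ} (hi : i ≤ 0)
    (hτ : A.TorsionCond 𝔯 U i i) :
    ∃ K : ∀ z : N, Submodule ℝ (TangentSpace 𝓘(ℝ, EN) z),
      IsSmoothSubbundle K ∧ A.Corresponds 𝔯 U ψ i K := by
  have hκ := (A.torsionCond_iff hPQ hi hi).1 hτ
  have hlie : ∀ X ∈ 𝔯.𝔭, ∀ Y ∈ 𝔯.fil i, ⁅X, Y⁆ ∈ 𝔯.fil i := fun X hX Y hY => by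
    have := 𝔯.lie_mem_fil hX hY
    rwa [zero_add] at this
  let S : M → Submodule ℝ EN := fun y =>
    (A.TP 𝔯 i y).map (mfderiv 𝓘(ℝ, EM) 𝓘(ℝ, EN) ψ y).toLinearMap
  have hS : ∀ u, A.proj u ∈ U → S (A.proj u) = (𝔯.fil i).map (A.leafMap EN ψ u) := fun u hu =>
    A.map_mfderiv_TP hψ hPQ hi hu
  have hconst : ∀ x ∈ U, ∀ y ∈ U, ψ x = ψ y → S x = S y := by
    intro x hx y hy
    refine A.eq_of_leaf_eq hconn (fun u₀ hu₀ => ?_) hx hy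
    filter_upwards [A.eventually_map_leafMap_eq hψ hPQ (𝔯.𝔭_le_fil hi) hlie hκ hu₀,
      (A.isOpen_preimage_proj hψ).mem_nhds hu₀] with u h1 h2 h3
    rw [hS u h2, hS u₀ hu₀, h1 h3]
  have hsurj : ∀ z : N, ∃ u : 𝒢, A.proj u ∈ U ∧ ψ (A.proj u) = z := by
    intro z
    obtain ⟨y, hy, rfl⟩ : z ∈ ψ '' U := by rw [hψ.surjective]; trivial
    obtain ⟨u, rfl⟩ := A.proj_surjective y
    exact ⟨u, hy, rfl⟩
  choose pt hptU hptz using hsurj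
  let K : ∀ z : N, Submodule ℝ (TangentSpace 𝓘(ℝ, EN) z) := fun z => S (A.proj (pt z))
  have hK : ∀ u z, A.proj u ∈ U → ψ (A.proj u) = z → K z = (𝔯.fil i).map (A.leafMap EN ψ u) := by
    intro u z hu huz
    rw [← hS u hu]
    exact hconst _ (hptU z) _ hu ((hptz z).trans huz.symm)
  refine ⟨K, ?_, ?_⟩
  · intro z₀
    obtain ⟨n, ι, hι0, hιF, hιF'⟩ := exists_complement_param (𝔯.𝔭_le_fil hi)
    obtain ⟨O, σ, hO, hzO, -, hσs, hσ⟩ := exists_local_section (A.isOpen_preimage_proj hψ)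
      (A.contMDiffOn_leaf hψ) (hptU z₀) (A.mfderiv_leaf_surjective hψ (hptU z₀))
    rw [hptz] at hzO
    refine ⟨O, hO, hzO, n, fun k z => A.leafMap EN ψ (σ z) (ι (Pi.single k 1)), ?_, ?_⟩
    · intro k z hz
      refine ContMDiffAt.contMDiffWithinAt ?_
      have h1 := (A.smoothAlongAt_constField (ι (Pi.single k 1)) (σ z)).map
        (A.contMDiffAt_leaf hψ (hσ z hz).1)
      have h2 := ContMDiffAt.comp (g := fun u => (⟨ψ (A.proj u),
        mfderiv 𝓘(ℝ, EP) 𝓘(ℝ, EN) (fun u => ψ (A.proj u)) u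
          (A.constField (ι (Pi.single k 1)) u)⟩ : TangentBundle 𝓘(ℝ, EN) N)) z h1
        (hσs.contMDiffAt (hO.mem_nhds hz))
      refine h2.congr_of_eventuallyEq ?_
      filter_upwards [hO.mem_nhds hz] with z' hz'
      have h3 : ∀ (x y : N) (v : EN), x = y →
          (⟨x, v⟩ : TangentBundle 𝓘(ℝ, EN) N) = ⟨y, v⟩ := by
        rintro _ _ v rfl; rfl
      exact h3 _ _ _ (hσ z' hz').2.symm
    · intro z hz
      obtain ⟨h1, h2⟩ := hσ z hz
      let L : (Fin n → ℝ) →ₗ[ℝ] EN := A.leafMap EN ψ (σ z) ∘ₗ ι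
      have hinj : LinearMap.ker L = ⊥ := by
        rw [LinearMap.ker_eq_bot']
        intro c hc
        exact hι0 c ((A.leafMap_eq_zero_iff hψ hPQ h1).1 hc)
      have hrange : K z = LinearMap.range L := by
        rw [hK _ z h1 h2, ← A.leafMapChart_self hψ h1 h2,
          A.range_leafMapChart hψ hPQ h1 (by rw [h2]; exact mem_chart_source EN z) hιF hιF']
        rw [A.leafMapChart_self hψ h1 h2]
      have hb : ∀ k, Pi.single k (1 : ℝ) = Pi.basisFun ℝ (Fin n) k := fun k => by simp
      have hfun : (fun k => L (Pi.single k 1)) = ⇑L ∘ ⇑(Pi.basisFun ℝ (Fin n)) :=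
        funext fun k => congrArg L (hb k)
      constructor
      · change LinearIndependent ℝ (fun k => L (Pi.single k 1))
        rw [hfun]
        exact (Pi.basisFun ℝ (Fin n)).linearIndependent.map' L hinj
      · rw [hrange]
        change Submodule.span ℝ (range fun k => L (Pi.single k 1)) = LinearMap.range L
        rw [hfun, range_comp, ← Submodule.map_span, (Pi.basisFun ℝ (Fin n)).span_eq,
          LinearMap.range_eq_map]
  · intro y hy
    exact hconst y hy _ (hptU _) (hptz _).symm

/-- If the image of `T^i_P M` in `TN` is well defined, then the torsion preserves `T^i_P M`. -/
theorem torsionCond_of_corresponds {i : ℤ} (hi : i ≤ 0)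
    {K : ∀ z : N, Submodule ℝ (TangentSpace 𝓘(ℝ, EN) z)} (hK : A.Corresponds 𝔯 U ψ i K) :
    A.TorsionCond 𝔯 U i i := by
  have hlie : ∀ X ∈ 𝔯.𝔭, ∀ Y ∈ 𝔯.fil i, ⁅X, Y⁆ ∈ 𝔯.fil i := fun X hX Y hY => by
    have := 𝔯.lie_mem_fil hX hY
    rwa [zero_add] at this
  rw [A.torsionCond_iff hPQ hi hi]
  intro u₀ hu₀ X hX Y hY
  refine A.curvature_mem_of_map_leafMap_eq hψ hPQ (𝔯.𝔭_le_fil hi) hlie hu₀ ?_ hX hY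
  have h1 : ∀ u, A.proj u ∈ U →
      ((𝔯.fil i).map (A.leafMap EN ψ u) : Submodule ℝ EN) = K (ψ (A.proj u)) := fun u hu =>
    (A.map_mfderiv_TP hψ hPQ hi hu).symm.trans (hK _ hu)
  intro u hu huz
  rw [h1 u hu, h1 u₀ hu₀, huz]

end

end CartanGeometry

end Leaves

/-! ### The induced isomorphism of bundles -/

lemma SubQuot.mk_eq_mk_iff {V : Type*} [AddCommGroup V] [Module ℝ V] {F F' : Submodule ℝ V}
    {v w : F} : SubQuot.mk F' v = SubQuot.mk F' w ↔ (v : V) - w ∈ F' :=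
  Submodule.Quotient.eq _

lemma SubQuot.mk_eq_zero_iff {V : Type*} [AddCommGroup V] [Module ℝ V] {F F' : Submodule ℝ V}
    {v : F} : SubQuot.mk F' v = 0 ↔ (v : V) ∈ F' :=
  Submodule.Quotient.mk_eq_zero _

lemma SubQuot.mk_surjective {V : Type*} [AddCommGroup V] [Module ℝ V] {F F' : Submodule ℝ V}
    (x : SubQuot F F') : ∃ v : F, SubQuot.mk F' v = x :=
  Submodule.Quotient.mk_surjective _ x

lemma totalSpace_mk_congr {EN : Type*} [NormedAddCommGroup EN] [NormedSpace ℝ EN] {N : Type*}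
    [TopologicalSpace N] [ChartedSpace EN N] {x y : N} (h : x = y) {v w : EN} (hvw : v = w) :
    (⟨x, v⟩ : TangentBundle 𝓘(ℝ, EN) N) = ⟨y, w⟩ := by
  subst h; subst hvw; rfl

section Leaves

variable {EG : Type*} [NormedAddCommGroup EG] [NormedSpace ℝ EG] [FiniteDimensional ℝ EG]
  {G : Type*} [TopologicalSpace G] [ChartedSpace EG G] [Group G] [LieGroup 𝓘(ℝ, EG) ∞ G]
  {𝔤 : Type*} [LieRing 𝔤] [LieAlgebra ℝ 𝔤]
  {EQ : Type*} [NormedAddCommGroup EQ] [NormedSpace ℝ EQ]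
  {EP : Type*} [NormedAddCommGroup EP] [NormedSpace ℝ EP]
  {EM : Type*} [NormedAddCommGroup EM] [NormedSpace ℝ EM]
  {EN : Type*} [NormedAddCommGroup EN] [NormedSpace ℝ EN]
  {EY : Type*} [NormedAddCommGroup EY] [NormedSpace ℝ EY]
  {Y : Type*} [TopologicalSpace Y] [ChartedSpace EY Y]

namespace CartanGeometry

variable {e : 𝔤 ≃ₗ⁅ℝ⁆ GroupLieAlgebra 𝓘(ℝ, EG) G} {Q : Subgroup G} [ChartedSpace EQ Q]
  {𝒢 : Type*} [TopologicalSpace 𝒢] [ChartedSpace EP 𝒢] [IsManifold 𝓘(ℝ, EP) ∞ 𝒢]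
  {M : Type*} [TopologicalSpace M] [ChartedSpace EM M] [IsManifold 𝓘(ℝ, EM) ∞ M]
  {N : Type*} [TopologicalSpace N] [ChartedSpace EN N]
  (A : CartanGeometry (EQ := EQ) (EP := EP) (EM := EM) e Q 𝒢 M)
  {𝔯 : NestedParabolics 𝔤} {U : Set M} {ψ : M → N}

/-- `ω⁻¹` of a smooth function along a smooth map is a smooth vector field along that map. -/
lemma smoothAlongAt_constField_comp [FiniteDimensional ℝ 𝔤] [FiniteDimensional ℝ EP] {n : ℕ}
    (ι : (Fin n → ℝ) →ₗ[ℝ] 𝔤) {s : Y → 𝒢} {c : Y → Fin n → ℝ} {y₀ : Y}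
    (hs : ContMDiffAt 𝓘(ℝ, EY) 𝓘(ℝ, EP) ∞ s y₀)
    (hc : ContMDiffAt 𝓘(ℝ, EY) 𝓘(ℝ, Fin n → ℝ) ∞ c y₀) :
    SmoothAlongAt (EY := EY) s (fun y => A.constField (ι (c y)) (s y)) y₀ := by
  have h1 : ∀ X, SmoothAlongAt (EY := EY) s (fun y => A.constField X (s y)) y₀ := fun X =>
    ContMDiffAt.comp (g := fun u => (⟨u, A.constField X u⟩ : TangentBundle 𝓘(ℝ, EP) 𝒢)) y₀
      (A.smoothAlongAt_constField X (s y₀)) hs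
  rw [smoothAlongAt_iff]
  refine ⟨hs, ?_⟩
  let L : Y → 𝔤 →ₗ[ℝ] EP := fun y =>
    (mvfderiv 𝓘(ℝ, EP) (extChartAt 𝓘(ℝ, EP) (s y₀)) (s y)).toLinearMap ∘ₗ
      (A.conn (s y)).symm.toLinearMap
  have h2 : ContMDiffAt 𝓘(ℝ, EY) 𝓘(ℝ, (Fin n → ℝ) →L[ℝ] EP) ∞
      (fun y => LinearMap.toContinuousLinearMap (L y ∘ₗ ι)) y₀ :=
    contMDiffAt_clm_of_apply fun v => (smoothAlongAt_iff.1 (h1 (ι v))).2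
  exact h2.clm_apply hc

lemma toTangent_mem_TP {i : ℤ} {x : M} {u : 𝒢} (h : A.proj u = x) {X : 𝔤} (hX : X ∈ 𝔯.fil i) :
    A.toTangent u h X ∈ A.TP 𝔯 i x :=
  A.map_fil_le 𝔯 i u h (Submodule.mem_map_of_mem hX)

lemma TP_antitone {i j : ℤ} (hij : i ≤ j) (x : M) : A.TP 𝔯 j x ≤ A.TP 𝔯 i x :=
  iSup₂_mono fun _ _ => Submodule.map_mono (𝔯.fil_antitone hij)

section

variable (hψ : IsLocalLeafSpace (EN := EN) (A.relTangent 𝔯) U ψ)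
include hψ

lemma mfderiv_toTangent {x : M} (hx : x ∈ U) {u : 𝒢} (h : A.proj u = x) (X : 𝔤) :
    (mfderiv 𝓘(ℝ, EM) 𝓘(ℝ, EN) ψ x (A.toTangent u h X) : EN) = A.leafMap EN ψ u X := by
  subst h
  exact (A.leafMap_eq hψ hx X).symm

lemma inducedMap_bijective {i : ℤ} (hi : i < 0)
    {K K' : ∀ z : N, Submodule ℝ (TangentSpace 𝓘(ℝ, EN) z)}
    (hK : A.Corresponds 𝔯 U ψ i K) (hK' : A.Corresponds 𝔯 U ψ (i + 1) K') {y : M} (hy : y ∈ U) :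
    Function.Bijective (A.inducedMap 𝔯 hK hK' y hy) := by
  constructor
  · rw [injective_iff_map_eq_zero]
    intro q hq
    obtain ⟨v, rfl⟩ := SubQuot.mk_surjective q
    have h1 : (mfderiv 𝓘(ℝ, EM) 𝓘(ℝ, EN) ψ y (v : TangentSpace 𝓘(ℝ, EM) y)) ∈ K' (ψ y) :=
      SubQuot.mk_eq_zero_iff.1 hq
    rw [← hK' y hy] at h1
    obtain ⟨w, hw, hwv⟩ := h1
    refine SubQuot.mk_eq_zero_iff.2 ?_
    have h2 : (v : TangentSpace 𝓘(ℝ, EM) y) - w ∈ A.relTangent 𝔯 y := by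
      rw [← hψ.ker_eq y hy, LinearMap.mem_ker, map_sub, hwv]
      exact sub_self _
    have h3 := add_mem (A.TP_antitone (by lia) y h2) hw
    rwa [sub_add_cancel] at h3
  · intro q
    obtain ⟨⟨v, hv⟩, rfl⟩ := SubQuot.mk_surjective q
    have h1 := hv
    rw [← hK y hy] at h1
    obtain ⟨w, hw, rfl⟩ := h1
    exact ⟨SubQuot.mk _ ⟨w, hw⟩, rfl⟩

variable {P : Subgroup G} (hPQ : IsParabolicPair (EQ := EQ) 𝔯 e P Q)
  [FiniteDimensional ℝ 𝔤] [LieAlgebra.IsSemisimple ℝ 𝔤]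
  [FiniteDimensional ℝ EP] [FiniteDimensional ℝ EM] [LieGroup 𝓘(ℝ, EQ) ∞ Q]
  [IsManifold 𝓘(ℝ, EN) ∞ N]
include hPQ

/-- The coefficients of a smooth section of the image of `T^i_P M` in `TN`, with respect to the
frame given by `leafMap` on a complement of `𝔭` in `𝔤^(i, *)`, are smooth. -/
lemma contMDiffAt_coeff {n : ℕ} {ι : (Fin n → ℝ) →ₗ[ℝ] 𝔤} (hι0 : ∀ c, ι c ∈ 𝔯.𝔭 → c = 0)
    [FiniteDimensional ℝ EN]
    {s : Y → 𝒢} {w : ∀ y, TangentSpace 𝓘(ℝ, EN) (ψ (A.proj (s y)))} {c : Y → Fin n → ℝ} {y₀ : Y}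
    (hs : ContMDiffAt 𝓘(ℝ, EY) 𝓘(ℝ, EP) ∞ s y₀)
    (hw : SmoothAlongAt (EY := EY) (fun y => ψ (A.proj (s y))) w y₀) (hU : A.proj (s y₀) ∈ U)
    (h : ∀ᶠ y in 𝓝 y₀, A.leafMap EN ψ (s y) (ι (c y)) = w y) :
    ContMDiffAt 𝓘(ℝ, EY) 𝓘(ℝ, Fin n → ℝ) ∞ c y₀ := by
  set z := ψ (A.proj (s y₀)) with hz
  have hzs : ψ (A.proj (s y₀)) ∈ (chartAt EN z).source := mem_chart_source EN z
  let a : 𝒢 → (Fin n → ℝ) →L[ℝ] EN := fun u =>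
    LinearMap.toContinuousLinearMap (A.leafMapChart EN ψ z u ∘ₗ ι)
  have ha : ContMDiffAt 𝓘(ℝ, EP) 𝓘(ℝ, (Fin n → ℝ) →L[ℝ] EN) ∞ a (s y₀) :=
    contMDiffAt_clm_of_apply fun v => A.contMDiffAt_leafMapChart hψ hU hzs (ι v)
  have hinj : LinearMap.ker (A.leafMapChart EN ψ z (s y₀) ∘ₗ ι) = ⊥ := by
    rw [LinearMap.ker_eq_bot']
    intro c hc
    rw [LinearMap.comp_apply, A.leafMapChart_self hψ hU rfl, A.leafMap_eq_zero_iff hψ hPQ hU] at hc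
    exact hι0 c hc
  obtain ⟨r₀, hr₀⟩ := LinearMap.exists_leftInverse_of_injective _ hinj
  let r : EN →L[ℝ] (Fin n → ℝ) := LinearMap.toContinuousLinearMap r₀
  have hra : ContMDiffAt 𝓘(ℝ, EY) 𝓘(ℝ, (Fin n → ℝ) →L[ℝ] (Fin n → ℝ)) ∞
      (fun y => r ∘L a (s y)) y₀ :=
    contMDiffAt_const.clm_comp (ha.comp y₀ hs)
  have hv : ContMDiffAt 𝓘(ℝ, EY) 𝓘(ℝ, EN) ∞
      (fun y => mvfderiv 𝓘(ℝ, EN) (extChartAt 𝓘(ℝ, EN) z) (ψ (A.proj (s y))) (w y)) y₀ :=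
    SmoothAlongAt.mvfderiv hw (contMDiffAt_extChartAt' hzs)
  have hrv := r.contDiff.contMDiff.contMDiffAt.comp y₀ hv
  refine contMDiffAt_of_solves hra hrv ?_ ?_
  · refine ⟨ContinuousLinearEquiv.refl ℝ _, ?_⟩
    exact ContinuousLinearMap.ext fun c => (congrArg (fun L => L c) hr₀).symm
  · filter_upwards [h, hs.continuousAt.eventually (A.eventually_leaf_mem_source hψ hU hzs)]
      with y hy hy'
    refine congrArg r ?_
    change A.leafMapChart EN ψ z (s y) (ι (c y)) = _
    rw [A.leafMapChart_eq hψ hy'.1 hy'.2]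
    exact congrArg _ hy

/-- The bundle map induced by `Tψ` is an isomorphism of smooth bundles. -/
theorem inducesIso [FiniteDimensional ℝ EN] {i : ℤ} (hi : i < 0)
    {K K' : ∀ z : N, Submodule ℝ (TangentSpace 𝓘(ℝ, EN) z)}
    (hK : A.Corresponds 𝔯 U ψ i K) (hK' : A.Corresponds 𝔯 U ψ (i + 1) K') :
    A.InducesIso 𝔯 hK hK' := by
  refine ⟨fun y hy => A.inducedMap_bijective hψ hi hK hK' hy, ?_⟩
  intro W hWU σ s hW hs
  constructor
  · intro hσ x₀ hx₀
    obtain ⟨W₀, hW₀, hx₀W, v, hv, hσv⟩ := hσ x₀ hx₀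
    classical
    refine ⟨W₀ ∩ W, hW₀.inter hW, ⟨hx₀W, hx₀⟩, fun x => if h : x ∈ U then
      ⟨mfderiv 𝓘(ℝ, EM) 𝓘(ℝ, EN) ψ x (v x),
        (hK x h).le (Submodule.mem_map_of_mem (v x).2)⟩ else 0, ?_, ?_⟩
    · intro x hx
      refine ContMDiffAt.contMDiffWithinAt ?_
      have h1 : SmoothAlongAt (EY := EM) (fun x : M => x)
          (fun x => (v x : TangentSpace 𝓘(ℝ, EM) x)) x := hv.contMDiffAt (hW₀.mem_nhds hx.1)
      have h2 := h1.map (hψ.smooth.contMDiffAt (hψ.isOpen.mem_nhds (hWU hx.2)))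
      refine h2.congr_of_eventuallyEq ?_
      filter_upwards [hW.mem_nhds hx.2] with x' hx'
      beta_reduce
      rw [dif_pos (hWU hx')]
    · rintro x ⟨hx, hxW⟩
      rw [hs x hxW, hσv x ⟨hx.1, hxW⟩]
      beta_reduce
      rw [dif_pos (hWU hxW)]
      rfl
  · intro hs' x₀ hx₀
    obtain ⟨W₀, hW₀, hx₀W, v, hv, hsv⟩ := hs' x₀ hx₀
    obtain ⟨u₀, rfl⟩ := A.proj_surjective x₀
    obtain ⟨Wp, t, hWp, hx₀p, -, ht, hpt⟩ := A.exists_local_section_proj u₀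
    obtain ⟨n, ι, hι0, hιF, hιF'⟩ := exists_complement_param (𝔯.𝔭_le_fil hi.le)
    let W₁ := W₀ ∩ W ∩ Wp
    have hW₁ : IsOpen W₁ := (hW₀.inter hW).inter hWp
    let v' : M → EN := fun x => (v x : TangentSpace 𝓘(ℝ, EN) (ψ x))
    have hex : ∀ x, ∃ c, x ∈ W₁ → A.leafMap EN ψ (t x) (ι c) = v' x := by
      intro x
      by_cases hx : x ∈ W₁
      · have hxU : A.proj (t x) ∈ U := (hpt x hx.2).symm ▸ hWU hx.1.2
        have h1 : v' x ∈ (𝔯.fil i).map (A.leafMap EN ψ (t x)) := by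
          rw [← A.map_mfderiv_TP hψ hPQ hi.le hxU, hpt x hx.2]
          exact (hK x (hWU hx.1.2)).ge (v x).2
        obtain ⟨Y, hY, hYv⟩ := h1
        obtain ⟨c, hc⟩ := hιF' Y hY
        rw [← A.leafMap_eq_zero_iff hψ hPQ hxU, map_sub, sub_eq_zero] at hc
        exact ⟨c, fun _ => hc.symm.trans hYv⟩
      · exact ⟨0, fun h => absurd h hx⟩
    choose c hc using hex
    have htx : ∀ x ∈ W₁, ContMDiffAt 𝓘(ℝ, EM) 𝓘(ℝ, EP) ∞ t x := fun x hx =>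
      ht.contMDiffAt (hWp.mem_nhds hx.2)
    have hcs : ∀ x ∈ W₁, ContMDiffAt 𝓘(ℝ, EM) 𝓘(ℝ, Fin n → ℝ) ∞ c x := by
      intro x hx
      have h1 : SmoothAlongAt (EY := EM) (EX := EN) (fun x => ψ (A.proj (t x)))
          v' x := by
        refine (hv.contMDiffAt (hW₀.mem_nhds hx.1.1)).congr_of_eventuallyEq ?_
        filter_upwards [hWp.mem_nhds hx.2] with x' hx'
        exact totalSpace_mk_congr (congrArg ψ (hpt x' hx')) rfl
      refine A.contMDiffAt_coeff hψ hPQ hι0 (htx x hx) h1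
        ((hpt x hx.2).symm ▸ hWU hx.1.2) ?_
      filter_upwards [hW₁.mem_nhds hx] with x' hx' using hc x' hx'
    classical
    refine ⟨W₁, hW₁, ⟨⟨hx₀W, hx₀⟩, hx₀p⟩, fun x => if h : x ∈ Wp then
      ⟨A.toTangent (t x) (hpt x h) (ι (c x)), A.toTangent_mem_TP _ (hιF _)⟩ else 0, ?_, ?_⟩
    · intro x hx
      refine ContMDiffAt.contMDiffWithinAt ?_
      have h2 := (A.smoothAlongAt_constField_comp ι (htx x hx) (hcs x hx)).map
        A.proj_smooth.contMDiffAt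
      refine h2.congr_of_eventuallyEq ?_
      filter_upwards [hWp.mem_nhds hx.2] with x' hx'
      beta_reduce
      rw [dif_pos hx']
      exact totalSpace_mk_congr (hpt x' hx').symm (A.toTangent_apply _ _ _)
    · rintro x ⟨hx, hxW⟩
      apply (A.inducedMap_bijective hψ hi hK hK' (hWU hxW)).1
      rw [← hs x hxW, hsv x ⟨hx.1.1, hxW⟩]
      beta_reduce
      rw [dif_pos hx.2]
      refine congrArg (SubQuot.mk (K' (ψ x))) (Subtype.ext ?_)
      exact (hc x hx).symm.trans (A.mfderiv_toTangent hψ (hWU hxW) (hpt x hx.2) _).symm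

end

end CartanGeometry

end Leaves

/-! ### The relative tractor connection in coefficients -/

/-- A curve whose velocity lies in a subspace stays in one coset of it. -/
lemma sub_mem_of_hasDerivAt {E : Type*} [NormedAddCommGroup E] [NormedSpace ℝ E]
    [FiniteDimensional ℝ E] {S : Submodule ℝ E} {f f' : ℝ → E}
    (h : ∀ t ∈ Icc (0 : ℝ) 1, HasDerivAt f (f' t) t) (h' : ∀ t ∈ Icc (0 : ℝ) 1, f' t ∈ S) :
    f 1 - f 0 ∈ S := by
  obtain ⟨C, hC⟩ := Submodule.exists_isCompl S
  let T : E →L[ℝ] C := LinearMap.toContinuousLinearMap (Submodule.projectionOnto C S hC.symm)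
  have hT : ∀ x, T x = 0 ↔ x ∈ S := fun x => Submodule.projectionOnto_apply_eq_zero_iff _
  have h1 : ∀ t ∈ Icc (0 : ℝ) 1, HasDerivAt (fun t => T (f t)) 0 t := fun t ht => by
    have h2 := T.hasFDerivAt.comp_hasDerivAt t (h t ht)
    rwa [(hT _).2 (h' t ht)] at h2
  have h2 := constant_of_has_deriv_right_zero (f := fun t => T (f t)) (a := 0) (b := 1)
    (fun t ht => (h1 t ht).continuousAt.continuousWithinAt)
    (fun t ht => (h1 t (Ico_subset_Icc_self ht)).hasDerivWithinAt) 1 (by simp)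
  rw [← hT, map_sub, h2, sub_self]

/-- The velocity of a curve that stays in one coset of a subspace lies in this subspace. -/
lemma mem_of_hasDerivAt {E : Type*} [NormedAddCommGroup E] [NormedSpace ℝ E]
    [FiniteDimensional ℝ E] {S : Submodule ℝ E} {f : ℝ → E} {f' : E} {t₀ : ℝ}
    (h : HasDerivAt f f' t₀) (h' : ∀ᶠ t in 𝓝 t₀, f t - f t₀ ∈ S) : f' ∈ S := by
  have hS : IsClosed (S : Set E) := S.closed_of_finiteDimensional
  refine hS.mem_of_tendsto (hasDerivAt_iff_tendsto_slope.1 h) ?_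
  filter_upwards [nhdsWithin_le_nhds h'] with t ht
  exact S.smul_mem _ ht

section Leaves

variable {EG : Type*} [NormedAddCommGroup EG] [NormedSpace ℝ EG] [FiniteDimensional ℝ EG]
  {G : Type*} [TopologicalSpace G] [ChartedSpace EG G] [Group G] [LieGroup 𝓘(ℝ, EG) ∞ G]
  {𝔤 : Type*} [LieRing 𝔤] [LieAlgebra ℝ 𝔤]
  {EQ : Type*} [NormedAddCommGroup EQ] [NormedSpace ℝ EQ]
  {EP : Type*} [NormedAddCommGroup EP] [NormedSpace ℝ EP]
  {EM : Type*} [NormedAddCommGroup EM] [NormedSpace ℝ EM]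
  {EN : Type*} [NormedAddCommGroup EN] [NormedSpace ℝ EN]

namespace CartanGeometry

variable {e : 𝔤 ≃ₗ⁅ℝ⁆ GroupLieAlgebra 𝓘(ℝ, EG) G} {Q : Subgroup G} [ChartedSpace EQ Q]
  {𝒢 : Type*} [TopologicalSpace 𝒢] [ChartedSpace EP 𝒢] [IsManifold 𝓘(ℝ, EP) ∞ 𝒢]
  {M : Type*} [TopologicalSpace M] [ChartedSpace EM M] [IsManifold 𝓘(ℝ, EM) ∞ M]
  {N : Type*} [TopologicalSpace N] [ChartedSpace EN N]
  (A : CartanGeometry (EQ := EQ) (EP := EP) (EM := EM) e Q 𝒢 M)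
  {𝔯 : NestedParabolics 𝔤} {U : Set M} {ψ : M → N}

/-- The directional derivative of a linear image of a vector-valued function. -/
lemma dirDeriv_eq {V : Type*} [AddCommGroup V] [Module ℝ V] [FiniteDimensional ℝ V] {n : ℕ}
    (L : (Fin n → ℝ) →ₗ[ℝ] V) {f : 𝒢 → V} {c : 𝒢 → Fin n → ℝ} {u : 𝒢}
    (hc : MDifferentiableAt 𝓘(ℝ, EP) 𝓘(ℝ, Fin n → ℝ) c u) (h : ∀ᶠ u' in 𝓝 u, f u' = L (c u'))
    (w : TangentSpace 𝓘(ℝ, EP) u) :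
    dirDeriv (EP := EP) f u w = L (mvfderiv 𝓘(ℝ, EP) c u w) := by
  have h1 : ∀ k, (mfderiv 𝓘(ℝ, EP) 𝓘(ℝ, ℝ)
      (fun u' => (Module.finBasis ℝ V).repr (f u') k) u w : ℝ)
      = (Module.finBasis ℝ V).repr (L (mvfderiv 𝓘(ℝ, EP) c u w)) k := by
    intro k
    let ℓ : (Fin n → ℝ) →L[ℝ] ℝ :=
      LinearMap.toContinuousLinearMap ((Module.finBasis ℝ V).coord k ∘ₗ L)
    have h2 : (fun u' => (Module.finBasis ℝ V).repr (f u') k) =ᶠ[𝓝 u] ℓ ∘ c := by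
      filter_upwards [h] with u' hu'
      rw [hu']; rfl
    have h3 := mfderiv_comp_apply (I := 𝓘(ℝ, EP)) (I' := 𝓘(ℝ, Fin n → ℝ)) (I'' := 𝓘(ℝ, ℝ))
      (g := ℓ) (f := c) u ℓ.differentiableAt.mdifferentiableAt hc w
    rw [← h2.mfderiv_eq] at h3
    refine h3.trans ?_
    rw [mfderiv_eq_fderiv, ℓ.fderiv]
    rfl
  rw [dirDeriv]
  refine Eq.trans ?_ ((Module.finBasis ℝ V).sum_repr (L (mvfderiv 𝓘(ℝ, EP) c u w)))
  exact Finset.sum_congr rfl fun k _ => congrArg (fun r : ℝ => r • Module.finBasis ℝ V k) (h1 k)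

section

variable {P : Subgroup G} (hPQ : IsParabolicPair (EQ := EQ) 𝔯 e P Q)
  [FiniteDimensional ℝ 𝔤] [LieAlgebra.IsSemisimple ℝ 𝔤]
  [FiniteDimensional ℝ EP] [FiniteDimensional ℝ EM] [LieGroup 𝓘(ℝ, EQ) ∞ Q]
include hPQ

lemma frame_injective {i : ℤ} (hi : i < 0) (u : 𝒢) : Function.Injective (A.frame 𝔯 i u) := by
  rw [injective_iff_map_eq_zero]
  intro q hq
  obtain ⟨Y, rfl⟩ := SubQuot.mk_surjective q
  have h1 : A.toTangent u rfl (Y : 𝔤) ∈ A.TP 𝔯 (i + 1) (A.proj u) := SubQuot.mk_eq_zero_iff.1 hq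
  exact SubQuot.mk_eq_zero_iff.2 ((A.toTangent_mem_TP_iff hPQ (by lia) rfl).1 h1)

/-- The vanishing of the relative tractor connection in terms of coefficients `c` of a section. -/
lemma relTractorConnection_eq_zero_iff {i : ℤ} (hi : i < 0) {n : ℕ}
    {ι : (Fin n → ℝ) →ₗ[ℝ] 𝔤} (hι : ∀ c, ι c ∈ 𝔯.fil i) {σ : ∀ x : M, A.𝒱 𝔯 i x}
    {c : 𝒢 → Fin n → ℝ} {u : 𝒢} (hc : MDifferentiableAt 𝓘(ℝ, EP) 𝓘(ℝ, Fin n → ℝ) c u)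
    (h : ∀ᶠ u' in 𝓝 u, A.frame 𝔯 i u' (SubQuot.mk _ ⟨ι (c u'), hι _⟩) = σ (A.proj u'))
    (w : TangentSpace 𝓘(ℝ, EP) u) (hw : A.conn u w ∈ 𝔯.𝔭) :
    A.relTractorConnection 𝔯 i σ u w hw = 0 ↔
      ι (mvfderiv 𝓘(ℝ, EP) c u w) + ⁅A.conn u w, ι (c u)⁆ ∈ 𝔯.fil (i + 1) := by
  let L : (Fin n → ℝ) →ₗ[ℝ] 𝔯.𝕍 i := Submodule.mkQ _ ∘ₗ ι.codRestrict (𝔯.fil i) hι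
  have h1 : ∀ᶠ u' in 𝓝 u, A.equivariantFunction 𝔯 i σ u' = L (c u') := by
    filter_upwards [h] with u' hu'
    rw [equivariantFunction, ← hu']
    exact Function.leftInverse_invFun (A.frame_injective hPQ hi u') _
  rw [relTractorConnection, map_eq_zero_iff _ (A.frame_injective hPQ hi u),
    dirDeriv_eq L hc h1 w, h1.self_of_nhds]
  exact SubQuot.mk_eq_zero_iff (v := ι.codRestrict (𝔯.fil i) hι (mvfderiv 𝓘(ℝ, EP) c u w) +
    ⟨⁅A.conn u w, ι (c u)⁆, by simpa using 𝔯.lie_mem_fil hw (hι (c u))⟩)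

variable (hψ : IsLocalLeafSpace (EN := EN) (A.relTangent 𝔯) U ψ)
  [IsManifold 𝓘(ℝ, EN) ∞ N]
include hψ

/-- A smooth section of `𝒱_i M` has local smooth coefficients on `𝒢`. -/
lemma exists_coeff [FiniteDimensional ℝ EN] {i : ℤ} (hi : i < 0) {n : ℕ} {ι : (Fin n → ℝ) →ₗ[ℝ] 𝔤}
    (hι0 : ∀ c, ι c ∈ 𝔯.𝔭 → c = 0) (hι : ∀ c, ι c ∈ 𝔯.fil i)
    (hι' : ∀ Y ∈ 𝔯.fil i, ∃ c, Y - ι c ∈ 𝔯.𝔭) {σ : ∀ x : M, A.𝒱 𝔯 i x}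
    (hσ : IsSmoothSection (A.TP 𝔯 i) (A.TP 𝔯 (i + 1)) U σ) {u₀ : 𝒢} (hu₀ : A.proj u₀ ∈ U) :
    ∃ (O : Set 𝒢) (c : 𝒢 → Fin n → ℝ), IsOpen O ∧ u₀ ∈ O ∧ O ⊆ A.proj ⁻¹' U ∧
      (∀ u ∈ O, ContMDiffAt 𝓘(ℝ, EP) 𝓘(ℝ, Fin n → ℝ) ∞ c u) ∧
      ∀ u ∈ O, A.frame 𝔯 i u (SubQuot.mk _ ⟨ι (c u), hι _⟩) = σ (A.proj u) := by
  obtain ⟨W, hW, hu₀W, v, hv, hσv⟩ := hσ _ hu₀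
  have hex : ∀ u, ∃ c, toTangent A u rfl (ι c) - (v (A.proj u) : TangentSpace 𝓘(ℝ, EM) _)
      ∈ A.relTangent 𝔯 (A.proj u) := by
    intro u
    have h1 : (v (A.proj u) : TangentSpace 𝓘(ℝ, EM) _) ∈ A.TP 𝔯 i (A.proj u) := (v (A.proj u)).2
    obtain ⟨Y, hY, hYv⟩ := (A.TP_eq_map hPQ hi.le (u := u) rfl).le h1
    obtain ⟨c, hc⟩ := hι' Y hY
    refine ⟨c, ?_⟩
    rw [← hYv, ← map_sub, ← neg_sub, map_neg]
    exact neg_mem (A.toTangent_mem_TP rfl hc)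
  choose c hc using hex
  have hO : IsOpen (A.proj ⁻¹' (W ∩ U)) := (hW.inter hψ.isOpen).preimage A.proj_smooth.continuous
  refine ⟨_, c, hO, ⟨hu₀W, hu₀⟩, fun u hu => hu.2, fun u hu => ?_, fun u hu => ?_⟩
  · have h1 : SmoothAlongAt (EY := EM) (fun x : M => x)
        (fun x => (v x : TangentSpace 𝓘(ℝ, EM) x)) (A.proj u) := hv.contMDiffAt (hW.mem_nhds hu.1)
    have h2 := h1.map (hψ.smooth.contMDiffAt (hψ.isOpen.mem_nhds hu.2))
    have h3 := ContMDiffAt.comp (g := fun x => (⟨ψ x, mfderiv 𝓘(ℝ, EM) 𝓘(ℝ, EN) ψ x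
      (v x : TangentSpace 𝓘(ℝ, EM) x)⟩ : TangentBundle 𝓘(ℝ, EN) N)) u h2
      A.proj_smooth.contMDiffAt
    refine A.contMDiffAt_coeff hψ hPQ hι0 (s := fun u => u) (w := fun u =>
      mfderiv 𝓘(ℝ, EM) 𝓘(ℝ, EN) ψ (A.proj u) (v (A.proj u) : TangentSpace 𝓘(ℝ, EM) (A.proj u)))
      contMDiffAt_id h3 hu.2 ?_
    filter_upwards [hO.mem_nhds hu] with u' hu'
    have h4 := hc u'
    rw [← hψ.ker_eq _ hu'.2, LinearMap.mem_ker, map_sub, sub_eq_zero] at h4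
    exact (A.leafMap_eq hψ hu'.2 _).trans h4
  · rw [hσv _ hu]
    exact SubQuot.mk_eq_mk_iff.2 (A.TP_antitone (by lia) _ (hc u))

/-- The derivative along a curve in a leaf of the image in `TN` of a vector field on `𝒢`. -/
lemma hasDerivAt_leafMapChart_coeff {z : N} {n : ℕ} (ι : (Fin n → ℝ) →ₗ[ℝ] 𝔤)
    {c : 𝒢 → Fin n → ℝ} {γ : ℝ → 𝒢} {t : ℝ}
    (hγ : MDifferentiableAt 𝓘(ℝ, ℝ) 𝓘(ℝ, EP) γ t) (hγt : A.proj (γ t) ∈ U)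
    (hfib : ∀ᶠ s in 𝓝 t, ψ (A.proj (γ s)) = ψ (A.proj (γ t)))
    (hz : ψ (A.proj (γ t)) ∈ (chartAt EN z).source)
    (hc : MDifferentiableAt 𝓘(ℝ, EP) 𝓘(ℝ, Fin n → ℝ) c (γ t)) {w : TangentSpace 𝓘(ℝ, EP) (γ t)}
    (hw : mfderiv 𝓘(ℝ, ℝ) 𝓘(ℝ, EP) γ t (1 : ℝ) = w) :
    HasDerivAt (fun t => A.leafMapChart EN ψ z (γ t) (ι (c (γ t))))
      (A.leafMapChart EN ψ z (γ t) (ι (mvfderiv 𝓘(ℝ, EP) c (γ t) w)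
        + ⁅A.conn (γ t) w, ι (c (γ t))⁆ - A.curvature (γ t) (A.conn (γ t) w) (ι (c (γ t))))) t := by
  subst hw
  let a : 𝒢 → (Fin n → ℝ) →L[ℝ] EN := fun u =>
    LinearMap.toContinuousLinearMap (A.leafMapChart EN ψ z u ∘ₗ ι)
  have ha : ContMDiffAt 𝓘(ℝ, EP) 𝓘(ℝ, (Fin n → ℝ) →L[ℝ] EN) ∞ a (γ t) :=
    contMDiffAt_clm_of_apply fun v => A.contMDiffAt_leafMapChart hψ hγt hz (ι v)
  have h1 := hasDerivAt_comp_curve (ha.mdifferentiableAt (by simp)) hγ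
  have h2 := h1.clm_apply (hasDerivAt_const t (c (γ t)))
  rw [map_zero, add_zero] at h2
  have h3 := h2.unique (A.hasDerivAt_leafMapChart hψ hPQ hγ hγt hfib hz rfl (ι (c (γ t))))
  have h4 := h1.clm_apply (hasDerivAt_comp_curve hc hγ)
  rw [h3] at h4
  rw [add_sub_assoc, map_add, add_comm]
  exact h4

end

end CartanGeometry

end Leaves

/-! ### Parallel sections -/

lemma SubQuot.mk_eq_of_eq {E : Type*} [NormedAddCommGroup E] [NormedSpace ℝ E] {N : Type*}
    [TopologicalSpace N] [ChartedSpace E N] {K K' : ∀ z : N, Submodule ℝ (TangentSpace 𝓘(ℝ, E) z)}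
    {s : ∀ z, SubQuot (K z) (K' z)} {z z' : N} (h : z' = z) {v : E} (hv : v ∈ K z')
    (hs : s z' = SubQuot.mk (K' z') ⟨v, hv⟩) :
    ∃ hv' : v ∈ K z, s z = SubQuot.mk (K' z) ⟨v, hv'⟩ := by
  subst h; exact ⟨hv, hs⟩

section Leaves

variable {EG : Type*} [NormedAddCommGroup EG] [NormedSpace ℝ EG] [FiniteDimensional ℝ EG]
  {G : Type*} [TopologicalSpace G] [ChartedSpace EG G] [Group G] [LieGroup 𝓘(ℝ, EG) ∞ G]
  {𝔤 : Type*} [LieRing 𝔤] [LieAlgebra ℝ 𝔤]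
  {EQ : Type*} [NormedAddCommGroup EQ] [NormedSpace ℝ EQ]
  {EP : Type*} [NormedAddCommGroup EP] [NormedSpace ℝ EP]
  {EM : Type*} [NormedAddCommGroup EM] [NormedSpace ℝ EM]
  {EN : Type*} [NormedAddCommGroup EN] [NormedSpace ℝ EN]

namespace CartanGeometry

variable {e : 𝔤 ≃ₗ⁅ℝ⁆ GroupLieAlgebra 𝓘(ℝ, EG) G} {Q : Subgroup G} [ChartedSpace EQ Q]
  {𝒢 : Type*} [TopologicalSpace 𝒢] [ChartedSpace EP 𝒢] [IsManifold 𝓘(ℝ, EP) ∞ 𝒢]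
  {M : Type*} [TopologicalSpace M] [ChartedSpace EM M] [IsManifold 𝓘(ℝ, EM) ∞ M]
  {N : Type*} [TopologicalSpace N] [ChartedSpace EN N]
  (A : CartanGeometry (EQ := EQ) (EP := EP) (EM := EM) e Q 𝒢 M)
  {𝔯 : NestedParabolics 𝔤} {U : Set M} {ψ : M → N} {i : ℤ}
  {K K' : ∀ z : N, Submodule ℝ (TangentSpace 𝓘(ℝ, EN) z)}

section

variable (hK : A.Corresponds 𝔯 U ψ i K) (hK' : A.Corresponds 𝔯 U ψ (i + 1) K')

/-- The coset of `K' (ψ x)` in the tangent space of `N` at `ψ x` that is the image of `σ x`, as a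
subset of the model space of `N`; in this form the values at different points of a fibre of `ψ`
can be compared. -/
def imageCoset (σ : ∀ x : M, A.𝒱 𝔯 i x) (x : M) : Set EN :=
  {v | ∃ (hx : x ∈ U) (hv : v ∈ K (ψ x)),
    A.inducedMap 𝔯 hK hK' x hx (σ x) = SubQuot.mk (K' (ψ x)) ⟨v, hv⟩}

lemma imageCoset_eq_of_pullback {σ : ∀ x : M, A.𝒱 𝔯 i x} {s : ∀ z : N, SubQuot (K z) (K' z)}
    (hs : ∀ (y : M) (hy : y ∈ U), A.inducedMap 𝔯 hK hK' y hy (σ y) = s (ψ y)) {x y : M}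
    (hx : x ∈ U) (hy : y ∈ U) (hxy : ψ x = ψ y) :
    A.imageCoset hK hK' σ x = A.imageCoset hK hK' σ y := by
  have h : ∀ x ∈ U, A.imageCoset hK hK' σ x
      = {v : EN | ∃ hv : v ∈ K (ψ x), s (ψ x) = SubQuot.mk (K' (ψ x)) ⟨v, hv⟩} := by
    intro x hx
    ext v
    exact ⟨fun ⟨_, hv, h⟩ => ⟨hv, (hs x hx).symm.trans h⟩,
      fun ⟨hv, h⟩ => ⟨hx, hv, (hs x hx).trans h⟩⟩
  rw [h x hx, h y hy, hxy]

variable (hψ : IsLocalLeafSpace (EN := EN) (A.relTangent 𝔯) U ψ)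
include hψ

/-- If `[u, Y]` represents `σ`, then the image of `σ` is the coset of `leafMap u Y`. -/
lemma mem_imageCoset_iff {σ : ∀ x : M, A.𝒱 𝔯 i x} {u : 𝒢} (hu : A.proj u ∈ U) {Y : 𝔤}
    (hY : Y ∈ 𝔯.fil i) (h : A.frame 𝔯 i u (SubQuot.mk _ ⟨Y, hY⟩) = σ (A.proj u)) {v : EN} :
    v ∈ A.imageCoset hK hK' σ (A.proj u) ↔
      A.leafMap EN ψ u Y - v ∈ (K' (ψ (A.proj u)) : Submodule ℝ EN) := by
  have h1 : (A.leafMap EN ψ u Y : EN) ∈ K (ψ (A.proj u)) := by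
    rw [A.leafMap_eq hψ hu]
    exact (hK _ hu).le (Submodule.mem_map_of_mem (A.toTangent_mem_TP rfl hY))
  have h2 : A.inducedMap 𝔯 hK hK' _ hu (σ (A.proj u))
      = SubQuot.mk (K' (ψ (A.proj u))) ⟨A.leafMap EN ψ u Y, h1⟩ := by
    rw [← h]
    exact congrArg (SubQuot.mk (K' (ψ (A.proj u)))) (Subtype.ext (A.leafMap_eq hψ hu Y).symm)
  have h3 : K' (ψ (A.proj u)) ≤ K (ψ (A.proj u)) := by
    rw [← hK _ hu, ← hK' _ hu]
    exact Submodule.map_mono (A.TP_antitone (by lia) _)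
  constructor
  · rintro ⟨_, hv, h4⟩
    rw [h2] at h4
    exact SubQuot.mk_eq_mk_iff.1 h4
  · intro h4
    have hv : v ∈ K (ψ (A.proj u)) := by
      have := Submodule.sub_mem _ h1 (h3 h4)
      rwa [sub_sub_cancel] at this
    exact ⟨hu, hv, h2.trans (SubQuot.mk_eq_mk_iff.2 h4)⟩

variable {P : Subgroup G} (hPQ : IsParabolicPair (EQ := EQ) 𝔯 e P Q)
  [FiniteDimensional ℝ 𝔤] [LieAlgebra.IsSemisimple ℝ 𝔤]
  [FiniteDimensional ℝ EP] [FiniteDimensional ℝ EM] [LieGroup 𝓘(ℝ, EQ) ∞ Q]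
include hPQ

include hK' in
/-- Membership in `𝔤^(i + 1, *)` is detected by the subbundle `K'` of `TN`. -/
lemma leafMap_mem_iff (hi : i < 0) {u : 𝒢} (hu : A.proj u ∈ U) {z : N} (hz : ψ (A.proj u) = z)
    {Y : 𝔤} : A.leafMap EN ψ u Y ∈ (K' z : Submodule ℝ EN) ↔ Y ∈ 𝔯.fil (i + 1) := by
  subst hz
  have h1 : (K' (ψ (A.proj u)) : Submodule ℝ EN) = (𝔯.fil (i + 1)).map (A.leafMap EN ψ u) :=
    (hK' _ hu).symm.trans (A.map_mfderiv_TP hψ hPQ (by lia) hu)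
  rw [h1]
  constructor
  · rintro ⟨Z, hZ, hZY⟩
    have h2 : Y - Z ∈ 𝔯.𝔭 := by
      rw [← A.leafMap_eq_zero_iff hψ hPQ hu, map_sub, hZY, sub_self]
    have h3 := add_mem (𝔯.𝔭_le_fil (by lia) h2) hZ
    rwa [sub_add_cancel] at h3
  · exact Submodule.mem_map_of_mem

variable [FiniteDimensional ℝ EQ] [FiniteDimensional ℝ EN] [IsManifold 𝓘(ℝ, EN) ∞ N]

/-- If the image of `σ` in `TN` is constant along the leaves, then `σ` is parallel. -/
lemma isParallel_of_imageCoset_eq (hi : i < 0) (hτ : A.TorsionCond 𝔯 U i (i + 1))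
    {σ : ∀ x : M, A.𝒱 𝔯 i x} (hσ : IsSmoothSection (A.TP 𝔯 i) (A.TP 𝔯 (i + 1)) U σ)
    (h : ∀ x ∈ U, ∀ y ∈ U, ψ x = ψ y → A.imageCoset hK hK' σ x = A.imageCoset hK hK' σ y) :
    A.IsParallel 𝔯 i U σ := by
  intro u w hw hu
  have hκ := (A.torsionCond_iff hPQ hi.le (show i + 1 ≤ 0 by lia)).1 hτ
  obtain ⟨n, ι, hι0, hι, hι'⟩ := exists_complement_param (𝔯.𝔭_le_fil hi.le)
  obtain ⟨O, c, hO, huO, hOU, hcs, hcσ⟩ := A.exists_coeff hPQ hψ hi hι0 hι hι' hσ hu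
  rw [A.relTractorConnection_eq_zero_iff hPQ hi hι ((hcs u huO).mdifferentiableAt (by simp))
    (by filter_upwards [hO.mem_nhds huO] with u' hu' using hcσ u' hu')]
  have hw' : mfderiv 𝓘(ℝ, EP) 𝓘(ℝ, EN) (fun u => ψ (A.proj u)) u w = 0 := by
    have := (A.leafMap_eq_zero_iff hψ hPQ hu).2 hw
    rwa [leafMap_apply, constField_conn] at this
  obtain ⟨γ, hγ, rfl, hγw, hγf⟩ := exists_curve_in_fibre_of_ker hO
    ((A.contMDiffOn_leaf hψ).mono hOU) huO (A.mfderiv_leaf_surjective hψ hu) hw'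
  set z := ψ (A.proj (γ 0)) with hz
  have h1 := A.hasDerivAt_leafMapChart_coeff hPQ hψ (z := z) ι (hγ.mdifferentiableAt (by simp)) hu
    (hγf.mono fun t ht => ht.2) (mem_chart_source EN z) ((hcs _ huO).mdifferentiableAt (by simp))
    hγw
  have h2 := mem_of_hasDerivAt (E := EN) (S := (K' z : Submodule ℝ EN)) h1 (by
    filter_upwards [hγf] with t ht
    rw [A.leafMapChart_self hψ (hOU ht.1) ht.2, A.leafMapChart_self hψ hu rfl]
    have h3 := (A.mem_imageCoset_iff hK hK' hψ hu (hι _) (hcσ _ huO)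
      (v := A.leafMap EN ψ (γ 0) (ι (c (γ 0))))).2 (by rw [sub_self]; exact zero_mem _)
    rw [h _ hu _ (hOU ht.1) ht.2.symm] at h3
    have h4 := (A.mem_imageCoset_iff hK hK' hψ (hOU ht.1) (hι _) (hcσ _ ht.1)).1 h3
    rwa [ht.2] at h4)
  rw [A.leafMapChart_self hψ hu rfl] at h2
  have h3 := add_mem ((A.leafMap_mem_iff hK' hψ hPQ hi hu rfl).1 h2)
    (hκ _ hu _ hw _ (hι (c (γ 0))))
  rwa [sub_add_cancel] at h3

/-- If `σ` is parallel, then its image in `TN` is constant along the leaves. -/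
lemma imageCoset_eq_of_isParallel (hconn : ∀ z : N, IsConnected (U ∩ ψ ⁻¹' {z})) (hi : i < 0)
    (hτ : A.TorsionCond 𝔯 U i (i + 1))
    {σ : ∀ x : M, A.𝒱 𝔯 i x} (hσ : IsSmoothSection (A.TP 𝔯 i) (A.TP 𝔯 (i + 1)) U σ)
    (h : A.IsParallel 𝔯 i U σ) {x y : M} (hx : x ∈ U) (hy : y ∈ U) (hxy : ψ x = ψ y) :
    A.imageCoset hK hK' σ x = A.imageCoset hK hK' σ y := by
  refine A.eq_of_leaf_eq hconn (fun u hu => ?_) hx hy hxy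
  have hκ := (A.torsionCond_iff hPQ hi.le (show i + 1 ≤ 0 by lia)).1 hτ
  obtain ⟨n, ι, hι0, hι, hι'⟩ := exists_complement_param (𝔯.𝔭_le_fil hi.le)
  obtain ⟨O, c, hO, huO, hOU, hcs, hcσ⟩ := A.exists_coeff hPQ hψ hi hι0 hι hι' hσ hu
  filter_upwards [eventually_exists_curve_in_fibre hO ((A.contMDiffOn_leaf hψ).mono hOU) huO
    (A.mfderiv_leaf_surjective hψ hu)] with u' hγ hu'
  obtain ⟨γ, T, hT, hIT, hγs, rfl, rfl, hγf⟩ := hγ hu'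
  set z := ψ (A.proj (γ 0)) with hz
  have h0 : (0 : ℝ) ∈ T := hIT (by simp)
  have h1 : (1 : ℝ) ∈ T := hIT (by simp)
  have hder : ∀ t ∈ T, ∃ v ∈ (K' z : Submodule ℝ EN),
      HasDerivAt (fun t => A.leafMapChart EN ψ z (γ t) (ι (c (γ t)))) v t := by
    intro t ht
    obtain ⟨htO, htz⟩ := hγf t ht
    have hfib : ∀ᶠ s in 𝓝 t, ψ (A.proj (γ s)) = ψ (A.proj (γ t)) := by
      filter_upwards [hT.mem_nhds ht] with s hs using (hγf s hs).2.trans htz.symm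
    have hγd : MDifferentiableAt 𝓘(ℝ, ℝ) 𝓘(ℝ, EP) γ t :=
      (hγs.contMDiffAt (hT.mem_nhds ht)).mdifferentiableAt (by simp)
    have hcd := (hcs _ htO).mdifferentiableAt (by simp)
    have hX := A.conn_velocity_mem_𝔭 hψ hPQ hγd (hOU htO) hfib
    refine ⟨_, ?_, A.hasDerivAt_leafMapChart_coeff hPQ hψ (z := z) ι hγd (hOU htO) hfib
      (by rw [htz]; exact mem_chart_source EN z) hcd rfl⟩
    have h2 := (A.relTractorConnection_eq_zero_iff hPQ hi hι hcd
      (by filter_upwards [hO.mem_nhds htO] with u' hu' using hcσ u' hu') _ hX).1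
      (h _ _ hX (hOU htO))
    rw [A.leafMapChart_self hψ (hOU htO) htz]
    exact (A.leafMap_mem_iff hK' hψ hPQ hi (hOU htO) htz).2
      (Submodule.sub_mem _ h2 (hκ _ (hOU htO) _ hX _ (hι _)))
  choose! f' hf' hf using hder
  have h2 := sub_mem_of_hasDerivAt (fun t ht => hf t (hIT ht)) fun t ht => hf' t (hIT ht)
  rw [A.leafMapChart_self hψ (hOU (hγf 1 h1).1) hu', A.leafMapChart_self hψ hu rfl] at h2
  ext v
  rw [A.mem_imageCoset_iff hK hK' hψ hu (hι _) (hcσ _ huO),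
    A.mem_imageCoset_iff hK hK' hψ (hOU (hγf 1 h1).1) (hι _) (hcσ _ (hγf 1 h1).1), hu']
  constructor
  · intro h3
    have h4 := Submodule.sub_mem _ h3 h2
    exact (congrArg (· ∈ (K' z : Submodule ℝ EN)) (sub_sub_sub_cancel_left _ _ _)).mp h4
  · intro h3
    have h4 := Submodule.add_mem _ h2 h3
    exact (congrArg (· ∈ (K' z : Submodule ℝ EN)) (sub_add_sub_cancel _ _ _)).mp h4

/-- The parallel sections of `𝒱_i M` are the pullbacks of the sections of the quotient `K / K'` of
subbundles of `TN`. -/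
theorem isParallel_iff_exists_pullback (hconn : ∀ z : N, IsConnected (U ∩ ψ ⁻¹' {z}))
    (hi : i < 0) (hτ : A.TorsionCond 𝔯 U i (i + 1))
    {σ : ∀ x : M, A.𝒱 𝔯 i x} (hσ : IsSmoothSection (A.TP 𝔯 i) (A.TP 𝔯 (i + 1)) U σ) :
    A.IsParallel 𝔯 i U σ ↔ ∃ s : ∀ z : N, SubQuot (K z) (K' z),
      IsSmoothSection K K' Set.univ s ∧
      ∀ (y : M) (hy : y ∈ U), A.inducedMap 𝔯 hK hK' y hy (σ y) = s (ψ y) := by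
  constructor
  · intro h
    have hex : ∀ z, ∃ v : K z, ∀ x ∈ U, ψ x = z →
        (v : TangentSpace 𝓘(ℝ, EN) z) ∈ A.imageCoset hK hK' σ x := by
      intro z
      obtain ⟨y, hy, rfl⟩ : z ∈ ψ '' U := by rw [hψ.surjective]; trivial
      obtain ⟨v, hv⟩ := SubQuot.mk_surjective (A.inducedMap 𝔯 hK hK' y hy (σ y))
      refine ⟨v, fun x hx hxy => ?_⟩
      rw [A.imageCoset_eq_of_isParallel hK hK' hψ hPQ hconn hi hτ hσ h hx hy hxy]
      exact ⟨hy, v.2, hv.symm⟩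
    choose v hv using hex
    let s : ∀ z : N, SubQuot (K z) (K' z) := fun z => SubQuot.mk (K' z) (v z)
    have hs : ∀ (y : M) (hy : y ∈ U), A.inducedMap 𝔯 hK hK' y hy (σ y) = s (ψ y) :=
      fun y hy => (hv _ y hy rfl).2.2
    refine ⟨s, fun z₀ _ => ?_, hs⟩
    obtain ⟨y, hy, rfl⟩ : z₀ ∈ ψ '' U := by rw [hψ.surjective]; trivial
    obtain ⟨W, hW, hyW, r, hr, hsr⟩ := ((A.inducesIso hψ hPQ hi hK hK').2 U subset_rfl σ
      (fun x => s (ψ x)) hψ.isOpen fun y hy => (hs y hy).symm).1 hσ y hy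
    obtain ⟨O, t, hO, hyO, -, ht, htψ⟩ := exists_local_section (hW.inter hψ.isOpen)
      (hψ.smooth.mono inter_subset_right) ⟨hyW, hy⟩ (hψ.submersion y hy)
    have hex : ∀ z, ∃ a : K z, z ∈ O → (a : TangentSpace 𝓘(ℝ, EN) z)
        = (r (t z) : TangentSpace 𝓘(ℝ, EN) (ψ (t z))) ∧
        s z = SubQuot.mk (K' z) a := by
      intro z
      by_cases hz : z ∈ O
      · obtain ⟨h1, h2⟩ := SubQuot.mk_eq_of_eq (s := s) (htψ z hz).2 (r (t z)).2
          (hsr _ (htψ z hz).1)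
        exact ⟨⟨_, h1⟩, fun _ => ⟨rfl, h2⟩⟩
      · exact ⟨0, fun h => absurd h hz⟩
    choose a ha using hex
    refine ⟨O, hO, hyO, a, fun z hz => ?_, fun z hz => (ha z hz.1).2⟩
    refine ContMDiffAt.contMDiffWithinAt ?_
    have h1 := ContMDiffAt.comp (g := fun x => (⟨ψ x, (r x : TangentSpace 𝓘(ℝ, EN) (ψ x))⟩ :
      TangentBundle 𝓘(ℝ, EN) N)) z (hr.contMDiffAt (hW.mem_nhds (htψ z hz).1.1))
      (ht.contMDiffAt (hO.mem_nhds hz))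
    refine h1.congr_of_eventuallyEq ?_
    filter_upwards [hO.mem_nhds hz] with z' hz'
    exact totalSpace_mk_congr (htψ z' hz').2.symm (ha z' hz').1
  · rintro ⟨s, -, hs⟩
    exact A.isParallel_of_imageCoset_eq hK hK' hψ hPQ hi hτ hσ fun x hx y hy hxy =>
      A.imageCoset_eq_of_pullback hK hK' hs hx hy hxy

end

end CartanGeometry

end Leaves

end RelBGG

end

theorem theorem3p2p2
    -- the semisimple Lie algebra `𝔤` with nested standard parabolic subalgebras `𝔮 ⊆ 𝔭 ⊆ 𝔤`
    {𝔤 : Type*} [LieRing 𝔤] [LieAlgebra ℝ 𝔤] [FiniteDimensional ℝ 𝔤]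
    [LieAlgebra.IsSemisimple ℝ 𝔤] (𝔯 : RelBGG.NestedParabolics 𝔤)
    -- the Lie group `G` with Lie algebra `𝔤` and the subgroups `Q ⊆ P ⊆ G`
    {EG : Type*} [NormedAddCommGroup EG] [NormedSpace ℝ EG] [FiniteDimensional ℝ EG]
    {G : Type*} [TopologicalSpace G] [ChartedSpace EG G] [Group G] [LieGroup 𝓘(ℝ, EG) ∞ G]
    (e : 𝔤 ≃ₗ⁅ℝ⁆ GroupLieAlgebra 𝓘(ℝ, EG) G) (P Q : Subgroup G)
    {EQ : Type*} [NormedAddCommGroup EQ] [NormedSpace ℝ EQ] [FiniteDimensional ℝ EQ]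
    [ChartedSpace EQ Q] [LieGroup 𝓘(ℝ, EQ) ∞ Q]
    (hPQ : RelBGG.IsParabolicPair (EQ := EQ) 𝔯 e P Q)
    -- the parabolic geometry `(𝒢 → M, ω)` of type `(G, Q)`
    {EM : Type*} [NormedAddCommGroup EM] [NormedSpace ℝ EM] [FiniteDimensional ℝ EM]
    {M : Type*} [TopologicalSpace M] [ChartedSpace EM M] [IsManifold 𝓘(ℝ, EM) ∞ M]
    {EP : Type*} [NormedAddCommGroup EP] [NormedSpace ℝ EP] [FiniteDimensional ℝ EP]
    {𝒢 : Type*} [TopologicalSpace 𝒢] [ChartedSpace EP 𝒢] [IsManifold 𝓘(ℝ, EP) ∞ 𝒢]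
    (A : RelBGG.CartanGeometry (EQ := EQ) (EP := EP) (EM := EM) e Q 𝒢 M)
    (hinv : RelBGG.IsInvolutive (A.relTangent 𝔯))
    -- the local leaf space `ψ : U → N`
    {EN : Type*} [NormedAddCommGroup EN] [NormedSpace ℝ EN] [FiniteDimensional ℝ EN]
    {N : Type*} [TopologicalSpace N] [ChartedSpace EN N] [IsManifold 𝓘(ℝ, EN) ∞ N]
    (U : Set M) (ψ : M → N)
    (hψ : RelBGG.IsLocalLeafSpace (EN := EN) (A.relTangent 𝔯) U ψ)
    (hconn : ∀ z : N, IsConnected (U ∩ ψ ⁻¹' {z}))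
    (i' : ℤ) (hi' : i' < 0) :
    -- (1)
    ((∃ K : ∀ z : N, Submodule ℝ (TangentSpace 𝓘(ℝ, EN) z),
        RelBGG.IsSmoothSubbundle K ∧ A.Corresponds 𝔯 U ψ i' K) ↔ A.TorsionCond 𝔯 U i' i') ∧
    -- (2), first part
    (A.TorsionCond 𝔯 U i' i' → A.TorsionCond 𝔯 U (i' + 1) (i' + 1) →
      ∃ (K K' : ∀ z : N, Submodule ℝ (TangentSpace 𝓘(ℝ, EN) z))
        (hK : A.Corresponds 𝔯 U ψ i' K) (hK' : A.Corresponds 𝔯 U ψ (i' + 1) K'),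
        RelBGG.IsSmoothSubbundle K ∧ RelBGG.IsSmoothSubbundle K' ∧ A.InducesIso 𝔯 hK hK') ∧
    -- (2), second part
    (A.TorsionCond 𝔯 U i' (i' + 1) →
      ∃ (K K' : ∀ z : N, Submodule ℝ (TangentSpace 𝓘(ℝ, EN) z))
        (hK : A.Corresponds 𝔯 U ψ i' K) (hK' : A.Corresponds 𝔯 U ψ (i' + 1) K'),
        RelBGG.IsSmoothSubbundle K ∧ RelBGG.IsSmoothSubbundle K' ∧ A.InducesIso 𝔯 hK hK' ∧
        ∀ σ : ∀ x : M, A.𝒱 𝔯 i' x,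
          RelBGG.IsSmoothSection (A.TP 𝔯 i') (A.TP 𝔯 (i' + 1)) U σ →
          (A.IsParallel 𝔯 i' U σ ↔
            ∃ s : ∀ z : N, RelBGG.SubQuot (K z) (K' z),
              RelBGG.IsSmoothSection K K' Set.univ s ∧
              ∀ (y : M) (hy : y ∈ U), A.inducedMap 𝔯 hK hK' y hy (σ y) = s (ψ y))) := by
  have hi : i' ≤ 0 := hi'.le
  have hi1 : i' + 1 ≤ 0 := by lia
  refine ⟨⟨fun ⟨K, _, hK⟩ => A.torsionCond_of_corresponds hψ hPQ hi hK,
    A.exists_subbundle hψ hPQ hconn hi⟩, fun h h' => ?_, fun h => ?_⟩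
  · obtain ⟨K, hKs, hK⟩ := A.exists_subbundle hψ hPQ hconn hi h
    obtain ⟨K', hKs', hK'⟩ := A.exists_subbundle hψ hPQ hconn hi1 h'
    exact ⟨K, K', hK, hK', hKs, hKs', A.inducesIso hψ hPQ hi' hK hK'⟩
  · have hfil := 𝔯.fil_antitone (show i' ≤ i' + 1 by lia)
    have hκ := (A.torsionCond_iff hPQ hi hi1).1 h
    obtain ⟨K, hKs, hK⟩ := A.exists_subbundle hψ hPQ hconn hi ((A.torsionCond_iff hPQ hi hi).2
      fun u hu X hX Y hY => hfil (hκ u hu X hX Y hY))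
    obtain ⟨K', hKs', hK'⟩ := A.exists_subbundle hψ hPQ hconn hi1 ((A.torsionCond_iff hPQ hi1 hi1).2
      fun u hu X hX Y hY => hκ u hu X hX Y (hfil hY))
    exact ⟨K, K', hK, hK', hKs, hKs', A.inducesIso hψ hPQ hi' hK hK', fun σ hσ =>
      A.isParallel_iff_exists_pullback hK hK' hψ hPQ hconn hi' h hσ⟩
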